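/- Let $\mathfrak g$ be a compact simple Lie algebra, $G$ the corresponding compact connected simply connected Lie group, $T$ a maximal torus with Lie algebra $\mathfrak t$, $W$ the Weyl group, and $w\mapsto(-1)^{\ell(w)}$ its alternating character (equal to $-1$ on reflections). The real roots are the nonzero $\alpha\in\mathfrak t^*$ such that $2\pi i\alpha$ is a weight of $\mathfrak t$ on $\mathfrak g\otimes\mathbb C$. Let $\Lambda\subset\mathfrak t$ be the integral lattice, i.e. the lattice generated by the coroots $\alpha^\vee$, and let $B$ be the basic inner product, i.e. the invariant inner product on $\mathfrak g$ with $B(\alpha^\vee,\alpha^\vee)=2$ for every long root $\alpha$; it identifies $\mathfrak t^*$ with $\mathfrak t$ and so the dual lattice $\Lambda^*$ with a lattice in $\mathfrak t$. Fix a set of positive roots, let $\alpha_0$ be the highest root, and let $$\mathfrak A=\{\lambda\in\mathfrak t:\ \alpha(\lambda)>0\ \text{for every positive root }\alpha,\ \alpha_0(\lambda)<1\}$$ be the open fundamental alcove. On $\mathfrak t^2=\{(p,q)\}$ let $\omega=2\pi B(dp,dq)$, and equip the trivial line bundle $\mathfrak t^2\times\mathbb C$ with the connection $d+\frac{\pi}{i}\bigl(B(p,dq)-B(q,dp)\bigr)$.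 The lattice $\Lambda^2$ acts on it by $$\gamma\cdot(x,z)=\bigl(\gamma+x,\ e^{i\pi B(\dot p,\dot q)}\,e^{\frac i2\omega(\gamma,x)}\,z\bigr),\qquad \gamma=(\dot p,\dot q)\in\Lambda^2,$$ and $L$ is the quotient line bundle over $T^2=\mathfrak t^2/\Lambda^2$. The Weyl group acts on $L$ by the diagonal action on $\mathfrak t^2$, lifted trivially. Let $\tau\in\mathbb C$ with $\operatorname{Im}\tau>0$, let $\mathfrak t^2$ have the complex structure given by the coordinate $\zeta=p+\tau q\in\mathfrak t\otimes\mathbb C$, and let $k\ge1$ be an integer. The holomorphic sections of $L^k$ are those whose covariant derivative along the vectors of type $(0,1)$ vanishes, and a section $\Psi$ is alternating if $w\cdot\Psi=(-1)^{\ell(w)}\Psi$ for all $w\in W$. Extend $B$ to $\mathfrak t\otimes \mathbb C$ as a $\mathbb C$-bilinear form, put $s=\exp(i\pi B(\zeta,q))$, and for $\mu\in\mathfrak t$ put $$\Theta_{\mu,k}(p,q)=\sum_{\gamma\in\mu+\Lambda}\exp\Bigl(2i\pi k\bigl(\tfrac\tau2B(\gamma,\gamma)-B(\zeta,\gamma)\bigr)\Bigr),\qquad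 \chi_{\mu,k}=\sum_{w\in W}(-1)^{\ell(w)}\,\Theta_{w(\mu),k}\,s^k .$$ Then $W$ is finite, these series converge absolutely, and the family $(\chi_{\mu,k})$, $\mu\in\mathfrak A\cap k^{-1}\Lambda^*$, is a basis of the complex vector space of alternating holomorphic sections of $L^k$ (sections of $L^k$ being regarded as $\Lambda^2$-invariant sections over $\mathfrak t^2$). -/

import Mathlib

open scoped TensorProduct

noncomputable section

namespace ThetaAlt

/-! ### Roots of a torus in a real Lie algebra -/

section Roots

variable {𝔤 : Type*} [LieRing 𝔤] [LieAlgebra ℝ 𝔤]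

/-- The real roots of `(𝔤, 𝔱)`: the nonzero linear forms `α : 𝔱 → ℝ` for which some nonzero vector
`X + i Y` of the complexification `𝔤_ℂ = 𝔤 ⊕ i 𝔤` satisfies `[H, X + i Y] = 2 π i α(H) (X + i Y)` for
every `H ∈ 𝔱`; the real and imaginary parts of this equation are written separately. -/
def realRoots (𝔱 : LieSubalgebra ℝ 𝔤) : Set (Module.Dual ℝ 𝔱) :=
  {α | α ≠ 0 ∧ ∃ X Y : 𝔤, (X ≠ 0 ∨ Y ≠ 0) ∧ ∀ H : 𝔱,
    ⁅(H : 𝔤), X⁆ = -(2 * Real.pi * α H) • Y ∧ ⁅(H : 𝔤), Y⁆ = (2 * Real.pi * α H) • X}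

/-- The restriction to `𝔱` of a bilinear form on `𝔤`. -/
def torusForm (B : LinearMap.BilinForm ℝ 𝔤) (𝔱 : LieSubalgebra ℝ 𝔤) : LinearMap.BilinForm ℝ 𝔱 :=
  B.compl₁₂ (𝔱.incl : 𝔱 →ₗ[ℝ] 𝔤) (𝔱.incl : 𝔱 →ₗ[ℝ] 𝔤)

end Roots

/-! ### Coroots, Weyl group, lattices and alcove
Here `V` is a real vector space, `B` an inner product on it and `Φ` a set of roots in the dual of `V`. -/

section RootData

variable {V : Type*} [AddCommGroup V] [Module ℝ V]

/-- `a` is the vector that corresponds to the linear form `α` under the identification of `V` with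
its dual by `B`. -/
def IsDualVector (B : LinearMap.BilinForm ℝ V) (α : Module.Dual ℝ V) (a : V) : Prop :=
  ∀ v : V, B a v = α v

/-- `x` is the coroot of `α`, that is, `x = 2 a / B(a, a)`, with `a` the vector corresponding
to `α`. -/
def IsCoroot (B : LinearMap.BilinForm ℝ V) (α : Module.Dual ℝ V) (x : V) : Prop :=
  ∃ a : V, IsDualVector B α a ∧ x = (2 / B a a) • a

/-- `α` is a long root: a root of maximal length. -/
def IsLongRoot (B : LinearMap.BilinForm ℝ V) (Φ : Set (Module.Dual ℝ V)) (α : Module.Dual ℝ V) :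
    Prop :=
  α ∈ Φ ∧ ∀ β ∈ Φ, ∀ a b : V, IsDualVector B α a → IsDualVector B β b → B b b ≤ B a a

/-- The lattice `Λ` generated by the coroots: the integral lattice of the maximal torus of the
simply connected group. -/
def corootLattice (B : LinearMap.BilinForm ℝ V) (Φ : Set (Module.Dual ℝ V)) : AddSubgroup V :=
  AddSubgroup.closure {x | ∃ α ∈ Φ, IsCoroot B α x}

/-- The Weyl group `W`, generated by the reflections `v ↦ v - α(v) α^∨`. -/
def weylGroup (B : LinearMap.BilinForm ℝ V) (Φ : Set (Module.Dual ℝ V)) : Subgroup (V ≃ₗ[ℝ] V) :=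
  Subgroup.closure {s | ∃ α ∈ Φ, ∃ x : V, IsCoroot B α x ∧ ∀ v : V, s v = v - α v • x}

/-- The alternating character `w ↦ (-1)^{ℓ(w)}` of the Weyl group: the determinant of `w` on `V`. -/
def altSign (w : V ≃ₗ[ℝ] V) : ℂ := ((LinearMap.det (w : V →ₗ[ℝ] V) : ℝ) : ℂ)

/-- `k⁻¹ Λ*`, where the dual lattice `Λ*` of `Λ` is seen in `V` by means of `B`. -/
def scaledDualLattice (B : LinearMap.BilinForm ℝ V) (Φ : Set (Module.Dual ℝ V)) (k : ℕ) : Set V :=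
  {μ | ∀ γ ∈ corootLattice B Φ, ∃ m : ℤ, B ((k : ℝ) • μ) γ = m}

/-- `Φp` is a set of positive roots of `Φ`: the roots which are positive on some element of `V`
on which no root vanishes. -/
def IsPositiveSystem (Φ Φp : Set (Module.Dual ℝ V)) : Prop :=
  ∃ ρ : V, (∀ α ∈ Φ, α ρ ≠ 0) ∧ Φp = {α | α ∈ Φ ∧ 0 < α ρ}

/-- `α₀` is the highest root: `α₀ - β` is a sum of positive roots (possibly none) for every
root `β`. -/
def IsHighestRoot (Φ Φp : Set (Module.Dual ℝ V)) (α₀ : Module.Dual ℝ V) : Prop :=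
  α₀ ∈ Φ ∧ ∀ β ∈ Φ, α₀ - β ∈ AddSubmonoid.closure Φp

/-- The open fundamental alcove. -/
def alcove (Φp : Set (Module.Dual ℝ V)) (α₀ : Module.Dual ℝ V) : Set V :=
  {v | (∀ α ∈ Φp, 0 < α v) ∧ α₀ v < 1}

end RootData

/-- `B` is the basic inner product of `𝔤` (with maximal torus `𝔱`): an invariant inner product with
`B(α^∨, α^∨) = 2` for each long root `α`. -/
structure IsBasicInnerProduct {𝔤 : Type*} [LieRing 𝔤] [LieAlgebra ℝ 𝔤] (𝔱 : LieSubalgebra ℝ 𝔤)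
    (B : LinearMap.BilinForm ℝ 𝔤) : Prop where
  symm : ∀ x y : 𝔤, B x y = B y x
  pos : ∀ x : 𝔤, x ≠ 0 → 0 < B x x
  invariant : ∀ x y z : 𝔤, B ⁅x, y⁆ z = B x ⁅y, z⁆
  normalized : ∀ α : Module.Dual ℝ 𝔱, IsLongRoot (torusForm B 𝔱) (realRoots 𝔱) α →
    ∀ x : 𝔱, IsCoroot (torusForm B 𝔱) α x → B x x = 2

/-! ### The prequantum bundle and its sections
The `k`-th power of the trivial prequantum line bundle over `V²` is `V² × ℂ`; its sections are the
functions `F : V² → ℂ`. The bundle `L^k` over the torus `V² / Λ²` is the quotient of `V² × ℂ` by an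
action of `Λ²`, so that the sections of `L^k` are the sections `F` invariant under `Λ²`. -/

section Sections

variable {V : Type*} [AddCommGroup V] [Module ℝ V]

/-- The symplectic form `ω = 2 π B(dp, dq)` on `V²`. -/
def symp (B : LinearMap.BilinForm ℝ V) (x y : V × V) : ℝ :=
  2 * Real.pi * (B x.1 y.2 - B y.1 x.2)

/-- The action of the Heisenberg group `V² × U(1)` on the `k`-th power of the prequantum bundle:
`(x, u) . (y, z) = (x + y, u^k z exp (i k ω(x, y) / 2))`. -/
def heisAct (B : LinearMap.BilinForm ℝ V) (k : ℕ) (h : (V × V) × Circle) (e : (V × V) × ℂ) :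
    (V × V) × ℂ :=
  (h.1 + e.1, (h.2 : ℂ) ^ k * e.2 * Complex.exp ((k : ℂ) * (Complex.I / 2) * (symp B h.1 e.1 : ℂ)))

/-- The embedding `(p, q) ↦ (p, q, exp (i π B(p, q)))` of `Λ²` into the Heisenberg group. -/
def latticeLift (B : LinearMap.BilinForm ℝ V) (γ : V × V) : (V × V) × Circle :=
  (γ, Circle.exp (Real.pi * B γ.1 γ.2))

/-- The section `F` is invariant under the action of `Λ²`: each element of `Λ²` maps the value of
`F` at `x` to its value at the translated point. -/
def IsLatticeInvariant (B : LinearMap.BilinForm ℝ V) (Λ : AddSubgroup V) (k : ℕ) (F : V × V → ℂ) :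
    Prop :=
  ∀ γ : V × V, γ.1 ∈ Λ → γ.2 ∈ Λ → ∀ x : V × V,
    heisAct B k (latticeLift B γ) (x, F x) = (γ + x, F (γ + x))

/-- The covariant derivative of the section `F` at `x = (p, q)` in the direction `v`, for the
connection `d + k (π / i) (B(p, dq) - B(q, dp))`. -/
def covDeriv (B : LinearMap.BilinForm ℝ V) (k : ℕ) (F : V × V → ℂ) (x v : V × V) : ℂ :=
  lineDeriv ℝ F x v +
    (k : ℂ) * ((Real.pi : ℂ) / Complex.I) * ((B x.1 v.2 - B x.2 v.1 : ℝ) : ℂ) * F x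

/-- The complex coordinate `ζ = p + τ q` on `V²`, with values in `V_ℂ = ℂ ⊗ V`. It transports the
complex structure of `V_ℂ` to `V²`. -/
def zeta (τ : UpperHalfPlane) (x : V × V) : ℂ ⊗[ℝ] V :=
  (1 : ℂ) ⊗ₜ[ℝ] x.1 + (τ : ℂ) ⊗ₜ[ℝ] x.2

/-- `F` is continuously differentiable on the finite dimensional space `V²` (in linear
coordinates). -/
def IsC1 (F : V × V → ℂ) : Prop :=
  ∀ (n : ℕ) (A : (Fin n → ℝ) →ₗ[ℝ] V × V), ContDiff ℝ 1 (fun c => F (A c))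

/-- `F` is a holomorphic section: it is of class `C¹` and its covariant derivative vanishes along
the vectors `v + i j v` of type `(0, 1)`, where `j` is the complex structure `ζ (j v) = i ζ (v)`. -/
def IsHolomorphicSection (B : LinearMap.BilinForm ℝ V) (τ : UpperHalfPlane) (k : ℕ)
    (F : V × V → ℂ) : Prop :=
  IsC1 F ∧ ∀ x v v' : V × V, zeta τ v' = Complex.I • zeta τ v →
    covDeriv B k F x v + Complex.I * covDeriv B k F x v' = 0

/-- The action of a linear automorphism of `V` on the sections, induced by the diagonal action on
`V²`, lifted trivially to the line bundle. -/
def weylAct (w : V ≃ₗ[ℝ] V) (F : V × V → ℂ) : V × V → ℂ :=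
  fun x => F (w.symm x.1, w.symm x.2)

/-- A `C¹` function is differentiable along lines. -/
theorem IsC1.lineDifferentiableAt {F : V × V → ℂ} (hF : IsC1 F) (x v : V × V) :
    LineDifferentiableAt ℝ F x v := by
  have h := hF 2 ((LinearMap.proj (0 : Fin 2) : (Fin 2 → ℝ) →ₗ[ℝ] ℝ).smulRight x +
    (LinearMap.proj (1 : Fin 2) : (Fin 2 → ℝ) →ₗ[ℝ] ℝ).smulRight v)
  have h1 : Differentiable ℝ (fun t : ℝ => (![1, t] : Fin 2 → ℝ)) := by
    rw [differentiable_pi]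
    intro i
    fin_cases i
    · simp
    · simp
  have h2 := (h.differentiable one_ne_zero).comp h1
  have h3 : Differentiable ℝ (fun t : ℝ => F (x + t • v)) := by
    refine (Iff.of_eq (congrArg (Differentiable ℝ) ?_)).mp h2
    funext t
    simp
  exact h3 0

/-- The space `H⁰_τ` of holomorphic sections of `L^k` over the torus `V² / Λ²`. -/
def holSections (B : LinearMap.BilinForm ℝ V) (Λ : AddSubgroup V) (τ : UpperHalfPlane) (k : ℕ) :
    Submodule ℂ (V × V → ℂ) where
  carrier := {F | IsLatticeInvariant B Λ k F ∧ IsHolomorphicSection B τ k F}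
  zero_mem' := by
    refine ⟨?_, ?_, ?_⟩
    · intro γ _ _ x
      simp [heisAct, latticeLift]
    · intro n A
      exact contDiff_const
    · intro x v v' _
      have h : ∀ u : V × V, lineDeriv ℝ (0 : V × V → ℂ) x u = 0 := by
        intro u
        simp [lineDeriv]
      simp [covDeriv, h]
  add_mem' := by
    rintro F G ⟨hF, hF1, hF2⟩ ⟨hG, hG1, hG2⟩
    refine ⟨?_, ?_, ?_⟩
    · intro γ h1 h2 x
      have e1 := congrArg Prod.snd (hF γ h1 h2 x)
      have e2 := congrArg Prod.snd (hG γ h1 h2 x)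
      simp only [heisAct, latticeLift] at e1 e2
      simp only [heisAct, latticeLift, Pi.add_apply, ← e1, ← e2]
      refine Prod.ext rfl ?_
      simp only
      ring
    · intro n A
      exact (hF1 n A).add (hG1 n A)
    · intro x v v' h
      have e1 := hF2 x v v' h
      have e2 := hG2 x v v' h
      have hadd : ∀ u : V × V, lineDeriv ℝ (F + G) x u = lineDeriv ℝ F x u + lineDeriv ℝ G x u := by
        intro u
        exact deriv_add (hF1.lineDifferentiableAt x u) (hG1.lineDifferentiableAt x u)
      simp only [covDeriv, hadd, Pi.add_apply] at e1 e2 ⊢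
      linear_combination e1 + e2
  smul_mem' := by
    rintro c F ⟨hF, hF1, hF2⟩
    refine ⟨?_, ?_, ?_⟩
    · intro γ h1 h2 x
      have e1 := congrArg Prod.snd (hF γ h1 h2 x)
      simp only [heisAct, latticeLift] at e1
      simp only [heisAct, latticeLift, Pi.smul_apply, smul_eq_mul, ← e1]
      refine Prod.ext rfl ?_
      simp only
      ring
    · intro n A
      exact contDiff_const.mul (hF1 n A)
    · intro x v v' h
      have e1 := hF2 x v v' h
      have hsmul : ∀ u : V × V, lineDeriv ℝ (c • F) x u = c * lineDeriv ℝ F x u := by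
        intro u
        exact deriv_const_mul c (hF1.lineDifferentiableAt x u)
      simp only [covDeriv, hsmul, Pi.smul_apply, smul_eq_mul] at e1 ⊢
      linear_combination c * e1

/-- The sections that are alternating under the group `W`. -/
def alternating (W : Subgroup (V ≃ₗ[ℝ] V)) : Submodule ℂ (V × V → ℂ) where
  carrier := {F | ∀ w ∈ W, weylAct w F = altSign w • F}
  zero_mem' := by
    intro w _
    funext x
    simp [weylAct]
  add_mem' := by
    intro F G hF hG w hw
    rw [smul_add, ← hF w hw, ← hG w hw]
    rfl
  smul_mem' := by
    intro c F hF w hw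
    rw [smul_comm, ← hF w hw]
    rfl

/-- The space of alternating holomorphic sections of `L^k`. -/
def altHolSections (B : LinearMap.BilinForm ℝ V) (Φ : Set (Module.Dual ℝ V)) (τ : UpperHalfPlane)
    (k : ℕ) : Submodule ℂ (V × V → ℂ) :=
  holSections B (corootLattice B Φ) τ k ⊓ alternating (weylGroup B Φ)

/-! ### Theta functions -/

/-- `B(ζ, v)` for `ζ = p + τ q` and `v ∈ V`, with `B` extended to a `ℂ`-bilinear form. -/
def zetaForm (B : LinearMap.BilinForm ℝ V) (τ : UpperHalfPlane) (x : V × V) (v : V) : ℂ :=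
  ((B x.1 v : ℝ) : ℂ) + (τ : ℂ) * ((B x.2 v : ℝ) : ℂ)

/-- The section `s = exp (i π B(ζ, q))`. -/
def refSection (B : LinearMap.BilinForm ℝ V) (τ : UpperHalfPlane) (x : V × V) : ℂ :=
  Complex.exp (Complex.I * (Real.pi : ℂ) * zetaForm B τ x x.2)

/-- The term `exp (2 i π k (τ B(γ, γ) / 2 - B(ζ, γ)))` of the theta series. -/
def thetaTerm (B : LinearMap.BilinForm ℝ V) (τ : UpperHalfPlane) (k : ℕ) (γ : V) (x : V × V) : ℂ :=
  Complex.exp (2 * Complex.I * (Real.pi : ℂ) * (k : ℂ) *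
    ((τ : ℂ) / 2 * ((B γ γ : ℝ) : ℂ) - zetaForm B τ x γ))

/-- The theta function `Θ_{μ,k}`: the sum of the terms above over `γ ∈ μ + Λ`. -/
def theta (B : LinearMap.BilinForm ℝ V) (Λ : AddSubgroup V) (τ : UpperHalfPlane) (k : ℕ) (μ : V)
    (x : V × V) : ℂ :=
  ∑' γ : Λ, thetaTerm B τ k (μ + (γ : V)) x

/-- The alternating sum `χ_{μ,k} = ∑_{w ∈ W} (-1)^{ℓ(w)} Θ_{w(μ),k} s^k`. -/
def chi (B : LinearMap.BilinForm ℝ V) (Φ : Set (Module.Dual ℝ V)) (τ : UpperHalfPlane) (k : ℕ)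
    (μ : V) : V × V → ℂ :=
  fun x => ∑ᶠ w : weylGroup B Φ, altSign (w : V ≃ₗ[ℝ] V) *
    (theta B (corootLattice B Φ) τ k ((w : V ≃ₗ[ℝ] V) μ) x * refSection B τ x ^ k)

end Sections

end ThetaAlt

end

/-! The section $s^k$ vanishes nowhere. Dividing by it makes the connection form of type $(1,0)$, so
a holomorphic section becomes a function $H$ that is holomorphic in $\zeta=p+\tau q$,
$\Lambda$-periodic in $p$, and multiplied by the classical exponential factor under translations of
$q$ (`covDeriv_mul_refSection_eq_zero_iff`, `isLatticeInvariant_mul_refSection_iff`).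

Expand $H(\cdot,q)$ in a Fourier series; its frequencies are indexed by $k^{-1}\Lambda^*$. The
Cauchy-Riemann equations fix the dependence of each coefficient on $q$ (`fiberCoeff_eq`), and
quasi-periodicity in $q$ relates the coefficients at $\mu$ and $\mu+\gamma$ (`fiberCoeff_add`). Once
a Gaussian factor is removed, what remains is a $\Lambda$-periodic function $d$ on
$k^{-1}\Lambda^*$. Hence holomorphic sections of $L^k$ are exactly the theta series `thetaSum` with
periodic coefficients, and $d$ is unique (`exists_thetaSum_eq`, `thetaSum_mul_mem_holSections`,
`eq_zero_of_thetaSum_eq_zero`).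

The Weyl group acts by permuting coefficients, so a section is alternating exactly when
$d(w\mu)=(-1)^{\ell(w)}d(\mu)$ (`thetaSum_mem_alternating_iff`). Such a $d$ vanishes wherever some
root is integral, because an affine reflection fixes the point and changes the sign. Every other
point has exactly one image in the open alcove under $W\ltimes\Lambda$ (`exists_mem_alcove`,
`eq_one_of_mem_alcove`). So $d$ is given by arbitrary values on $\mathfrak A\cap k^{-1}\Lambda^*$,
and the coefficients of $\chi_{\mu,k}$ restrict there to the delta function at $\mu$
(`chiCoeff_alcove`).

All this needs only a reduced crystallographic root system whose coroots have even square length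
(`IsRootData`); evenness makes $\Lambda$ integral, so that $\Lambda\subseteq k^{-1}\Lambda^*$. The
root system axioms come from the complexification, where the Killing form is nondegenerate and the
torus becomes a Cartan subalgebra. Evenness comes from the normalisation on long roots: by
irreducibility each root is non-orthogonal to some long root (`exists_long_not_orthogonal`), and
Cauchy-Schwarz leaves few cases (`exists_form_coroot_eq`). -/

namespace ThetaAlt

open Module

/-! ### Euclidean root systems, coroots and the Weyl group. -/

section RootDataTheory

variable {V : Type*} [NormedAddCommGroup V] [InnerProductSpace ℝ V] [FiniteDimensional ℝ V]

/-- The vector corresponding to a linear form under the inner product. -/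
noncomputable def dualVec (α : Dual ℝ V) : V :=
  (InnerProductSpace.toDual ℝ V).symm (LinearMap.toContinuousLinearMap α)

theorem inner_dualVec (α : Dual ℝ V) (v : V) : inner ℝ (dualVec α) v = α v := by
  simp [dualVec]

theorem dualVec_ne_zero {α : Dual ℝ V} (h : α ≠ 0) : dualVec α ≠ 0 := by
  intro h0
  apply h
  ext v
  rw [← inner_dualVec, h0]
  simp

/-- The coroot of a linear form. -/
noncomputable def corootVec (α : Dual ℝ V) : V :=
  (2 / inner ℝ (dualVec α) (dualVec α)) • dualVec α

theorem apply_corootVec_self {α : Dual ℝ V} (h : α ≠ 0) : α (corootVec α) = 2 := by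
  have h1 : inner ℝ (dualVec α) (dualVec α) ≠ 0 := inner_self_ne_zero.mpr (dualVec_ne_zero h)
  rw [corootVec, map_smul, ← inner_dualVec α (dualVec α), smul_eq_mul]
  field_simp

theorem inner_corootVec_self_pos {α : Dual ℝ V} (h : α ≠ 0) :
    0 < inner ℝ (corootVec α) (corootVec α) := by
  refine real_inner_self_pos.mpr fun h0 => ?_
  have := apply_corootVec_self h
  rw [h0, map_zero] at this
  norm_num at this

/-- `⟨α^∨, v⟩ = (⟨α^∨, α^∨⟩ / 2) α(v)`. -/
theorem inner_corootVec {α : Dual ℝ V} (h : α ≠ 0) (v : V) :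
    inner ℝ (corootVec α) v = inner ℝ (corootVec α) (corootVec α) / 2 * α v := by
  have h2 : ∀ v, inner ℝ (corootVec α) v = 2 / inner ℝ (dualVec α) (dualVec α) * α v := by
    intro v
    rw [corootVec, real_inner_smul_left, inner_dualVec α v]
  rw [h2 v, h2 (corootVec α), apply_corootVec_self h]
  ring

variable {B : LinearMap.BilinForm ℝ V} {Φ : Set (Dual ℝ V)}

/-- The properties of the roots of a compact simple Lie algebra and of the basic inner product that
are used below: a reduced crystallographic root system, with coroots of even square length. -/
structure IsRootData (B : LinearMap.BilinForm ℝ V) (Φ : Set (Dual ℝ V)) : Prop where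
  form_eq : ∀ x y, B x y = inner ℝ x y
  finite : Φ.Finite
  zero_notMem : 0 ∉ Φ
  span_eq : Submodule.span ℝ Φ = ⊤
  refl : ∀ α ∈ Φ, ∀ β ∈ Φ, β - β (corootVec α) • α ∈ Φ
  integral : ∀ α ∈ Φ, ∀ β ∈ Φ, ∃ m : ℤ, β (corootVec α) = m
  reduced : ∀ α ∈ Φ, ∀ c : ℝ, c • α ∈ Φ → c = 1 ∨ c = -1
  norm : ∀ α ∈ Φ, ∃ m : ℤ, B (corootVec α) (corootVec α) = 2 * m

namespace IsRootData

variable (h : IsRootData B Φ)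
include h

theorem isDualVector_iff (α : Dual ℝ V) (a : V) : IsDualVector B α a ↔ a = dualVec α := by
  constructor
  · intro ha
    refine ext_inner_right ℝ fun v => ?_
    rw [← h.form_eq, ha v, inner_dualVec]
  · rintro rfl v
    rw [h.form_eq, inner_dualVec]

theorem isCoroot_iff (α : Dual ℝ V) (x : V) : IsCoroot B α x ↔ x = corootVec α := by
  constructor
  · rintro ⟨a, ha, rfl⟩
    rw [h.isDualVector_iff] at ha
    rw [corootVec, h.form_eq, ha]
  · rintro rfl
    exact ⟨dualVec α, (h.isDualVector_iff _ _).mpr rfl, by rw [corootVec, h.form_eq]⟩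

theorem ne_zero {α : Dual ℝ V} (hα : α ∈ Φ) : α ≠ 0 := fun h0 => h.zero_notMem (h0 ▸ hα)

theorem neg_mem {α : Dual ℝ V} (hα : α ∈ Φ) : -α ∈ Φ := by
  have := h.refl α hα α hα
  rw [apply_corootVec_self (h.ne_zero hα)] at this
  convert this using 1
  module

theorem corootVec_injOn : Set.InjOn corootVec Φ := by
  intro α hα β hβ hab
  ext v
  have h1 := inner_corootVec (h.ne_zero hα) v
  have h2 := inner_corootVec (h.ne_zero hβ) v
  have h3 := inner_corootVec_self_pos (h.ne_zero hα)
  rw [hab] at h1 h3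
  rw [h1] at h2
  have h4 : inner ℝ (corootVec β) (corootVec β) / 2 ≠ 0 := by positivity
  exact mul_left_cancel₀ h4 h2

theorem eq_zero_of_forall {v : V} (hv : ∀ α ∈ Φ, α v = 0) : v = 0 := by
  rw [← Module.forall_dual_apply_eq_zero_iff ℝ v]
  intro f
  have hf : f ∈ Submodule.span ℝ Φ := by rw [h.span_eq]; trivial
  induction hf using Submodule.span_induction with
  | mem x hx => exact hv x hx
  | zero => rfl
  | add x y _ _ hx hy => simp [hx, hy]
  | smul a x _ hx => simp [hx]

/-- The root system, as a root pairing between the dual of `V` and `V`. -/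
noncomputable def pairing : RootPairing Φ ℝ (Dual ℝ V) V :=
  have := h.finite.to_subtype
  RootPairing.mk'' (ι := Φ) (p := LinearMap.id)
    (root := ⟨Subtype.val, Subtype.val_injective⟩)
    (coroot := ⟨fun α => corootVec (α : Dual ℝ V),
      fun α β hab => Subtype.ext (h.corootVec_injOn α.2 β.2 hab)⟩)
    (hp := fun α => apply_corootVec_self (h.ne_zero α.2))
    (hs := by
      rintro α - ⟨β, rfl⟩
      exact ⟨⟨_, h.refl α α.2 β β.2⟩, rfl⟩)
    (hsp := by simpa using h.span_eq)

theorem pairing_root (i : Φ) : h.pairing.root i = i := rfl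

theorem isRootSystem_pairing : h.pairing.IsRootSystem :=
  have := h.finite.to_subtype
  RootPairing.isRootSystem_mk'' (hsp := by simpa using h.span_eq) fun i j => by
    obtain ⟨m, hm⟩ := h.integral j j.2 i i.2
    exact ⟨m, hm.symm⟩

theorem isCrystallographic_pairing : h.pairing.IsCrystallographic where
  exists_value i j := by
    obtain ⟨m, hm⟩ := h.integral j j.2 i i.2
    exact ⟨m, hm.symm⟩

theorem isReduced_pairing : h.pairing.IsReduced where
  eq_or_eq_neg i j hij := by
    rw [LinearIndependent.pair_iff' (h.pairing.ne_zero i), not_forall] at hij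
    obtain ⟨c, hc⟩ := hij
    rw [not_not] at hc
    rcases h.reduced i i.2 c (by rw [← h.pairing_root, hc]; exact j.2) with rfl | rfl
    · left; rw [← hc, one_smul]
    · right; rw [← hc]; module

/-- The reflection in the root `α`. -/
noncomputable def sreflection (i : Φ) : V ≃ₗ[ℝ] V := h.pairing.coreflection i

theorem sreflection_apply (i : Φ) (v : V) :
    h.sreflection i v = v - (i : Dual ℝ V) v • corootVec (i : Dual ℝ V) :=
  h.pairing.coreflection_apply i v

theorem weylGroup_eq : weylGroup B Φ = Subgroup.closure (Set.range h.sreflection) := by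
  unfold weylGroup
  congr 1
  ext s
  constructor
  · rintro ⟨α, hα, x, hx, hs⟩
    refine ⟨⟨α, hα⟩, ?_⟩
    ext v
    rw [h.sreflection_apply, hs, (h.isCoroot_iff _ _).mp hx]
  · rintro ⟨i, rfl⟩
    exact ⟨i, i.2, _, (h.isCoroot_iff _ _).mpr rfl, h.sreflection_apply i⟩

theorem sreflection_mem (i : Φ) : h.sreflection i ∈ weylGroup B Φ := by
  rw [h.weylGroup_eq]
  exact Subgroup.subset_closure ⟨i, rfl⟩

theorem sreflection_mul_self (i : Φ) : h.sreflection i * h.sreflection i = 1 := by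
  ext v
  exact h.pairing.coreflection_same i v

theorem sreflection_inv (i : Φ) : (h.sreflection i)⁻¹ = h.sreflection i :=
  h.pairing.coreflection_inv i

theorem inner_sreflection (i : Φ) (x y : V) :
    inner ℝ (h.sreflection i x) (h.sreflection i y) = inner ℝ x y := by
  have hi := h.ne_zero i.2
  simp only [h.sreflection_apply, inner_sub_left, inner_sub_right, real_inner_smul_left,
    real_inner_smul_right]
  rw [real_inner_comm (corootVec (i : Dual ℝ V)) x, inner_corootVec hi x, inner_corootVec hi y]
  ring

theorem inner_weyl {w : V ≃ₗ[ℝ] V} (hw : w ∈ weylGroup B Φ) :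
    ∀ x y, inner ℝ (w x) (w y) = inner ℝ x y := by
  rw [h.weylGroup_eq] at hw
  induction hw using Subgroup.closure_induction with
  | mem s hs =>
    obtain ⟨i, rfl⟩ := hs
    exact h.inner_sreflection i
  | one => intro x y; rfl
  | mul u v _ _ hu hv => intro x y; exact (hu _ _).trans (hv _ _)
  | inv u _ hu =>
    intro x y
    rw [← hu]
    exact congrArg₂ _ (u.apply_symm_apply x) (u.apply_symm_apply y)

theorem form_weyl {w : V ≃ₗ[ℝ] V} (hw : w ∈ weylGroup B Φ) (x y : V) :
    B (w x) (w y) = B x y := by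
  rw [h.form_eq, h.form_eq, h.inner_weyl hw]

theorem comp_weyl_mem {w : V ≃ₗ[ℝ] V} (hw : w ∈ weylGroup B Φ) :
    ∀ α ∈ Φ, α ∘ₗ (w : V →ₗ[ℝ] V) ∈ Φ := by
  -- Both `w` and its inverse are carried through the induction, so that the inverse case is a swap.
  have key : ∀ w ∈ weylGroup B Φ, (∀ α ∈ Φ, α ∘ₗ (w : V →ₗ[ℝ] V) ∈ Φ) ∧
      ∀ α ∈ Φ, α ∘ₗ ((w⁻¹ : V ≃ₗ[ℝ] V) : V →ₗ[ℝ] V) ∈ Φ := by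
    intro w hw
    rw [h.weylGroup_eq] at hw
    induction hw using Subgroup.closure_induction with
    | mem s hs =>
      obtain ⟨i, rfl⟩ := hs
      rw [h.sreflection_inv, and_self]
      intro α hα
      convert h.refl i i.2 α hα using 1
      ext v
      simp [h.sreflection_apply, mul_comm]
    | one => exact ⟨fun α hα => hα, fun α hα => hα⟩
    | mul u v _ _ hu hv =>
      refine ⟨fun α hα => hv.1 _ (hu.1 α hα), fun α hα => ?_⟩
      rw [mul_inv_rev]
      exact hu.2 _ (hv.2 α hα)
    | inv u _ hu => exact ⟨hu.2, by simpa using hu.1⟩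
  exact (key w hw).1

theorem corootLattice_eq : corootLattice B Φ = AddSubgroup.closure (corootVec '' Φ) := by
  unfold corootLattice
  congr 1
  ext x
  simp only [h.isCoroot_iff, Set.mem_image, Set.mem_ofPred_eq, eq_comm]

theorem corootVec_mem {α : Dual ℝ V} (hα : α ∈ Φ) : corootVec α ∈ corootLattice B Φ := by
  rw [h.corootLattice_eq]
  exact AddSubgroup.subset_closure ⟨α, hα, rfl⟩

theorem weyl_corootVec {w : V ≃ₗ[ℝ] V} (hw : w ∈ weylGroup B Φ) (α : Dual ℝ V) :
    w (corootVec α) = corootVec (α ∘ₗ (w.symm : V →ₗ[ℝ] V)) := by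
  have h1 : w (dualVec α) = dualVec (α ∘ₗ (w.symm : V →ₗ[ℝ] V)) := by
    refine ext_inner_right ℝ fun v => ?_
    rw [inner_dualVec, ← h.inner_weyl (inv_mem hw), LinearMap.comp_apply, ← inner_dualVec]
    exact congrArg₂ _ (w.symm_apply_apply _) rfl
  rw [corootVec, map_smul, corootVec, h1, ← h1, h.inner_weyl hw]

theorem weyl_mem_lattice {w : V ≃ₗ[ℝ] V} (hw : w ∈ weylGroup B Φ) {γ : V}
    (hγ : γ ∈ corootLattice B Φ) : w γ ∈ corootLattice B Φ := by
  have hγ' := hγ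
  rw [h.corootLattice_eq] at hγ'
  induction hγ' using AddSubgroup.closure_induction with
  | mem x hx =>
    obtain ⟨α, hα, rfl⟩ := hx
    rw [h.weyl_corootVec hw]
    exact h.corootVec_mem (h.comp_weyl_mem (inv_mem hw) α hα)
  | zero => rw [map_zero]; exact zero_mem _
  | add x y hx' hy' hx hy =>
    rw [← h.corootLattice_eq] at hx' hy'
    rw [map_add]; exact add_mem (hx hx') (hy hy')
  | neg x hx' hx =>
    rw [← h.corootLattice_eq] at hx'
    rw [map_neg]; exact AddSubgroup.neg_mem _ (hx hx')

/-- The roots separate the points of `V`, so the action on the finite set of roots is faithful. -/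
theorem finite_weylGroup : Finite (weylGroup B Φ) := by
  have := h.finite.to_subtype
  refine Finite.of_injective (β := Φ → Φ)
    (fun w i => ⟨_, h.comp_weyl_mem w.2 i i.2⟩) ?_
  intro w u hwu
  refine Subtype.ext (LinearEquiv.ext fun v => sub_eq_zero.mp (h.eq_zero_of_forall fun α hα => ?_))
  have := congrArg Subtype.val (congrFun hwu ⟨α, hα⟩)
  have := LinearMap.congr_fun this v
  rw [map_sub, sub_eq_zero]
  exact this

/-- As a map $v\mapsto v+\alpha(v)(-\alpha^\vee)$ it has determinant $1-\alpha(\alpha^\vee)=1-2$. -/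
theorem det_sreflection (i : Φ) : LinearMap.det (h.sreflection i : V →ₗ[ℝ] V) = -1 := by
  have : (h.sreflection i : V →ₗ[ℝ] V) =
      LinearMap.transvection (i : Dual ℝ V) (-corootVec (i : Dual ℝ V)) := by
    ext v
    simp [h.sreflection_apply, LinearMap.transvection.apply, sub_eq_add_neg]
  rw [this, LinearMap.transvection.det, map_neg, apply_corootVec_self (h.ne_zero i.2)]
  norm_num

theorem altSign_sreflection (i : Φ) : altSign (h.sreflection i) = -1 := by
  rw [altSign, h.det_sreflection]
  norm_num

omit h [FiniteDimensional ℝ V] in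
theorem altSign_mul (w u : V ≃ₗ[ℝ] V) : altSign (w * u) = altSign w * altSign u := by
  rw [altSign, altSign, altSign, ← Complex.ofReal_mul, ← LinearMap.det_comp]
  rfl

omit h [FiniteDimensional ℝ V] in
theorem altSign_one : altSign (1 : V ≃ₗ[ℝ] V) = 1 := by
  rw [altSign]
  exact_mod_cast LinearMap.det_id

theorem altSign_mul_self {w : V ≃ₗ[ℝ] V} (hw : w ∈ weylGroup B Φ) :
    altSign w * altSign w = 1 := by
  rw [h.weylGroup_eq] at hw
  induction hw using Subgroup.closure_induction with
  | mem s hs =>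
    obtain ⟨i, rfl⟩ := hs
    rw [h.altSign_sreflection]; norm_num
  | one => rw [altSign_one, one_mul]
  | mul u v _ _ hu hv =>
    rw [altSign_mul]
    linear_combination altSign v * altSign v * hu + hv
  | inv u _ hu =>
    have h1 : altSign u * altSign u⁻¹ = 1 := by rw [← altSign_mul, mul_inv_cancel, altSign_one]
    linear_combination (-altSign u⁻¹ * altSign u⁻¹) * hu + (altSign u * altSign u⁻¹ + 1) * h1

/-! #### Simple transitivity on the Weyl chambers -/

theorem sreflection_reflectionPerm (i j : Φ) :
    h.sreflection (h.pairing.reflectionPerm j i) =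
      h.sreflection j * h.sreflection i * h.sreflection j :=
  h.pairing.flip.reflection_reflectionPerm

theorem reflectionPerm_apply (i j : Φ) (v : V) :
    (h.pairing.reflectionPerm j i : Dual ℝ V) v = (i : Dual ℝ V) (h.sreflection j v) := by
  rw [← h.pairing_root (h.pairing.reflectionPerm j i), h.pairing.root_reflectionPerm,
    RootPairing.reflection_apply, h.sreflection_apply, map_sub, map_smul]
  change (i : Dual ℝ V) v - (i : Dual ℝ V) (corootVec (j : Dual ℝ V)) * (j : Dual ℝ V) v = _
  rw [smul_eq_mul, mul_comm]

theorem reflectionPerm_self_apply (i : Φ) (v : V) :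
    (h.pairing.reflectionPerm i i : Dual ℝ V) v = -(i : Dual ℝ V) v := by
  rw [h.reflectionPerm_apply, h.sreflection_apply, map_sub, map_smul,
    apply_corootVec_self (h.ne_zero i.2), smul_eq_mul]
  ring

section Base

variable (b : h.pairing.Base)

/-- Every root is reached from a simple one by simple reflections, and the reflection in
$s_j\alpha_i$ is the conjugate $s_js_is_j$. -/
theorem weylGroup_eq_closure_base :
    weylGroup B Φ = Subgroup.closure (h.sreflection '' b.support) := by
  have := h.finite.to_subtype
  have := h.isCrystallographic_pairing
  have := h.isReduced_pairing
  rw [h.weylGroup_eq]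
  refine le_antisymm ((Subgroup.closure_le _).mpr ?_) (Subgroup.closure_mono ?_)
  · rintro _ ⟨i, rfl⟩
    refine b.induction_reflect i (p := fun i => h.sreflection i ∈ _) ?_ ?_ ?_
    · intro i hi
      rw [h.sreflection_reflectionPerm]
      exact mul_mem (mul_mem hi hi) hi
    · intro i hi
      exact Subgroup.subset_closure ⟨i, hi, rfl⟩
    · intro i j hi hj
      have hj' := Subgroup.subset_closure (Set.mem_image_of_mem h.sreflection hj)
      rw [h.sreflection_reflectionPerm]
      exact mul_mem (mul_mem hj' hi) hj'
  · rintro _ ⟨i, _, rfl⟩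
    exact ⟨i, rfl⟩

theorem exists_list_of_mem_weylGroup {w : V ≃ₗ[ℝ] V} (hw : w ∈ weylGroup B Φ) :
    ∃ l : List Φ, (∀ i ∈ l, i ∈ b.support) ∧ (l.map h.sreflection).prod = w := by
  rw [h.weylGroup_eq_closure_base b] at hw
  induction hw using Subgroup.closure_induction with
  | mem s hs =>
    obtain ⟨i, hi, rfl⟩ := hs
    exact ⟨[i], by simpa using hi, by simp⟩
  | one => exact ⟨[], by simp, by simp⟩
  | mul u v _ _ hu hv =>
    obtain ⟨l, hl, rfl⟩ := hu
    obtain ⟨m, hm, rfl⟩ := hv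
    refine ⟨l ++ m, fun i hi => ?_, by simp⟩
    rcases List.mem_append.mp hi with hi | hi
    exacts [hl i hi, hm i hi]
  | inv u _ hu =>
    obtain ⟨l, hl, rfl⟩ := hu
    refine ⟨l.reverse, fun i hi => hl i (List.mem_reverse.mp hi), ?_⟩
    rw [List.prod_inv_reverse, List.map_map, List.map_reverse]
    congr 2

/-- The exchange condition. -/
theorem exists_list_exchange {y : V} (hy : ∀ i : Φ, b.IsPos i → 0 < (i : Dual ℝ V) y)
    (l : List Φ) (hl : ∀ i ∈ l, i ∈ b.support) :
    ∀ β : Φ, b.IsPos β → (β : Dual ℝ V) ((l.map h.sreflection).prod y) < 0 →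
      ∃ m : List Φ, (∀ i ∈ m, i ∈ b.support) ∧ m.length + 1 = l.length ∧
        h.sreflection β * (l.map h.sreflection).prod = (m.map h.sreflection).prod := by
  have := h.finite.to_subtype
  have := h.isCrystallographic_pairing
  have := h.isReduced_pairing
  induction l with
  | nil =>
    intro β hβ h1
    exact absurd (hy β hβ) (not_lt.mpr h1.le)
  | cons i l ih =>
    intro β hβ h1
    have hi := hl i (by simp)
    have hl' : ∀ i ∈ l, i ∈ b.support := fun j hj => hl j (by simp [hj])
    simp only [List.map_cons, List.prod_cons] at h1 ⊢
    -- If `β` is the first letter, that letter cancels. Otherwise the simple reflection $s_i$ keeps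
    -- `β` positive, and the induction hypothesis applies to $s_i\beta$.
    by_cases hβi : β = i
    · subst hβi
      exact ⟨l, hl', rfl, by rw [← mul_assoc, h.sreflection_mul_self, one_mul]⟩
    · obtain ⟨m, hm, hm1, hm2⟩ := ih hl' _ (hβ.reflectionPerm hi hβi)
        (by rw [h.reflectionPerm_apply]; exact h1)
      refine ⟨i :: m, ?_, by simp [hm1], ?_⟩
      · intro j hj
        rcases List.mem_cons.mp hj with rfl | hj
        exacts [hi, hm j hj]
      · rw [List.map_cons, List.prod_cons, ← hm2, h.sreflection_reflectionPerm, ← mul_assoc,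
          ← mul_assoc, ← mul_assoc, ← mul_assoc, h.sreflection_mul_self, one_mul]

/-- In a shortest word for `w`, the first simple root is positive on $wy$, hence negative on the
tail applied to $y$. The exchange condition then absorbs the first letter and deletes one more, a
contradiction unless the word is empty. -/
theorem eq_one_of_forall_isPos {w : V ≃ₗ[ℝ] V} (hw : w ∈ weylGroup B Φ) {y : V}
    (hy : ∀ i : Φ, b.IsPos i → 0 < (i : Dual ℝ V) y)
    (hwy : ∀ i : Φ, b.IsPos i → 0 < (i : Dual ℝ V) (w y)) : w = 1 := by
  classical
  have hex : ∃ n : ℕ, ∃ l : List Φ, (∀ i ∈ l, i ∈ b.support) ∧ l.length = n ∧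
      (l.map h.sreflection).prod = w := by
    obtain ⟨l, hl, hlw⟩ := h.exists_list_of_mem_weylGroup b hw
    exact ⟨_, l, hl, rfl, hlw⟩
  obtain ⟨l, hl, hln, hlw⟩ := Nat.find_spec hex
  cases l with
  | nil => simpa using hlw.symm
  | cons i l =>
    exfalso
    have hi := hl i (by simp)
    have hl' : ∀ i ∈ l, i ∈ b.support := fun j hj => hl j (by simp [hj])
    rw [List.map_cons, List.prod_cons] at hlw
    have h1 := hwy i (RootPairing.Base.isPos_of_mem_support hi)
    rw [← hlw] at h1
    have h2 : (i : Dual ℝ V) ((l.map h.sreflection).prod y) < 0 := by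
      have h3 := h.reflectionPerm_apply i i ((l.map h.sreflection).prod y)
      rw [h.reflectionPerm_self_apply] at h3
      have h4 : 0 < (i : Dual ℝ V) (h.sreflection i ((l.map h.sreflection).prod y)) := h1
      linarith
    obtain ⟨m, hm, hm1, hm2⟩ := h.exists_list_exchange b hy l hl' i
      (RootPairing.Base.isPos_of_mem_support hi) h2
    refine Nat.find_min hex (m := m.length) ?_ ⟨m, hm, rfl, by rw [← hm2, hlw]⟩
    rw [← hln, List.length_cons, ← hm1]
    omega

theorem forall_isPos_of_forall_support {y : V}
    (hy : ∀ i ∈ b.support, 0 < (i : Dual ℝ V) y) :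
    ∀ i : Φ, b.IsPos i → 0 < (i : Dual ℝ V) y := by
  have := h.finite.to_subtype
  have := h.isCrystallographic_pairing
  intro i hi
  refine hi.induction_on_add (p := fun i : Φ => 0 < (i : Dual ℝ V) y) hy ?_
  intro i j k hk hi hj
  have h1 : (k : Dual ℝ V) = i + j := hk
  rw [h1, LinearMap.add_apply]
  exact add_pos hi (hy j hj)

/-- Simple roots are linearly independent, so their values can be prescribed; $\rho$ serves below as
a strictly dominant vector. -/
theorem exists_forall_support_eq_one : ∃ ρ : V, ∀ i ∈ b.support, (i : Dual ℝ V) ρ = 1 := by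
  have hli : LinearIndependent ℝ (fun i : b.support => ((i : Φ) : Dual ℝ V)) := b.linearIndepOn_root
  obtain ⟨f, hf⟩ : ∃ f : Dual ℝ (Dual ℝ V), ∀ i : b.support, f ((i : Φ) : Dual ℝ V) = 1 := by
    obtain ⟨f, hf⟩ := LinearMap.exists_extend ((Basis.span hli).constr ℝ fun _ => (1 : ℝ))
    refine ⟨f, fun i => ?_⟩
    have h1 := LinearMap.congr_fun hf (Basis.span hli i)
    rw [Basis.constr_basis] at h1
    rw [← h1, LinearMap.comp_apply, Submodule.subtype_apply, Basis.span_apply]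
  refine ⟨(Module.evalEquiv ℝ V).symm f, fun i hi => ?_⟩
  rw [Module.apply_evalEquiv_symm_apply]
  exact hf ⟨i, hi⟩

end Base

/-- An element of the Weyl group which preserves a Weyl chamber is trivial. -/
theorem eq_one_of_same_sign {w : V ≃ₗ[ℝ] V} (hw : w ∈ weylGroup B Φ) {v : V}
    (hv : ∀ α ∈ Φ, α v ≠ 0) (hwv : ∀ α ∈ Φ, 0 < α v → 0 < α (w v)) : w = 1 := by
  have := h.finite.to_subtype
  have := h.finite_weylGroup
  have := h.isCrystallographic_pairing
  have := h.isReduced_pairing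
  have := h.isRootSystem_pairing
  obtain ⟨b⟩ := h.pairing.nonempty_base
  obtain ⟨ρ, hρ⟩ := h.exists_forall_support_eq_one b
  -- Maximality makes $uv$ dominant: as $\alpha_i(\rho)=1$, reflecting in a simple root with
  -- $\alpha_i(uv)<0$ would increase the inner product with $\rho$.
  obtain ⟨u, hu⟩ := Finite.exists_max fun u : weylGroup B Φ =>
    (inner ℝ ((u : V ≃ₗ[ℝ] V) v) ρ : ℝ)
  have hpos : ∀ i ∈ b.support, 0 < (i : Dual ℝ V) ((u : V ≃ₗ[ℝ] V) v) := by
    intro i hi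
    refine lt_of_le_of_ne ?_ fun h0 => hv _ (h.comp_weyl_mem u.2 i i.2) h0.symm
    have h1 := hu ⟨_, mul_mem (h.sreflection_mem i) u.2⟩
    have h2 : (inner ℝ (h.sreflection i ((u : V ≃ₗ[ℝ] V) v)) ρ : ℝ) ≤
      inner ℝ ((u : V ≃ₗ[ℝ] V) v) ρ := h1
    rw [h.sreflection_apply, inner_sub_left, real_inner_smul_left,
      inner_corootVec (h.ne_zero i.2), hρ i hi] at h2
    have h3 := inner_corootVec_self_pos (h.ne_zero i.2)
    by_contra! h4
    nlinarith [mul_pos h3 (neg_pos.mpr h4)]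
  have hpos' : ∀ i ∈ b.support, 0 < (i : Dual ℝ V) ((u : V ≃ₗ[ℝ] V) (w v)) := by
    intro i hi
    exact hwv _ (h.comp_weyl_mem u.2 i i.2) (hpos i hi)
  -- Conjugating by `u` moves the chamber of `v` to the chamber of the base.
  have h1 := h.eq_one_of_forall_isPos b (w := u * w * (u : V ≃ₗ[ℝ] V)⁻¹)
    (mul_mem (mul_mem u.2 hw) (inv_mem u.2)) (h.forall_isPos_of_forall_support b hpos) ?_
  · rwa [mul_inv_eq_one, mul_eq_left] at h1
  · refine h.forall_isPos_of_forall_support b fun i hi => ?_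
    have h2 : ((u : V ≃ₗ[ℝ] V) * w * (u : V ≃ₗ[ℝ] V)⁻¹) ((u : V ≃ₗ[ℝ] V) v) =
        (u : V ≃ₗ[ℝ] V) (w v) :=
      congrArg (fun x => (u : V ≃ₗ[ℝ] V) (w x)) ((u : V ≃ₗ[ℝ] V).symm_apply_apply v)
    rw [h2]
    exact hpos' i hi

end IsRootData
end RootDataTheory
end ThetaAlt

namespace ThetaAlt

open Module

theorem finite_inter_ball {V : Type*} [NormedAddCommGroup V] [NormedSpace ℝ V]
    [FiniteDimensional ℝ V] (Λ : AddSubgroup V) [DiscreteTopology Λ] (R : ℝ) :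
    {γ : V | γ ∈ Λ ∧ ‖γ‖ ≤ R}.Finite := by
  have := FiniteDimensional.proper_real V
  have h1 := Metric.finite_isBounded_inter_isClosed (K := Metric.closedBall (0 : V) R)
    (s := (Λ : Set V)) DiscreteTopology.isDiscrete Metric.isBounded_closedBall
    AddSubgroup.isClosed_of_discrete
  refine h1.subset fun γ hγ => ⟨?_, hγ.1⟩
  simpa using hγ.2

namespace IsRootData

variable {V : Type*} [NormedAddCommGroup V] [InnerProductSpace ℝ V] [FiniteDimensional ℝ V]
variable {B : LinearMap.BilinForm ℝ V} {Φ : Set (Dual ℝ V)} (h : IsRootData B Φ)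
include h

/-! #### The coroot lattice -/

theorem apply_lattice {α : Dual ℝ V} (hα : α ∈ Φ) {γ : V} (hγ : γ ∈ corootLattice B Φ) :
    ∃ m : ℤ, α γ = m := by
  rw [h.corootLattice_eq] at hγ
  induction hγ using AddSubgroup.closure_induction with
  | mem x hx =>
    obtain ⟨β, hβ, rfl⟩ := hx
    exact h.integral β hβ α hα
  | zero => exact ⟨0, by simp⟩
  | add x y _ _ hx hy =>
    obtain ⟨m, hm⟩ := hx
    obtain ⟨n, hn⟩ := hy
    exact ⟨m + n, by rw [map_add, hm, hn]; push_cast; rfl⟩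
  | neg x _ hx =>
    obtain ⟨m, hm⟩ := hx
    exact ⟨-m, by rw [map_neg, hm]; push_cast; rfl⟩

/-- Evenness of the coroot lengths enters here:
$B(\alpha^\vee,\gamma)=\tfrac12B(\alpha^\vee,\alpha^\vee)\,\alpha(\gamma)$ is a product of two
integers. -/
theorem form_corootVec_lattice {α : Dual ℝ V} (hα : α ∈ Φ) {γ : V}
    (hγ : γ ∈ corootLattice B Φ) : ∃ m : ℤ, B (corootVec α) γ = m := by
  obtain ⟨m, hm⟩ := h.norm α hα
  obtain ⟨n, hn⟩ := h.apply_lattice hα hγ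
  refine ⟨m * n, ?_⟩
  rw [h.form_eq, inner_corootVec (h.ne_zero hα), ← h.form_eq, hm, hn]
  push_cast
  ring

theorem form_lattice {γ γ' : V} (hγ : γ ∈ corootLattice B Φ) (hγ' : γ' ∈ corootLattice B Φ) :
    ∃ m : ℤ, B γ γ' = m := by
  rw [h.corootLattice_eq] at hγ
  induction hγ using AddSubgroup.closure_induction with
  | mem x hx =>
    obtain ⟨β, hβ, rfl⟩ := hx
    exact h.form_corootVec_lattice hβ hγ'
  | zero => exact ⟨0, by simp⟩
  | add x y _ _ hx hy =>
    obtain ⟨m, hm⟩ := hx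
    obtain ⟨n, hn⟩ := hy
    exact ⟨m + n, by rw [map_add, LinearMap.add_apply, hm, hn]; push_cast; rfl⟩
  | neg x _ hx =>
    obtain ⟨m, hm⟩ := hx
    exact ⟨-m, by rw [map_neg, LinearMap.neg_apply, hm]; push_cast; rfl⟩

/-- This is the standard fact on two roots at an obtuse angle, applied to the dual root system. -/
theorem corootVec_add {i j : Φ}
    (hij : inner ℝ (corootVec (i : Dual ℝ V)) (corootVec (j : Dual ℝ V)) < 0) :
    corootVec (i : Dual ℝ V) + corootVec (j : Dual ℝ V) = 0 ∨
      ∃ k : Φ, corootVec (i : Dual ℝ V) + corootVec (j : Dual ℝ V) = corootVec (k : Dual ℝ V) := by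
  have := h.finite.to_subtype
  have := h.isCrystallographic_pairing
  by_cases h0 : corootVec (i : Dual ℝ V) = -corootVec (j : Dual ℝ V)
  · left
    rw [h0, neg_add_cancel]
  · right
    have h1 : h.pairing.flip.pairingIn ℤ i j < 0 := by
      have h2 : ((h.pairing.flip.pairingIn ℤ i j : ℤ) : ℝ) =
          (j : Dual ℝ V) (corootVec (i : Dual ℝ V)) :=
        h.pairing.flip.algebraMap_pairingIn ℤ i j
      rw [real_inner_comm, inner_corootVec (h.ne_zero j.2)] at hij
      have h3 := inner_corootVec_self_pos (h.ne_zero j.2)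
      rw [← Int.cast_lt_zero (R := ℝ), h2]
      by_contra! h4
      nlinarith
    obtain ⟨k, hk⟩ := h.pairing.flip.root_add_root_mem_of_pairingIn_neg h1 h0
    exact ⟨k, hk.symm⟩

theorem corootVec_neg {α : Dual ℝ V} (hα : α ∈ Φ) : corootVec (-α) = -corootVec α := by
  have h1 := h.weyl_corootVec (h.sreflection_mem ⟨α, hα⟩) α
  rw [h.sreflection_apply, apply_corootVec_self (h.ne_zero hα)] at h1
  have h2 : -α = α ∘ₗ ((h.sreflection ⟨α, hα⟩).symm : V →ₗ[ℝ] V) := by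
    ext v
    have h3 : (h.sreflection ⟨α, hα⟩).symm = h.sreflection ⟨α, hα⟩ := h.sreflection_inv _
    rw [h3]
    simp only [LinearMap.neg_apply, LinearMap.comp_apply, LinearEquiv.coe_coe,
      h.sreflection_apply, map_sub, map_smul, apply_corootVec_self (h.ne_zero hα), smul_eq_mul]
    ring
  rw [h2, ← h1]
  module

theorem exists_list_of_mem_lattice {γ : V} (hγ : γ ∈ corootLattice B Φ) :
    ∃ l : List Φ, (l.map fun i : Φ => corootVec (i : Dual ℝ V)).sum = γ := by
  rw [h.corootLattice_eq] at hγ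
  induction hγ using AddSubgroup.closure_induction with
  | mem x hx =>
    obtain ⟨β, hβ, rfl⟩ := hx
    exact ⟨[⟨β, hβ⟩], by simp⟩
  | zero => exact ⟨[], by simp⟩
  | add x y _ _ hx hy =>
    obtain ⟨l, hl⟩ := hx
    obtain ⟨m, hm⟩ := hy
    exact ⟨l ++ m, by rw [List.map_append, List.sum_append, hl, hm]⟩
  | neg x _ hx =>
    obtain ⟨l, rfl⟩ := hx
    refine ⟨l.map fun i => ⟨_, h.neg_mem i.2⟩, ?_⟩
    clear * -
    induction l with
    | nil => simp
    | cons i l ih =>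
      simp only [List.map_cons, List.sum_cons, neg_add] at ih ⊢
      rw [ih, h.corootVec_neg i.2]

/-- The coroot lattice contains no minuscule coweight: an element on which all roots take values
of absolute value at most one vanishes. -/
theorem lattice_eq_zero {γ : V} (hγ : γ ∈ corootLattice B Φ) (hγ1 : ∀ α ∈ Φ, α γ ≤ 1) :
    γ = 0 := by
  classical
  have hex : ∃ n : ℕ, ∃ l : List Φ, l.length = n ∧
      (l.map fun i : Φ => corootVec (i : Dual ℝ V)).sum = γ := by
    obtain ⟨l, hl⟩ := h.exists_list_of_mem_lattice hγ
    exact ⟨_, l, rfl, hl⟩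
  -- Take a shortest expression of `γ` as a sum of coroots. Two summands at an obtuse angle could be
  -- merged or cancelled, so the first has nonnegative product with all the others.
  obtain ⟨l, hln, hl⟩ := Nat.find_spec hex
  cases l with
  | nil => simpa using hl.symm
  | cons i l =>
    exfalso
    have hpair : ∀ j ∈ l, 0 ≤ inner ℝ (corootVec (i : Dual ℝ V)) (corootVec (j : Dual ℝ V)) := by
      intro j hj
      by_contra! hneg
      obtain ⟨m, hm⟩ : ∃ m : List Φ, l.Perm (j :: m) := ⟨l.erase j, List.perm_cons_erase hj⟩
      have hsum : (corootVec (i : Dual ℝ V) + corootVec (j : Dual ℝ V)) +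
          (m.map fun i : Φ => corootVec (i : Dual ℝ V)).sum = γ := by
        rw [← hl, List.map_cons, List.sum_cons, (hm.map _).sum_eq, List.map_cons, List.sum_cons,
          add_assoc]
      have hlen := hm.length_eq
      rw [List.length_cons] at hlen hln
      rcases h.corootVec_add hneg with h0 | ⟨k, hk⟩
      · rw [h0, zero_add] at hsum
        exact Nat.find_min hex (m := m.length) (by omega) ⟨m, rfl, hsum⟩
      · rw [hk] at hsum
        exact Nat.find_min hex (m := m.length + 1) (by omega) ⟨k :: m, rfl, hsum⟩
    -- Thus $\langle\alpha^\vee,\gamma\rangle\ge\langle\alpha^\vee,\alpha^\vee\rangle$ for the first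
    -- summand $\alpha^\vee$, which says $\alpha(\gamma)\ge2$.
    have h1 : inner ℝ (corootVec (i : Dual ℝ V)) (corootVec (i : Dual ℝ V)) ≤
        inner ℝ (corootVec (i : Dual ℝ V)) γ := by
      rw [← hl, List.map_cons, List.sum_cons, inner_add_right, le_add_iff_nonneg_right]
      clear hl hln
      induction l with
      | nil => simp
      | cons j l ih =>
        rw [List.map_cons, List.sum_cons, inner_add_right]
        exact add_nonneg (hpair j (by simp)) (ih fun k hk => hpair k (by simp [hk]))
    rw [inner_corootVec (h.ne_zero i.2) γ] at h1
    have h2 := hγ1 i i.2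
    have h3 := inner_corootVec_self_pos (h.ne_zero i.2)
    nlinarith

/-- The coroot lattice as a `ℤ`-submodule. -/
abbrev latticeZ (B : LinearMap.BilinForm ℝ V) (Φ : Set (Dual ℝ V)) : Submodule ℤ V :=
  AddSubgroup.toIntSubmodule (corootLattice B Φ)

/-- Squared lengths of lattice vectors are integers, so the open unit ball contains only zero. -/
theorem discreteTopology_lattice : DiscreteTopology (latticeZ B Φ) := by
  refine discreteTopology_iff_isOpen_singleton_zero.mpr ?_
  rw [Metric.isOpen_singleton_iff]
  refine ⟨1, one_pos, fun γ hγ => ?_⟩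
  rw [dist_zero_right] at hγ
  obtain ⟨m, hm⟩ := h.form_lattice γ.2 γ.2
  rw [h.form_eq, real_inner_self_eq_norm_sq] at hm
  have h1 : ‖(γ : V)‖ ^ 2 < 1 := by
    have : ‖(γ : V)‖ < 1 := hγ
    nlinarith [norm_nonneg (γ : V)]
  have h2 : 0 ≤ ‖(γ : V)‖ ^ 2 := by positivity
  rw [hm] at h1 h2
  have h3 : m = 0 := by
    have h4 : m < 1 := by exact_mod_cast h1
    have h5 : 0 ≤ m := by exact_mod_cast h2
    omega
  rw [h3] at hm
  simpa using hm

theorem span_corootVec : Submodule.span ℝ (corootVec '' Φ) = ⊤ := by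
  have := h.finite.to_subtype
  have := h.isRootSystem_pairing
  have h1 := RootPairing.IsRootSystem.span_coroot_eq_top (P := h.pairing)
  rw [← h1]
  congr 1
  ext x
  constructor
  · rintro ⟨α, hα, rfl⟩
    exact ⟨⟨α, hα⟩, rfl⟩
  · rintro ⟨i, rfl⟩
    exact ⟨i, i.2, rfl⟩

theorem isZLattice : have := h.discreteTopology_lattice; IsZLattice ℝ (latticeZ B Φ) := by
  have := h.discreteTopology_lattice
  refine ⟨top_unique ?_⟩
  rw [← h.span_corootVec]
  refine Submodule.span_mono ?_
  rintro _ ⟨α, hα, rfl⟩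
  exact h.corootVec_mem hα

theorem finite_lattice_inter_ball (R : ℝ) :
    {γ : V | γ ∈ corootLattice B Φ ∧ ‖γ‖ ≤ R}.Finite := by
  have : DiscreteTopology (corootLattice B Φ) := h.discreteTopology_lattice
  exact finite_inter_ball _ R

end IsRootData
end ThetaAlt

namespace ThetaAlt

open Module

namespace IsRootData

variable {V : Type*} [NormedAddCommGroup V] [InnerProductSpace ℝ V] [FiniteDimensional ℝ V]
variable {B : LinearMap.BilinForm ℝ V} {Φ : Set (Dual ℝ V)} (h : IsRootData B Φ)
variable {Φp : Set (Dual ℝ V)} {α₀ : Dual ℝ V}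

/-! #### The fundamental alcove -/

omit [FiniteDimensional ℝ V] in
theorem _root_.ThetaAlt.IsPositiveSystem.subset (hp : IsPositiveSystem Φ Φp) : Φp ⊆ Φ := by
  obtain ⟨ρ, _, rfl⟩ := hp
  exact fun α hα => hα.1

omit [FiniteDimensional ℝ V] in
theorem apply_nonneg_of_mem_closure {v : V} (hv : ∀ α ∈ Φp, 0 < α v) {β : Dual ℝ V}
    (hβ : β ∈ AddSubmonoid.closure Φp) : 0 ≤ β v := by
  induction hβ using AddSubmonoid.closure_induction with
  | mem x hx => exact (hv x hx).le
  | zero => simp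
  | add x y _ _ hx hy => exact add_nonneg hx hy

omit [FiniteDimensional ℝ V] in
theorem apply_lt_one (h0 : IsHighestRoot Φ Φp α₀) {v : V}
    (hv : v ∈ alcove Φp α₀) {α : Dual ℝ V} (hα : α ∈ Φ) : α v < 1 := by
  have h1 := apply_nonneg_of_mem_closure hv.1 (h0.2 α hα)
  rw [LinearMap.sub_apply] at h1
  have h2 := hv.2
  linarith

include h

theorem mem_or_neg_mem (hp : IsPositiveSystem Φ Φp) {α : Dual ℝ V} (hα : α ∈ Φ) :
    α ∈ Φp ∨ -α ∈ Φp := by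
  obtain ⟨ρ, hρ, rfl⟩ := hp
  rcases lt_or_gt_of_ne (hρ α hα) with h1 | h1
  · right
    exact ⟨h.neg_mem hα, by simpa using h1⟩
  · exact Or.inl ⟨hα, h1⟩

theorem highest_mem (hp : IsPositiveSystem Φ Φp) (h0 : IsHighestRoot Φ Φp α₀) : α₀ ∈ Φp := by
  obtain ⟨ρ, hρ, rfl⟩ := hp
  refine ⟨h0.1, lt_of_le_of_ne ?_ (hρ α₀ h0.1).symm⟩
  have h1 := apply_nonneg_of_mem_closure (v := ρ) (fun α hα => hα.2) (h0.2 _ (h.neg_mem h0.1))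
  simp only [LinearMap.sub_apply, LinearMap.neg_apply] at h1
  linarith

theorem nonempty_alcove (hp : IsPositiveSystem Φ Φp) (h0 : IsHighestRoot Φ Φp α₀) :
    (alcove Φp α₀).Nonempty := by
  have h1 := h.highest_mem hp h0
  obtain ⟨ρ, hρ, rfl⟩ := hp
  have h2 : 0 < α₀ ρ := h1.2
  -- The scaling gives the highest root the value $1/2$.
  refine ⟨(2 * α₀ ρ)⁻¹ • ρ, fun α hα => ?_, ?_⟩
  · rw [map_smul, smul_eq_mul]
    exact mul_pos (by positivity) hα.2
  · rw [map_smul, smul_eq_mul, mul_inv, mul_assoc, inv_mul_cancel₀ h2.ne']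
    norm_num

/-- The alcove is a strict fundamental domain: an element of the affine Weyl group which maps
a point of the alcove to a point of the alcove is trivial. -/
theorem eq_one_of_mem_alcove (hp : IsPositiveSystem Φ Φp) (h0 : IsHighestRoot Φ Φp α₀)
    {v : V} (hv : v ∈ alcove Φp α₀) {w : V ≃ₗ[ℝ] V} (hw : w ∈ weylGroup B Φ) {γ : V}
    (hγ : γ ∈ corootLattice B Φ) (hwv : w v + γ ∈ alcove Φp α₀) : w = 1 ∧ γ = 0 := by
  have hlt : ∀ {v : V}, v ∈ alcove Φp α₀ → ∀ α ∈ Φ, -1 < α v ∧ α v < 1 ∧ α v ≠ 0 := by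
    intro v hv α hα
    refine ⟨?_, apply_lt_one h0 hv hα, ?_⟩
    · have := apply_lt_one h0 hv (h.neg_mem hα)
      rw [LinearMap.neg_apply] at this
      linarith
    · rcases h.mem_or_neg_mem hp hα with h1 | h1
      · exact (hv.1 α h1).ne'
      · have := hv.1 _ h1
        rw [LinearMap.neg_apply] at this
        linarith
  -- The integer $\alpha(\gamma)=\alpha(wv+\gamma)-(\alpha\circ w)(v)$ is a difference of two
  -- numbers in $(-1,1)$, hence at most $1$, and `lattice_eq_zero` applies.
  have hγ0 : γ = 0 := by
    refine h.lattice_eq_zero hγ fun α hα => ?_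
    obtain ⟨m, hm⟩ := h.apply_lattice hα hγ
    have h1 := hlt hwv α hα
    have h2 := hlt hv _ (h.comp_weyl_mem hw α hα)
    simp only [map_add, LinearMap.comp_apply, LinearEquiv.coe_coe] at h1 h2
    rw [hm] at h1 ⊢
    have h3 : (m : ℝ) < 2 := by linarith
    have h4 : m < 2 := by exact_mod_cast h3
    exact_mod_cast (by omega : m ≤ 1)
  refine ⟨h.eq_one_of_same_sign hw (v := v) (fun α hα => (hlt hv α hα).2.2) ?_, hγ0⟩
  intro α hα hαv
  rw [hγ0, add_zero] at hwv
  rcases h.mem_or_neg_mem hp hα with h1 | h1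
  · exact hwv.1 α h1
  · have := hv.1 _ h1
    rw [LinearMap.neg_apply] at this
    linarith

/-- Every point on which no root is an integer can be moved into the alcove. -/
theorem exists_mem_alcove (hp : IsPositiveSystem Φ Φp) (h0 : IsHighestRoot Φ Φp α₀) {μ : V}
    (hμ : ∀ α ∈ Φ, ∀ m : ℤ, α μ ≠ m) :
    ∃ w ∈ weylGroup B Φ, ∃ γ ∈ corootLattice B Φ, w μ + γ ∈ alcove Φp α₀ := by
  obtain ⟨ρ, hρ⟩ := h.nonempty_alcove hp h0
  have := h.finite_weylGroup
  -- The image of `μ` closest to the alcove point `ρ` will be chosen. Restricting to images no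
  -- farther than `μ` itself leaves a finite set, on which the minimum exists.
  let S : Set ((weylGroup B Φ) × V) := {x | x.2 ∈ corootLattice B Φ ∧
    ‖(x.1 : V ≃ₗ[ℝ] V) μ + x.2 - ρ‖ ≤ ‖μ - ρ‖}
  have hS : S.Finite := by
    refine ((Set.finite_univ (α := weylGroup B Φ)).prod
      (h.finite_lattice_inter_ball (‖μ - ρ‖ + ‖ρ‖ + ‖μ‖))).subset ?_
    rintro ⟨w, γ⟩ ⟨h1, h2⟩
    refine ⟨trivial, h1, ?_⟩
    have h3 : ‖(w : V ≃ₗ[ℝ] V) μ‖ = ‖μ‖ := by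
      rw [← sq_eq_sq₀ (norm_nonneg _) (norm_nonneg _), ← real_inner_self_eq_norm_sq,
        ← real_inner_self_eq_norm_sq, h.inner_weyl w.2]
    have h4 : γ = ((w : V ≃ₗ[ℝ] V) μ + γ - ρ) + ρ - (w : V ≃ₗ[ℝ] V) μ := by abel
    have h5 := norm_sub_le (((w : V ≃ₗ[ℝ] V) μ + γ - ρ) + ρ) ((w : V ≃ₗ[ℝ] V) μ)
    have h6 := norm_add_le ((w : V ≃ₗ[ℝ] V) μ + γ - ρ) ρ
    rw [← h4] at h5
    simp only at h2
    change ‖γ‖ ≤ _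
    linarith
  obtain ⟨⟨w, γ⟩, ⟨hγ, hle⟩, hmin⟩ := Set.exists_min_image S
    (fun x => ‖(x.1 : V ≃ₗ[ℝ] V) μ + x.2 - ρ‖) hS ⟨(1, 0), zero_mem _, by simp⟩
  have hmin' : ∀ u ∈ weylGroup B Φ, ∀ δ ∈ corootLattice B Φ,
      ‖(w : V ≃ₗ[ℝ] V) μ + γ - ρ‖ ≤ ‖u μ + δ - ρ‖ := by
    intro u hu δ hδ
    by_cases hc : ‖u μ + δ - ρ‖ ≤ ‖μ - ρ‖
    · exact hmin (⟨u, hu⟩, δ) ⟨hδ, hc⟩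
    · exact hle.trans (not_le.mp hc).le
  refine ⟨w, w.2, γ, hγ, ?_⟩
  set x := (w : V ≃ₗ[ℝ] V) μ + γ with hx
  have hne : ∀ α ∈ Φ, ∀ m : ℤ, α x ≠ m := by
    intro α hα m hm
    obtain ⟨n, hn⟩ := h.apply_lattice hα hγ
    refine hμ _ (h.comp_weyl_mem w.2 α hα) (m - n) ?_
    rw [hx, map_add, hn] at hm
    push_cast
    rw [← hm]
    simp
  have hrefl : ∀ α ∈ Φ, ∀ n : ℤ, ‖x - ρ‖ ≤ ‖x - ρ - (α x - n) • corootVec α‖ := by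
    intro α hα n
    have h1 := hmin' _ (mul_mem (h.sreflection_mem ⟨α, hα⟩) w.2)
      (h.sreflection ⟨α, hα⟩ γ + n • corootVec α)
      (add_mem (h.weyl_mem_lattice (h.sreflection_mem ⟨α, hα⟩) hγ)
        (zsmul_mem (h.corootVec_mem hα) n))
    refine h1.trans (le_of_eq (congrArg _ ?_))
    rw [← add_assoc, LinearEquiv.mul_apply, ← map_add, ← hx, h.sreflection_apply,
      ← Int.cast_smul_eq_zsmul ℝ]
    module
  -- The affine reflection in $\alpha=n$ cannot bring `x` closer to `ρ`, so both points lie on the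
  -- same side of that wall. The alcove inequalities are the cases $n=0$ and, for the highest root,
  -- $n=1$.
  have hval : ∀ α ∈ Φ, ∀ n : ℤ, 0 ≤ (α x - n) * (α ρ - n) := by
    intro α hα n
    have h1 := hrefl α hα n
    have he := inner_corootVec (h.ne_zero hα) (x - ρ)
    rw [map_sub] at he
    have he' := he
    rw [real_inner_comm] at he'
    rw [← sq_le_sq₀ (norm_nonneg _) (norm_nonneg _), ← real_inner_self_eq_norm_sq,
      ← real_inner_self_eq_norm_sq, inner_sub_left (x - ρ) _ (x - ρ - _),
      inner_sub_right (x - ρ) (x - ρ), inner_sub_right _ (x - ρ),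
      real_inner_smul_left, real_inner_smul_left, real_inner_smul_right, real_inner_smul_right,
      he', he] at h1
    have h2 := inner_corootVec_self_pos (h.ne_zero hα)
    by_contra! h3
    linarith [mul_neg_of_pos_of_neg h2 h3]
  refine ⟨fun α hα => ?_, ?_⟩
  · have hα' := hp.subset hα
    have h1 := hval α hα' 0
    have h2 := hne α hα' 0
    have h3 := hρ.1 α hα
    simp only [Int.cast_zero, sub_zero] at h1 h2
    exact lt_of_le_of_ne (by by_contra! hlt; nlinarith) h2.symm
  · have h1 := hval α₀ h0.1 1
    have h2 := hne α₀ h0.1 1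
    have h3 := hρ.2
    simp only [Int.cast_one] at h1 h2
    exact lt_of_le_of_ne (by by_contra! hlt; nlinarith) h2

end IsRootData
end ThetaAlt

namespace ThetaAlt

open Module

/-! ### Convergence of Gaussian lattice sums. -/

section Summability

variable {V : Type*} [NormedAddCommGroup V] [NormedSpace ℝ V] [FiniteDimensional ℝ V]

/-- Both $1+t$ and $t^N/N!$ are at most $e^t$; completing the square then bounds $-at^2+(c+2)t$ by
$(c+2)^2/4a$. -/
theorem exists_gaussian_bound (a c : ℝ) (ha : 0 < a) (N : ℕ) :
    ∃ K : ℝ, ∀ t : ℝ, 0 ≤ t → (1 + t) * Real.exp (-a * t ^ 2 + c * t) * t ^ N ≤ K := by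
  refine ⟨(N.factorial : ℝ) * Real.exp ((c + 2) ^ 2 / (4 * a)), fun t ht => ?_⟩
  have h1 : 1 + t ≤ Real.exp t := by linarith [Real.add_one_le_exp t]
  have h2 : t ^ N ≤ (N.factorial : ℝ) * Real.exp t := by
    have := Real.pow_div_factorial_le_exp t ht N
    rwa [div_le_iff₀ (by positivity), mul_comm] at this
  have h3 : -a * t ^ 2 + c * t + 2 * t ≤ (c + 2) ^ 2 / (4 * a) := by
    rw [le_div_iff₀ (by positivity)]
    nlinarith [sq_nonneg (2 * a * t - (c + 2))]
  calc (1 + t) * Real.exp (-a * t ^ 2 + c * t) * t ^ N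
      ≤ Real.exp t * Real.exp (-a * t ^ 2 + c * t) * ((N.factorial : ℝ) * Real.exp t) := by
        gcongr
    _ = (N.factorial : ℝ) * Real.exp (-a * t ^ 2 + c * t + 2 * t) := by
        rw [show -a * t ^ 2 + c * t + 2 * t = t + (-a * t ^ 2 + c * t) + t by ring,
          Real.exp_add (t + _), Real.exp_add t]
        ring
    _ ≤ _ := by gcongr

/-- Gaussian sums over shifted lattices converge. -/
theorem summable_gaussian (Λ : AddSubgroup V) [DiscreteTopology Λ] (v : V) {a : ℝ} (ha : 0 < a)
    (c : ℝ) : Summable fun γ : Λ =>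
      (1 + ‖v + (γ : V)‖) * Real.exp (-a * ‖v + (γ : V)‖ ^ 2 + c * ‖v + (γ : V)‖) := by
  have : DiscreteTopology (AddSubgroup.toIntSubmodule Λ) := ‹DiscreteTopology Λ›
  -- Negative powers of the norm are summable over a lattice once the exponent exceeds its rank.
  set N := finrank ℤ (AddSubgroup.toIntSubmodule Λ) + 1 with hN
  obtain ⟨K, hK⟩ := exists_gaussian_bound a c ha N
  have h1 : Summable fun γ : Λ => ‖(γ : V) - (-v)‖ ^ (-(N : ℝ)) :=
    ZLattice.summable_norm_sub_rpow (AddSubgroup.toIntSubmodule Λ) (-(N : ℝ))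
      (by rw [hN]; push_cast; linarith) (-v)
  refine Summable.of_norm_bounded_eventually (h1.mul_left K) ?_
  -- The comparison divides by a power of $\|v+\gamma\|$, which vanishes for at most one `γ`.
  have h2 : {γ : Λ | v + (γ : V) = 0}.Finite := by
    refine Set.Subsingleton.finite fun x hx y hy => Subtype.ext ?_
    have : v + (x : V) = v + y := by rw [show v + (x : V) = 0 from hx, show v + (y : V) = 0 from hy]
    exact add_left_cancel this
  filter_upwards [h2.compl_mem_cofinite] with γ hγ
  have h3 : 0 < ‖v + (γ : V)‖ := norm_pos_iff.mpr hγ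
  rw [Real.norm_of_nonneg (by positivity), sub_neg_eq_add, add_comm (γ : V) v,
    Real.rpow_neg h3.le, Real.rpow_natCast, ← div_eq_mul_inv, le_div_iff₀ (by positivity)]
  exact hK _ h3.le

end Summability

/-! ### Termwise differentiation of series of exponentials. -/

section ExpSeries

variable {E : Type*} [NormedAddCommGroup E] [NormedSpace ℝ E] {ι : Type*}
  {c : ι → ℂ} {L : ι → E →L[ℝ] ℂ}

theorem norm_exp_le (l : E →L[ℝ] ℂ) {x : E} {R : ℝ} (hx : ‖x‖ ≤ R) :
    ‖Complex.exp (l x)‖ ≤ Real.exp (‖l‖ * R) := by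
  rw [Complex.norm_exp]
  refine Real.exp_le_exp.mpr (((Complex.re_le_norm _).trans (l.le_opNorm x)).trans ?_)
  gcongr

variable (h : ∀ R : ℝ, Summable fun i => ‖c i‖ * (1 + ‖L i‖) * Real.exp (‖L i‖ * R))
include h

theorem summable_expSeries (x : E) : Summable fun i => c i * Complex.exp (L i x) := by
  refine Summable.of_norm_bounded (h ‖x‖) fun i => ?_
  rw [norm_mul]
  have h1 := norm_exp_le (L i) (le_refl ‖x‖)
  have h2 : ‖c i‖ ≤ ‖c i‖ * (1 + ‖L i‖) := by nlinarith [norm_nonneg (c i), norm_nonneg (L i)]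
  gcongr

/-- On a ball the differentiated terms are dominated uniformly; the factor $1+\|L_i\|$ in the
hypothesis covers both the term and its derivative. -/
theorem hasFDerivAt_expSeries (x : E) :
    HasFDerivAt (fun y => ∑' i, c i * Complex.exp (L i y))
      (∑' i, (c i * Complex.exp (L i x)) • L i) x := by
  have hx : x ∈ Metric.ball (0 : E) (‖x‖ + 1) := by simp
  refine hasFDerivAt_tsum_of_isPreconnected (h (‖x‖ + 1))
    Metric.isOpen_ball (convex_ball (0 : E) (‖x‖ + 1)).isPreconnected
    (f' := fun i y => (c i * Complex.exp (L i y)) • L i) ?_ ?_ hx (summable_expSeries h x) hx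
  · intro i y _
    have := ((L i).hasFDerivAt (x := y)).cexp.const_mul (c i)
    simpa only [smul_smul] using this
  · intro i y hy
    have hy' : ‖y‖ ≤ ‖x‖ + 1 := by simpa using (Metric.mem_ball.mp hy).le
    rw [norm_smul, norm_mul]
    have h1 := norm_exp_le (L i) hy'
    calc ‖c i‖ * ‖Complex.exp (L i y)‖ * ‖L i‖
        ≤ ‖c i‖ * Real.exp (‖L i‖ * (‖x‖ + 1)) * (1 + ‖L i‖) := by
          gcongr
          linarith
      _ = _ := by ring

theorem contDiff_expSeries : ContDiff ℝ 1 (fun y => ∑' i, c i * Complex.exp (L i y)) := by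
  refine contDiff_one_iff_hasFDerivAt.mpr ⟨_, ?_, hasFDerivAt_expSeries h⟩
  rw [continuous_iff_continuousAt]
  intro x
  have hx : Metric.ball (0 : E) (‖x‖ + 1) ∈ nhds x := Metric.isOpen_ball.mem_nhds (by simp)
  refine ContinuousOn.continuousAt (continuousOn_tsum (fun i => ?_) (h (‖x‖ + 1)) ?_) hx
  · exact (continuous_const.mul (L i).continuous.cexp).smul continuous_const |>.continuousOn
  · intro i y hy
    have hy' : ‖y‖ ≤ ‖x‖ + 1 := by simpa using (Metric.mem_ball.mp hy).le
    rw [norm_smul, norm_mul]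
    have h1 := norm_exp_le (L i) hy'
    calc ‖c i‖ * ‖Complex.exp (L i y)‖ * ‖L i‖
        ≤ ‖c i‖ * Real.exp (‖L i‖ * (‖x‖ + 1)) * (1 + ‖L i‖) := by
          gcongr
          linarith
      _ = _ := by ring

end ExpSeries

/-! ### Linearity of the complexified pairing. -/

section ZetaForm

variable {V : Type*} [AddCommGroup V] [Module ℝ V] {B : LinearMap.BilinForm ℝ V}

theorem zetaForm_add (τ : UpperHalfPlane) (x y : V × V) (v : V) :
    zetaForm B τ (x + y) v = zetaForm B τ x v + zetaForm B τ y v := by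
  simp only [zetaForm, Prod.fst_add, Prod.snd_add, map_add, LinearMap.add_apply]
  push_cast
  ring

theorem zetaForm_smul (τ : UpperHalfPlane) (t : ℝ) (x : V × V) (v : V) :
    zetaForm B τ (t • x) v = t * zetaForm B τ x v := by
  simp only [zetaForm, Prod.smul_fst, Prod.smul_snd, map_smul, LinearMap.smul_apply, smul_eq_mul]
  push_cast
  ring

theorem zetaForm_add_right (τ : UpperHalfPlane) (x : V × V) (u v : V) :
    zetaForm B τ x (u + v) = zetaForm B τ x u + zetaForm B τ x v := by
  simp only [zetaForm, map_add]
  push_cast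
  ring

theorem zetaForm_smul_right (τ : UpperHalfPlane) (t : ℝ) (x : V × V) (v : V) :
    zetaForm B τ x (t • v) = t * zetaForm B τ x v := by
  simp only [zetaForm, map_smul, smul_eq_mul]
  push_cast
  ring

end ZetaForm

/-! ### Convergence of theta series. -/

section Theta

variable {V : Type*} [NormedAddCommGroup V] [InnerProductSpace ℝ V]
variable {B : LinearMap.BilinForm ℝ V}

/-- The exponent `-2 π i k B(ζ, γ)` of the theta series, as a real linear map. -/
noncomputable def thetaExponent (B : LinearMap.BilinForm ℝ V) (τ : UpperHalfPlane) (k : ℕ) (γ : V) :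
    V × V →ₗ[ℝ] ℂ where
  toFun x := -2 * Complex.I * (Real.pi : ℂ) * (k : ℂ) * zetaForm B τ x γ
  map_add' x y := by rw [zetaForm_add]; ring
  map_smul' t x := by
    rw [zetaForm_smul, RingHom.id_apply, Complex.real_smul]
    ring

/-- This separates a constant Gaussian coefficient from the exponential of a real linear map, the
shape required by the exponential series above. -/
theorem thetaTerm_eq (τ : UpperHalfPlane) (k : ℕ) (γ : V) (x : V × V) :
    thetaTerm B τ k γ x = thetaTerm B τ k γ 0 * Complex.exp (thetaExponent B τ k γ x) := by
  have h0 : zetaForm B τ 0 γ = 0 := by simp [zetaForm]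
  rw [thetaTerm, thetaTerm, ← Complex.exp_add, h0]
  congr 1
  change _ = _ + -2 * Complex.I * (Real.pi : ℂ) * (k : ℂ) * zetaForm B τ x γ
  ring

variable (hB : ∀ x y, B x y = inner ℝ x y)
include hB

/-- The decay comes from $\operatorname{Re}(i\tau)=-\operatorname{Im}\tau<0$. -/
theorem norm_thetaTerm_zero (τ : UpperHalfPlane) (k : ℕ) (γ : V) :
    ‖thetaTerm B τ k γ 0‖ = Real.exp (-(Real.pi * k * τ.im) * ‖γ‖ ^ 2) := by
  have h0 : zetaForm B τ 0 γ = 0 := by simp [zetaForm]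
  rw [thetaTerm, Complex.norm_exp, h0, hB, real_inner_self_eq_norm_sq]
  congr 1
  have : 2 * Complex.I * (Real.pi : ℂ) * (k : ℂ) * ((τ : ℂ) / 2 * ((‖γ‖ ^ 2 : ℝ) : ℂ) - 0) =
      ((Real.pi * k * ‖γ‖ ^ 2 : ℝ) : ℂ) * (Complex.I * (τ : ℂ)) := by
    push_cast
    ring
  rw [this, Complex.re_ofReal_mul]
  simp
  ring

theorem norm_thetaExponent_le (τ : UpperHalfPlane) (k : ℕ) (γ : V) (x : V × V) :
    ‖thetaExponent B τ k γ x‖ ≤ 2 * Real.pi * k * (1 + ‖(τ : ℂ)‖) * ‖x‖ * ‖γ‖ := by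
  change ‖-2 * Complex.I * (Real.pi : ℂ) * (k : ℂ) * zetaForm B τ x γ‖ ≤ _
  have h1 : ‖zetaForm B τ x γ‖ ≤ (1 + ‖(τ : ℂ)‖) * ‖x‖ * ‖γ‖ := by
    unfold zetaForm
    refine (norm_add_le _ _).trans ?_
    rw [norm_mul, Complex.norm_real, Complex.norm_real, hB, hB]
    have h2 := (norm_inner_le_norm (𝕜 := ℝ) x.1 γ).trans
      (mul_le_mul_of_nonneg_right (norm_fst_le x) (norm_nonneg γ))
    have h3 := (norm_inner_le_norm (𝕜 := ℝ) x.2 γ).trans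
      (mul_le_mul_of_nonneg_right (norm_snd_le x) (norm_nonneg γ))
    have h4 := mul_le_mul_of_nonneg_left h3 (norm_nonneg (τ : ℂ))
    linarith
  simp only [norm_mul, norm_neg, Complex.norm_I, Complex.norm_real, Complex.norm_ofNat,
    Complex.norm_natCast, Real.norm_of_nonneg Real.pi_pos.le, mul_one]
  calc 2 * Real.pi * (k : ℝ) * ‖zetaForm B τ x γ‖
      ≤ 2 * Real.pi * (k : ℝ) * ((1 + ‖(τ : ℂ)‖) * ‖x‖ * ‖γ‖) := by gcongr
    _ = _ := by ring

variable [FiniteDimensional ℝ V]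

/-- The basic convergence statement for theta series, including derivatives. -/
theorem summable_thetaTerm_aux (Λ : AddSubgroup V) [DiscreteTopology Λ] (τ : UpperHalfPlane)
    {k : ℕ} (hk : 0 < k) (μ : V) {d : V → ℂ} {C : ℝ} (hd : ∀ γ : Λ, ‖d (μ + γ)‖ ≤ C)
    {L : Λ → ℝ} {K : ℝ} (hL0 : ∀ γ, 0 ≤ L γ) (hL : ∀ γ : Λ, L γ ≤ K * ‖μ + (γ : V)‖) (R : ℝ) :
    Summable fun γ : Λ => ‖d (μ + γ) * thetaTerm B τ k (μ + γ) 0‖ * (1 + L γ) *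
      Real.exp (L γ * R) := by
  have ha : 0 < Real.pi * k * τ.im := by
    have := τ.im_pos
    have := Real.pi_pos
    positivity
  refine Summable.of_nonneg_of_le (fun γ => ?_) (fun γ => ?_)
    ((summable_gaussian Λ μ ha (|K| * |R|)).mul_left (|C| * (1 + |K|)))
  · have := hL0 γ
    positivity
  · rw [norm_mul, norm_thetaTerm_zero hB]
    have h1 : L γ ≤ |K| * ‖μ + (γ : V)‖ :=
      (hL γ).trans (mul_le_mul_of_nonneg_right (le_abs_self K) (norm_nonneg _))
    have h2 : L γ * R ≤ |K| * |R| * ‖μ + (γ : V)‖ := by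
      calc L γ * R ≤ L γ * |R| := mul_le_mul_of_nonneg_left (le_abs_self R) (hL0 γ)
        _ ≤ |K| * ‖μ + (γ : V)‖ * |R| := by gcongr
        _ = _ := by ring
    have h3 : 1 + L γ ≤ (1 + |K|) * (1 + ‖μ + (γ : V)‖) := by
      nlinarith [norm_nonneg (μ + (γ : V)), abs_nonneg K]
    have h4 : ‖d (μ + γ)‖ ≤ |C| := (hd γ).trans (le_abs_self C)
    have h5 := hL0 γ
    calc ‖d (μ + γ)‖ * Real.exp (-(Real.pi * k * τ.im) * ‖μ + (γ : V)‖ ^ 2) * (1 + L γ) *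
          Real.exp (L γ * R)
        ≤ |C| * Real.exp (-(Real.pi * k * τ.im) * ‖μ + (γ : V)‖ ^ 2) *
          ((1 + |K|) * (1 + ‖μ + (γ : V)‖)) * Real.exp (|K| * |R| * ‖μ + (γ : V)‖) := by
          gcongr
      _ = _ := by
          rw [Real.exp_add]
          ring

theorem summable_mul_thetaTerm (Λ : AddSubgroup V) [DiscreteTopology Λ] (τ : UpperHalfPlane)
    {k : ℕ} (hk : 0 < k) (μ : V) {d : V → ℂ} {C : ℝ} (hd : ∀ γ : Λ, ‖d (μ + γ)‖ ≤ C)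
    (x : V × V) : Summable fun γ : Λ => d (μ + γ) * thetaTerm B τ k (μ + γ) x := by
  refine Summable.of_norm_bounded (summable_thetaTerm_aux hB Λ τ hk μ hd
    (L := fun γ => ‖thetaExponent B τ k (μ + γ) x‖) (fun γ => norm_nonneg _)
    (fun γ => norm_thetaExponent_le hB τ k (μ + γ) x) 1) fun γ => ?_
  rw [thetaTerm_eq, ← mul_assoc, norm_mul, mul_one, Complex.norm_exp]
  have h1 := Complex.re_le_norm (thetaExponent B τ k (μ + γ) x)
  have h2 : ‖d (μ + γ) * thetaTerm B τ k (μ + γ) 0‖ ≤ ‖d (μ + γ) * thetaTerm B τ k (μ + γ) 0‖ *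
      (1 + ‖thetaExponent B τ k (μ + γ) x‖) := by
    nlinarith [norm_nonneg (d (μ + γ) * thetaTerm B τ k (μ + γ) 0),
      norm_nonneg (thetaExponent B τ k (μ + γ) x)]
  gcongr

theorem summable_thetaTerm (Λ : AddSubgroup V) [DiscreteTopology Λ] (τ : UpperHalfPlane)
    {k : ℕ} (hk : 0 < k) (μ : V) (x : V × V) :
    Summable fun γ : Λ => thetaTerm B τ k (μ + γ) x := by
  simpa using summable_mul_thetaTerm hB Λ τ hk μ (d := fun _ => 1) (C := 1) (by simp) x

end Theta
end ThetaAlt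

namespace ThetaAlt

open Module

/-! ### Trivialisation by $s^k$: factors of automorphy and the connection. -/

section Automorphy

variable {V : Type*} [AddCommGroup V] [Module ℝ V] {B : LinearMap.BilinForm ℝ V}

/-- For fixed `u`, the pairing is a complex linear functional of `zeta τ v`. -/
theorem zetaForm_of_zeta_eq (τ : UpperHalfPlane) {v v' : V × V}
    (h : zeta τ v' = Complex.I • zeta τ v) (u : V) :
    zetaForm B τ v' u = Complex.I * zetaForm B τ v u := by
  let f : ℂ ⊗[ℝ] V →ₗ[ℂ] ℂ := TensorProduct.AlgebraTensorModule.lift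
    ((LinearMap.lsmul ℂ (V →ₗ[ℝ] ℂ)).flip (Complex.ofRealCLM.toLinearMap ∘ₗ B.flip u))
  have hf : ∀ v : V × V, f (zeta τ v) = zetaForm B τ v u := by
    intro v
    simp [f, zeta, zetaForm]
  rw [← hf, h, map_smul, hf, smul_eq_mul]

theorem refSection_pow (τ : UpperHalfPlane) (k : ℕ) (x : V × V) :
    refSection B τ x ^ k =
      Complex.exp ((k : ℂ) * (Complex.I * (Real.pi : ℂ) * zetaForm B τ x x.2)) := by
  rw [refSection, ← Complex.exp_nat_mul]

theorem refSection_pow_ne_zero (τ : UpperHalfPlane) (k : ℕ) (x : V × V) :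
    refSection B τ x ^ k ≠ 0 := by
  rw [refSection_pow]
  exact Complex.exp_ne_zero _

variable (hs : ∀ x y, B x y = B y x)
include hs

/-- In the quadratic exponent $i\pi kB(\zeta,q)$ the cross terms with $\gamma$ split into $\tfrac
i2k\omega(\gamma,x)$ and a part depending on $x$ only through $\zeta$; the latter is the factor of
automorphy. -/
theorem refSection_pow_add (τ : UpperHalfPlane) (k : ℕ) (γ x : V × V) :
    refSection B τ (γ + x) ^ k =
      (Circle.exp (Real.pi * B γ.1 γ.2) : ℂ) ^ k * refSection B τ x ^ k *
        Complex.exp ((k : ℂ) * (Complex.I / 2) * (symp B γ x : ℂ)) *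
        Complex.exp (2 * Complex.I * (Real.pi : ℂ) * (k : ℂ) *
          (zetaForm B τ x γ.2 + (τ : ℂ) / 2 * ((B γ.2 γ.2 : ℝ) : ℂ))) := by
  rw [refSection_pow, refSection_pow, Circle.coe_exp, ← Complex.exp_nat_mul, ← Complex.exp_add,
    ← Complex.exp_add, ← Complex.exp_add]
  congr 1
  simp only [zetaForm, symp, Prod.fst_add, Prod.snd_add, map_add, LinearMap.add_apply]
  rw [hs γ.2 x.2]
  push_cast
  ring

/-- In the trivialisation by `s^k`, invariance under the lattice becomes the usual quasi-periodicity
of theta functions. -/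
theorem isLatticeInvariant_mul_refSection_iff (Λ : AddSubgroup V) (τ : UpperHalfPlane)
    (k : ℕ) (H : V × V → ℂ) :
    IsLatticeInvariant B Λ k (fun x => H x * refSection B τ x ^ k) ↔
      ∀ γ : V × V, γ.1 ∈ Λ → γ.2 ∈ Λ → ∀ x, H (γ + x) = H x *
        Complex.exp (-2 * Complex.I * (Real.pi : ℂ) * (k : ℂ) *
          (zetaForm B τ x γ.2 + (τ : ℂ) / 2 * ((B γ.2 γ.2 : ℝ) : ℂ))) := by
  refine forall_congr' fun γ => forall_congr' fun h1 => forall_congr' fun h2 =>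
    forall_congr' fun x => ?_
  have h3 := refSection_pow_ne_zero (B := B) τ k (γ + x)
  have h4 : Complex.exp (-2 * Complex.I * (Real.pi : ℂ) * (k : ℂ) *
      (zetaForm B τ x γ.2 + (τ : ℂ) / 2 * ((B γ.2 γ.2 : ℝ) : ℂ))) *
      refSection B τ (γ + x) ^ k = (Circle.exp (Real.pi * B γ.1 γ.2) : ℂ) ^ k *
        refSection B τ x ^ k * Complex.exp ((k : ℂ) * (Complex.I / 2) * (symp B γ x : ℂ)) := by
    rw [refSection_pow_add hs, mul_comm, mul_assoc, ← Complex.exp_add]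
    have : 2 * Complex.I * (Real.pi : ℂ) * (k : ℂ) *
        (zetaForm B τ x γ.2 + (τ : ℂ) / 2 * ((B γ.2 γ.2 : ℝ) : ℂ)) +
        -2 * Complex.I * (Real.pi : ℂ) * (k : ℂ) *
        (zetaForm B τ x γ.2 + (τ : ℂ) / 2 * ((B γ.2 γ.2 : ℝ) : ℂ)) = 0 := by ring
    rw [this, Complex.exp_zero, mul_one]
  simp only [heisAct, latticeLift, Prod.mk.injEq, true_and]
  constructor
  · intro h
    refine mul_right_cancel₀ h3 ?_
    rw [mul_assoc, h4, ← h]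
    ring
  · intro h
    rw [h, mul_assoc (H x), h4]
    ring

omit hs in
theorem hasDerivAt_refSection_pow (τ : UpperHalfPlane) (k : ℕ) (x v : V × V) :
    HasDerivAt (fun t : ℝ => refSection B τ (x + t • v) ^ k)
      ((k : ℂ) * (Complex.I * (Real.pi : ℂ) * (zetaForm B τ v x.2 + zetaForm B τ x v.2)) *
        refSection B τ x ^ k) 0 := by
  have h1 : ∀ t : ℝ, (k : ℂ) * (Complex.I * (Real.pi : ℂ) *
      zetaForm B τ (x + t • v) (x + t • v).2) =
      (k : ℂ) * (Complex.I * (Real.pi : ℂ) * (zetaForm B τ x x.2 +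
        (t : ℂ) * (zetaForm B τ v x.2 + zetaForm B τ x v.2) + (t : ℂ) ^ 2 * zetaForm B τ v v.2)) := by
    intro t
    rw [zetaForm_add, zetaForm_smul, Prod.snd_add, Prod.smul_snd, zetaForm_add_right,
      zetaForm_smul_right, zetaForm_add_right, zetaForm_smul_right]
    ring
  have ht : HasDerivAt (fun t : ℝ => (t : ℂ)) 1 0 := Complex.ofRealCLM.hasDerivAt
  have h2 := ((((ht.mul_const (zetaForm B τ v x.2 + zetaForm B τ x v.2)).const_add
    (zetaForm B τ x x.2)).add ((ht.pow 2).mul_const (zetaForm B τ v v.2))).const_mul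
    (Complex.I * (Real.pi : ℂ))).const_mul (k : ℂ)
  have h3 := h2.cexp
  convert h3 using 1
  · funext t
    rw [refSection_pow, h1]
    rfl
  · rw [refSection_pow]
    simp
    ring

/-- In the trivialisation by `s^k`, the connection form is of type `(1,0)`. -/
theorem covDeriv_mul_refSection (τ : UpperHalfPlane) (k : ℕ) {H : V × V → ℂ} {x v : V × V} {h' : ℂ}
    (hH : HasLineDerivAt ℝ H h' x v) :
    covDeriv B k (fun y => H y * refSection B τ y ^ k) x v =
      (h' + 2 * Complex.I * (Real.pi : ℂ) * (k : ℂ) * zetaForm B τ v x.2 * H x) *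
        refSection B τ x ^ k := by
  have h1 : HasLineDerivAt ℝ (fun y => H y * refSection B τ y ^ k) _ x v :=
    HasDerivAt.mul hH (hasDerivAt_refSection_pow τ k x v)
  rw [covDeriv, h1.lineDeriv]
  simp only [zero_smul, add_zero, zetaForm, Complex.div_I]
  rw [hs x.2 v.1, hs v.2 x.2]
  push_cast
  ring

/-- The connection term is proportional to $B(\zeta(v),q)$. Since $\zeta(v')=i\zeta(v)$, it cancels
in the combination along $v+iv'$, leaving the plain Cauchy-Riemann equation for $H$. -/
theorem covDeriv_mul_refSection_eq_zero_iff (τ : UpperHalfPlane) (k : ℕ) {H : V × V → ℂ}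
    {x v v' : V × V} {a a' : ℂ} (hv : HasLineDerivAt ℝ H a x v) (hv' : HasLineDerivAt ℝ H a' x v')
    (hvv' : zeta τ v' = Complex.I • zeta τ v) :
    covDeriv B k (fun y => H y * refSection B τ y ^ k) x v +
      Complex.I * covDeriv B k (fun y => H y * refSection B τ y ^ k) x v' = 0 ↔
      a + Complex.I * a' = 0 := by
  rw [covDeriv_mul_refSection hs τ k hv, covDeriv_mul_refSection hs τ k hv',
    zetaForm_of_zeta_eq τ hvv']
  have h3 := refSection_pow_ne_zero (B := B) τ k x
  have : (a + 2 * Complex.I * (Real.pi : ℂ) * (k : ℂ) * zetaForm B τ v x.2 * H x) *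
        refSection B τ x ^ k + Complex.I * ((a' + 2 * Complex.I * (Real.pi : ℂ) * (k : ℂ) *
        (Complex.I * zetaForm B τ v x.2) * H x) * refSection B τ x ^ k) =
      (a + Complex.I * a') * refSection B τ x ^ k := by
    linear_combination (2 * Complex.I * (Real.pi : ℂ) * (k : ℂ) * zetaForm B τ v x.2 * H x *
      refSection B τ x ^ k) * Complex.I_sq
  rw [this, mul_eq_zero, or_iff_left h3]

end Automorphy

/-! ### Theta series with periodic coefficients are holomorphic sections. -/

section ThetaSum

variable {V : Type*} [NormedAddCommGroup V] [InnerProductSpace ℝ V] {B : LinearMap.BilinForm ℝ V}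

/-- The lattice `k⁻¹ Λ*`. -/
def dualLattice (B : LinearMap.BilinForm ℝ V) (Λ : AddSubgroup V) (k : ℕ) : AddSubgroup V where
  carrier := {μ | ∀ γ ∈ Λ, ∃ m : ℤ, B ((k : ℝ) • μ) γ = m}
  zero_mem' γ _ := ⟨0, by simp⟩
  add_mem' {μ ν} hμ hν γ hγ := by
    obtain ⟨m, hm⟩ := hμ γ hγ
    obtain ⟨n, hn⟩ := hν γ hγ
    exact ⟨m + n, by rw [smul_add, map_add, LinearMap.add_apply, hm, hn]; push_cast; rfl⟩
  neg_mem' {μ} hμ γ hγ := by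
    obtain ⟨m, hm⟩ := hμ γ hγ
    exact ⟨-m, by rw [smul_neg, map_neg, LinearMap.neg_apply, hm]; push_cast; rfl⟩

/-- The theta series with coefficients `d` on the lattice `P`. -/
noncomputable def thetaSum (B : LinearMap.BilinForm ℝ V) (P : AddSubgroup V) (τ : UpperHalfPlane)
    (k : ℕ) (d : V → ℂ) (x : V × V) : ℂ :=
  ∑' μ : P, d μ * thetaTerm B τ k μ x

variable (hB : ∀ x y, B x y = inner ℝ x y)
include hB

theorem form_symm (x y : V) : B x y = B y x := by
  rw [hB, hB, real_inner_comm]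

/-- Completing the square turns the shift of $q$ into a shift of the index. The shift of $p$
contributes $\exp(-2\pi ik B(\gamma_1,\mu))$, which is $1$ because $\mu\in k^{-1}\Lambda^*$. -/
theorem thetaTerm_add (τ : UpperHalfPlane) (k : ℕ) {Λ : AddSubgroup V} {γ : V × V} (h1 : γ.1 ∈ Λ)
    {μ : V} (hμ : μ ∈ dualLattice B Λ k) (x : V × V) :
    thetaTerm B τ k μ (γ + x) = thetaTerm B τ k (μ - γ.2) x *
      Complex.exp (-2 * Complex.I * (Real.pi : ℂ) * (k : ℂ) *
          (zetaForm B τ x γ.2 + (τ : ℂ) / 2 * ((B γ.2 γ.2 : ℝ) : ℂ))) := by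
  obtain ⟨m, hm⟩ := hμ γ.1 h1
  rw [map_smul, LinearMap.smul_apply, smul_eq_mul] at hm
  have hm' : (k : ℂ) * ((B γ.1 μ : ℝ) : ℂ) = (m : ℂ) := by
    rw [form_symm hB γ.1 μ]
    exact_mod_cast congrArg (fun r : ℝ => (r : ℂ)) hm
  rw [thetaTerm, thetaTerm, ← Complex.exp_add]
  refine Complex.exp_eq_exp_iff_exists_int.mpr ⟨-m, ?_⟩
  simp only [zetaForm, Prod.fst_add, Prod.snd_add, map_add, LinearMap.add_apply, map_sub,
    LinearMap.sub_apply]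
  rw [form_symm hB μ γ.2]
  push_cast
  linear_combination (-2 * Complex.I * (Real.pi : ℂ)) * hm'

variable [FiniteDimensional ℝ V]

variable {E : Type*} [NormedAddCommGroup E] [NormedSpace ℝ E] [FiniteDimensional ℝ E]

omit hB [FiniteDimensional ℝ V] in
/-- The exponent of the theta series in a linear chart, as a continuous linear map. -/
noncomputable def thetaExponentL (B : LinearMap.BilinForm ℝ V) (τ : UpperHalfPlane) (k : ℕ)
    (A : E →ₗ[ℝ] V × V) (γ : V) : E →L[ℝ] ℂ :=
  LinearMap.toContinuousLinearMap (thetaExponent B τ k γ ∘ₗ A)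

omit hB [FiniteDimensional ℝ V] in
theorem thetaExponentL_apply (τ : UpperHalfPlane) (k : ℕ) (A : E →ₗ[ℝ] V × V) (γ : V) (x : E) :
    thetaExponentL B τ k A γ x =
      -2 * Complex.I * (Real.pi : ℂ) * (k : ℂ) * zetaForm B τ (A x) γ :=
  rfl

omit [FiniteDimensional ℝ V] in
theorem exists_norm_thetaExponentL_le (τ : UpperHalfPlane) (k : ℕ) (A : E →ₗ[ℝ] V × V) :
    ∃ K : ℝ, ∀ γ, ‖thetaExponentL B τ k A γ‖ ≤ K * ‖γ‖ := by
  refine ⟨2 * Real.pi * k * (1 + ‖(τ : ℂ)‖) * ‖LinearMap.toContinuousLinearMap A‖, fun γ => ?_⟩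
  refine ContinuousLinearMap.opNorm_le_bound _ (by have := Real.pi_pos; positivity) fun x => ?_
  refine (norm_thetaExponent_le hB τ k γ (A x)).trans ?_
  have h1 : ‖A x‖ ≤ ‖LinearMap.toContinuousLinearMap A‖ * ‖x‖ :=
    (LinearMap.toContinuousLinearMap A).le_opNorm x
  have := Real.pi_pos
  calc 2 * Real.pi * k * (1 + ‖(τ : ℂ)‖) * ‖A x‖ * ‖γ‖
      ≤ 2 * Real.pi * k * (1 + ‖(τ : ℂ)‖) * (‖LinearMap.toContinuousLinearMap A‖ * ‖x‖) * ‖γ‖ := by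
        gcongr
    _ = _ := by ring

theorem summable_thetaSum_aux (P : AddSubgroup V) [DiscreteTopology P] (τ : UpperHalfPlane)
    {k : ℕ} (hk : 0 < k) {d : V → ℂ} {C : ℝ} (hd : ∀ μ ∈ P, ‖d μ‖ ≤ C) (A : E →ₗ[ℝ] V × V)
    (R : ℝ) :
    Summable fun μ : P => ‖d μ * thetaTerm B τ k μ 0‖ *
      (1 + ‖thetaExponentL B τ k A (μ : V)‖) * Real.exp (‖thetaExponentL B τ k A (μ : V)‖ * R) := by
  obtain ⟨K, hK⟩ := exists_norm_thetaExponentL_le hB τ k A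
  have h1 := summable_thetaTerm_aux hB P τ hk 0 (d := d) (C := C) (fun μ => by
    rw [zero_add]; exact hd μ μ.2)
    (L := fun μ => ‖thetaExponentL B τ k A (μ : V)‖)
    (K := K) (fun μ => norm_nonneg _) (fun μ => by rw [zero_add]; exact hK μ) R
  simpa only [zero_add] using h1

omit hB [FiniteDimensional ℝ V] in
theorem thetaSum_comp_eq (P : AddSubgroup V) (τ : UpperHalfPlane) (k : ℕ) (d : V → ℂ)
    (A : E →ₗ[ℝ] V × V) :
    (fun x => thetaSum B P τ k d (A x)) = fun x => ∑' μ : P, (d μ * thetaTerm B τ k μ 0) *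
      Complex.exp (thetaExponentL B τ k A (μ : V) x) := by
  funext x
  refine tsum_congr fun μ => ?_
  rw [thetaTerm_eq, mul_assoc]
  rfl

theorem isC1_thetaSum (P : AddSubgroup V) [DiscreteTopology P] (τ : UpperHalfPlane)
    {k : ℕ} (hk : 0 < k) {d : V → ℂ} {C : ℝ} (hd : ∀ μ ∈ P, ‖d μ‖ ≤ C) :
    IsC1 (thetaSum B P τ k d) := by
  intro n A
  rw [thetaSum_comp_eq]
  exact contDiff_expSeries (summable_thetaSum_aux hB P τ hk hd A)

theorem exists_hasFDerivAt_thetaSum (P : AddSubgroup V) [DiscreteTopology P]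
    (τ : UpperHalfPlane) {k : ℕ} (hk : 0 < k) {d : V → ℂ} {C : ℝ} (hd : ∀ μ ∈ P, ‖d μ‖ ≤ C)
    (A : E →ₗ[ℝ] V × V) (x : E) :
    ∃ D : E →L[ℝ] ℂ, HasFDerivAt (fun x => thetaSum B P τ k d (A x)) D x ∧
      ∀ v, HasSum (fun μ : P => (d μ * thetaTerm B τ k μ 0 * Complex.exp
      (thetaExponentL B τ k A (μ : V) x)) * thetaExponentL B τ k A (μ : V) v) (D v) := by
  have hsum := summable_thetaSum_aux hB P τ hk hd A
  have h1 := hasFDerivAt_expSeries hsum x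
  rw [← thetaSum_comp_eq] at h1
  refine ⟨_, h1, fun v => ?_⟩
  have h2 : Summable fun μ : P => (d μ * thetaTerm B τ k μ 0 * Complex.exp
      (thetaExponentL B τ k A (μ : V) x)) • thetaExponentL B τ k A (μ : V) := by
    refine Summable.of_norm_bounded (hsum ‖x‖) fun μ => ?_
    rw [norm_smul, norm_mul]
    have h3 := norm_exp_le (thetaExponentL B τ k A (μ : V)) (le_refl ‖x‖)
    rw [mul_right_comm]
    gcongr
    linarith
  exact h2.hasSum.mapL (ContinuousLinearMap.apply ℝ ℂ v)

/-- Each term is an exponential of a complex linear function of $\zeta$, so the derivatives in the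
directions $v$ and $v'$ cancel term by term. -/
theorem exists_hasLineDerivAt_thetaSum (P : AddSubgroup V) [DiscreteTopology P]
    (τ : UpperHalfPlane) {k : ℕ} (hk : 0 < k) {d : V → ℂ} {C : ℝ} (hd : ∀ μ ∈ P, ‖d μ‖ ≤ C)
    (x : V × V) {v v' : V × V} (hv : zeta τ v' = Complex.I • zeta τ v) :
    ∃ a a' : ℂ, HasLineDerivAt ℝ (thetaSum B P τ k d) a x v ∧
      HasLineDerivAt ℝ (thetaSum B P τ k d) a' x v' ∧ a + Complex.I * a' = 0 := by
  obtain ⟨D, h1, h3⟩ := exists_hasFDerivAt_thetaSum hB P τ hk hd LinearMap.id x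
  refine ⟨_, _, h1.hasLineDerivAt v, h1.hasLineDerivAt v', ?_⟩
  have h5 := (h3 v).add ((h3 v').mul_left Complex.I)
  refine h5.unique (hasSum_zero.congr_fun fun μ => ?_)
  simp only [thetaExponentL_apply, LinearMap.id_apply, zetaForm_of_zeta_eq τ hv]
  ring_nf
  rw [Complex.I_pow_three]
  ring

omit [FiniteDimensional ℝ V] in
theorem isC1_refSection_pow (τ : UpperHalfPlane) (k : ℕ) :
    IsC1 (fun x : V × V => refSection B τ x ^ k) := by
  intro n A
  have h1 : ContDiff ℝ 1 fun c => (A c).1 :=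
    (LinearMap.toContinuousLinearMap (LinearMap.fst ℝ V V ∘ₗ A)).contDiff
  have h2 : ContDiff ℝ 1 fun c => (A c).2 :=
    (LinearMap.toContinuousLinearMap (LinearMap.snd ℝ V V ∘ₗ A)).contDiff
  have h3 : ContDiff ℝ 1 fun c => ((B (A c).1 (A c).2 : ℝ) : ℂ) := by
    simp only [hB]
    exact Complex.ofRealCLM.contDiff.comp (h1.inner ℝ h2)
  have h4 : ContDiff ℝ 1 fun c => ((B (A c).2 (A c).2 : ℝ) : ℂ) := by
    simp only [hB]
    exact Complex.ofRealCLM.contDiff.comp (h2.inner ℝ h2)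
  exact (contDiff_const.mul (h3.add (contDiff_const.mul h4))).cexp.pow k

omit [FiniteDimensional ℝ V] in
theorem thetaSum_add (Λ : AddSubgroup V) (τ : UpperHalfPlane) (k : ℕ) {d : V → ℂ}
    (hΛ : Λ ≤ dualLattice B Λ k) (hd : ∀ μ ∈ dualLattice B Λ k, ∀ γ ∈ Λ, d (μ + γ) = d μ)
    {γ : V × V} (h1 : γ.1 ∈ Λ) (h2 : γ.2 ∈ Λ) (x : V × V) :
    thetaSum B (dualLattice B Λ k) τ k d (γ + x) = thetaSum B (dualLattice B Λ k) τ k d x *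
      Complex.exp (-2 * Complex.I * (Real.pi : ℂ) * (k : ℂ) *
          (zetaForm B τ x γ.2 + (τ : ℂ) / 2 * ((B γ.2 γ.2 : ℝ) : ℂ))) := by
  rw [thetaSum, thetaSum, ← tsum_mul_right,
    ← (Equiv.addRight (⟨γ.2, hΛ h2⟩ : dualLattice B Λ k)).tsum_eq]
  refine tsum_congr fun μ => ?_
  rw [thetaTerm_add hB τ k h1 (Subtype.prop _), Equiv.coe_addRight, AddSubgroup.coe_add,
    add_sub_cancel_right, hd μ μ.2 _ h2]
  ring

/-- Theta series with bounded periodic coefficients are holomorphic sections. -/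
theorem thetaSum_mul_mem_holSections (Λ : AddSubgroup V) (τ : UpperHalfPlane) {k : ℕ} (hk : 0 < k)
    [DiscreteTopology (dualLattice B Λ k)] (hΛ : Λ ≤ dualLattice B Λ k) {d : V → ℂ}
    (hd : ∀ μ ∈ dualLattice B Λ k, ∀ γ ∈ Λ, d (μ + γ) = d μ) {C : ℝ}
    (hC : ∀ μ ∈ dualLattice B Λ k, ‖d μ‖ ≤ C) :
    (fun x => thetaSum B (dualLattice B Λ k) τ k d x * refSection B τ x ^ k) ∈
      holSections B Λ τ k := by
  refine ⟨?_, ?_, ?_⟩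
  · rw [isLatticeInvariant_mul_refSection_iff (form_symm hB)]
    exact fun γ h1 h2 x => thetaSum_add hB Λ τ k hΛ hd h1 h2 x
  · intro n A
    exact (isC1_thetaSum hB _ τ hk hC n A).mul (isC1_refSection_pow hB τ k n A)
  · intro x v v' hv
    obtain ⟨a, a', h1, h2, h3⟩ := exists_hasLineDerivAt_thetaSum hB _ τ hk hC x hv
    exact (covDeriv_mul_refSection_eq_zero_iff (form_symm hB) τ k h1 h2 hv).mpr h3

end ThetaSum
end ThetaAlt

namespace ThetaAlt

open Module

/-! ### Fourier series of functions periodic under a lattice. -/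

section Fourier

open MeasureTheory Set Filter Topology

/-- The normalised measure on `ℝ / ℤ`. -/
noncomputable local instance : MeasureSpace UnitAddCircle := ⟨AddCircle.haarAddCircle⟩

local instance : Measure.IsAddHaarMeasure (volume : Measure UnitAddCircle) :=
  inferInstanceAs (Measure.IsAddHaarMeasure AddCircle.haarAddCircle)

local instance : IsProbabilityMeasure (volume : Measure UnitAddCircle) :=
  inferInstanceAs (IsProbabilityMeasure AddCircle.haarAddCircle)

variable {ι : Type*} [Fintype ι]

/-- The projection `ℝⁿ → ℝⁿ / ℤⁿ`. -/
def torusMk (x : ι → ℝ) : UnitAddTorus ι := fun i => (x i : UnitAddCircle)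

omit [Fintype ι] in
theorem isOpenQuotientMap_torusMk : IsOpenQuotientMap (torusMk (ι := ι)) :=
  IsOpenQuotientMap.piMap fun _ => QuotientAddGroup.isOpenQuotientMap_mk

variable {V : Type*} [NormedAddCommGroup V] [InnerProductSpace ℝ V]
variable (b : Basis ι ℝ V)

/-- The mean value of a function over the fundamental box of a basis. -/
noncomputable def boxMean (f : V → ℂ) : ℂ :=
  ∫ x in {x : ι → ℝ | ∀ i, x i ∈ Ioc (0 : ℝ) (0 + 1)}, f (b.equivFun.symm x)

variable {b} {Λ : AddSubgroup V} (hΛ : ∀ v, v ∈ Λ ↔ ∀ i, ∃ m : ℤ, b.repr v i = m)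
include hΛ

/-- In the coordinates of `b` the lattice is $\mathbb Z^n$, so `f` factors through the quotient map
onto the standard torus. -/
theorem exists_torus_lift {f : V → ℂ} (hf : Continuous f) (hp : ∀ γ ∈ Λ, ∀ v, f (γ + v) = f v) :
    ∃ F : C(UnitAddTorus ι, ℂ), ∀ x : ι → ℝ, F (torusMk x) = f (b.equivFun.symm x) := by
  let q : C(ι → ℝ, UnitAddTorus ι) := ⟨torusMk, isOpenQuotientMap_torusMk.continuous⟩
  have hq : IsQuotientMap q := isOpenQuotientMap_torusMk.isQuotientMap
  let g : C(ι → ℝ, ℂ) := ⟨fun x => f (b.equivFun.symm x),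
    hf.comp (LinearMap.continuous_of_finiteDimensional b.equivFun.symm.toLinearMap)⟩
  have hg : Function.FactorsThrough g q := by
    intro x y hxy
    have h1 : b.equivFun.symm (x - y) ∈ Λ := by
      rw [hΛ]
      intro i
      have h2 : (x i : UnitAddCircle) = y i := congrFun hxy i
      rw [← sub_eq_zero, ← AddCircle.coe_sub, AddCircle.coe_eq_zero_iff] at h2
      obtain ⟨m, hm⟩ := h2
      refine ⟨m, ?_⟩
      rw [← b.equivFun_apply, LinearEquiv.apply_symm_apply, Pi.sub_apply, ← hm]
      simp
    have h2 := hp _ h1 (b.equivFun.symm y)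
    rw [← map_add, sub_add_cancel] at h2
    exact h2
  exact ⟨hq.lift g hg, fun x => DFunLike.congr_fun (hq.lift_comp g hg) x⟩

omit hΛ in
theorem boxMean_eq_integral {f : V → ℂ} {F : C(UnitAddTorus ι, ℂ)}
    (hF : ∀ x : ι → ℝ, F (torusMk x) = f (b.equivFun.symm x)) :
    boxMean b f = ∫ t, F t := by
  rw [UnitAddTorus.integral_preimage F (fun _ => 0)]
  exact integral_congr_ae (Eventually.of_forall fun x => (hF x).symm)

/-- The mean over the box is the Haar integral over the torus, which is translation invariant. -/
theorem boxMean_translate {f : V → ℂ} (hf : Continuous f)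
    (hp : ∀ γ ∈ Λ, ∀ v, f (γ + v) = f v) (u : V) :
    boxMean b (fun v => f (v + u)) = boxMean b f := by
  obtain ⟨F, hF⟩ := exists_torus_lift hΛ hf hp
  rw [boxMean_eq_integral hF]
  let G : C(UnitAddTorus ι, ℂ) := ⟨fun t => F (t + torusMk (b.equivFun u)), by fun_prop⟩
  have hG : ∀ x : ι → ℝ, G (torusMk x) = f (b.equivFun.symm x + u) := by
    intro x
    have h1 : torusMk x + torusMk (b.equivFun u) = torusMk (x + b.equivFun u) := by
      funext i
      rfl
    change F (torusMk x + torusMk (b.equivFun u)) = _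
    rw [h1, hF, map_add, LinearEquiv.symm_apply_apply]
  rw [boxMean_eq_integral (f := fun v => f (v + u)) hG]
  exact integral_add_right_eq_self (μ := (volume : Measure (UnitAddTorus ι))) F _

variable {B : LinearMap.BilinForm ℝ V} {k : ℕ} {P : AddSubgroup V}
variable {σ : P ≃ (ι → ℤ)} (hσ : ∀ (μ : P) (i : ι), ((σ μ i : ℤ) : ℝ) = -(k * B (b i) μ))

-- The sign in `hσ` is chosen so that the monomial of index `σ μ` is the character $\exp(-2\pi
-- ikB(p,\mu))$ occurring in the theta terms.
omit hΛ in
include hσ in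
theorem mFourier_torusMk (μ : P) (x : ι → ℝ) :
    UnitAddTorus.mFourier (σ μ) (torusMk x) =
      Complex.exp (-(2 * Complex.I * Real.pi * k * B (b.equivFun.symm x) μ)) := by
  have h1 : B (b.equivFun.symm x) μ = ∑ i, x i * B (b i) μ := by
    rw [Basis.equivFun_symm_apply, map_sum, LinearMap.sum_apply]
    simp
  change ∏ i, fourier (σ μ i) (x i : UnitAddCircle) = _
  simp only [fourier_coe_apply, ← Complex.exp_sum]
  congr 1
  rw [h1]
  push_cast
  rw [Finset.mul_sum, ← Finset.sum_neg_distrib]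
  refine Finset.sum_congr rfl fun i _ => ?_
  have h2 := congrArg (fun r : ℝ => (r : ℂ)) (hσ μ i)
  push_cast at h2
  rw [h2]
  ring

include hσ in
/-- Fourier inversion for functions which are periodic with respect to a lattice. -/
theorem hasSum_fourier {f : V → ℂ} (hf : Continuous f) (hp : ∀ γ ∈ Λ, ∀ v, f (γ + v) = f v)
    (hs : Summable fun μ : P =>
      boxMean b fun v => f v * Complex.exp (2 * Complex.I * Real.pi * k * B v μ)) (v : V) :
    HasSum (fun μ : P => (boxMean b fun v => f v *
      Complex.exp (2 * Complex.I * Real.pi * k * B v μ)) *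
        Complex.exp (-(2 * Complex.I * Real.pi * k * B v μ))) (f v) := by
  obtain ⟨F, hF⟩ := exists_torus_lift hΛ hf hp
  have h1 : ∀ μ : P, (boxMean b fun v => f v *
      Complex.exp (2 * Complex.I * Real.pi * k * B v μ)) = UnitAddTorus.mFourierCoeff F (σ μ) := by
    intro μ
    rw [UnitAddTorus.mFourierCoeff_eq_integral F (σ μ) (fun _ => 0), boxMean]
    refine integral_congr_ae (Eventually.of_forall fun x => ?_)
    have h2 := mFourier_torusMk hσ μ x
    change _ = UnitAddTorus.mFourier (-σ μ) (torusMk x) • F (torusMk x)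
    rw [UnitAddTorus.mFourier_neg, h2, hF, ← Complex.exp_conj, smul_eq_mul]
    refine (mul_comm _ _).trans ?_
    congr 2
    simp only [map_neg, map_mul, Complex.conj_I, Complex.conj_ofReal, map_natCast, map_ofNat]
    ring
  simp only [h1] at hs ⊢
  have hs' : Summable (UnitAddTorus.mFourierCoeff F) := by
    rw [← σ.summable_iff]
    exact hs
  have h3 := UnitAddTorus.hasSum_mFourier_series_apply_of_summable hs' (torusMk (b.equivFun v))
  rw [← σ.hasSum_iff, hF, LinearEquiv.symm_apply_apply] at h3
  refine h3.congr_fun fun μ => ?_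
  rw [Function.comp_apply, mFourier_torusMk hσ, LinearEquiv.symm_apply_apply, smul_eq_mul]

omit hΛ in
include hσ in
/-- An absolutely convergent Fourier series which vanishes identically is trivial. -/
theorem eq_zero_of_hasSum_fourier {c : P → ℂ} (hc : Summable c)
    (h0 : ∀ v, HasSum (fun μ : P => c μ *
        Complex.exp (-(2 * Complex.I * Real.pi * k * B v μ))) 0) (μ : P) : c μ = 0 := by
  -- Summability gives uniform convergence on the torus, to zero. Passing to $L^2$, orthonormality
  -- of the monomials isolates one coefficient.
  have h1 : HasSum (fun n => c (σ.symm n) • UnitAddTorus.mFourierLp 2 n)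
      (0 : Lp ℂ 2 (volume : Measure (UnitAddTorus ι))) := by
    have h2 : Summable fun n => c (σ.symm n) • UnitAddTorus.mFourier n := by
      refine Summable.of_norm ?_
      simp only [norm_smul, UnitAddTorus.mFourier_norm, mul_one]
      exact (σ.symm.summable_iff (f := fun μ => ‖c μ‖)).mpr hc.norm
    obtain ⟨F, hF⟩ := h2
    have hF0 : F = 0 := by
      ext t
      obtain ⟨x, rfl⟩ := isOpenQuotientMap_torusMk.surjective t
      have h3 := (ContinuousMap.evalCLM ℂ (torusMk x)).hasSum hF
      have h4 := h0 (b.equivFun.symm x)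
      rw [← σ.symm.hasSum_iff] at h4
      refine h3.unique (h4.congr_fun fun n => ?_)
      have h5 := mFourier_torusMk hσ (σ.symm n) x
      rw [Equiv.apply_symm_apply] at h5
      simp only [Function.comp_apply, map_smul, smul_eq_mul, ← h5]
      rfl
    rw [hF0] at hF
    have h6 := (ContinuousMap.toLp (E := ℂ) 2 (volume : Measure (UnitAddTorus ι)) ℂ).hasSum hF
    simpa using h6
  have h2 := (innerSL ℂ (UnitAddTorus.mFourierLp (d := ι) 2 (σ μ))).hasSum h1
  have h3 : HasSum (fun n => if n = σ μ then c μ else 0) (0 : ℂ) := by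
    rw [map_zero] at h2
    refine h2.congr_fun fun n => ?_
    have h4 := orthonormal_iff_ite.mp (UnitAddTorus.orthonormal_mFourier (d := ι)) (σ μ) n
    simp only [map_smul, innerSL_apply_apply, smul_eq_mul, h4, eq_comm (a := σ μ)]
    split_ifs with h5
    · rw [h5, Equiv.symm_apply_apply, mul_one]
    · rw [mul_zero]
  exact (hasSum_ite_eq (σ μ) (c μ)).unique h3

end Fourier
end ThetaAlt

namespace ThetaAlt

open Module

/-! ### Means over a period of holomorphic functions. -/

section BoxMean

open MeasureTheory Set Filter Topology

variable {ι : Type*} [Fintype ι] {V : Type*} [NormedAddCommGroup V] [InnerProductSpace ℝ V]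
variable {b : Basis ι ℝ V}

theorem measurableSet_box :
    MeasurableSet {x : ι → ℝ | ∀ i, x i ∈ Ioc (0 : ℝ) (0 + 1)} :=
  MeasurableSet.univ_pi' fun _ => measurableSet_Ioc

omit [Fintype ι] in
theorem box_subset_Icc :
    {x : ι → ℝ | ∀ i, x i ∈ Ioc (0 : ℝ) (0 + 1)} ⊆ Icc 0 1 := by
  intro x hx
  exact ⟨fun i => (hx i).1.le, fun i => by simpa using (hx i).2⟩

theorem hasDerivAt_integral_box {E : Type*} [NormedAddCommGroup E] [NormedSpace ℝ E]
    {A : (ι → ℝ) → E} (hA : Continuous A) {g : E → ℂ} (hg : ContDiff ℝ 1 g) (a : E) (t₀ : ℝ) :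
    HasDerivAt (fun t : ℝ => ∫ x in {x : ι → ℝ | ∀ i, x i ∈ Ioc (0 : ℝ) (0 + 1)},
      g (A x + t • a))
      (∫ x in {x : ι → ℝ | ∀ i, x i ∈ Ioc (0 : ℝ) (0 + 1)}, fderiv ℝ g (A x + t₀ • a) a) t₀ := by
  have hg' : Continuous fun y : (ι → ℝ) × ℝ => fderiv ℝ g (A y.1 + y.2 • a) a := by
    have h1 : Continuous fun x => fderiv ℝ g x a :=
      (hg.continuous_fderiv one_ne_zero).clm_apply continuous_const
    exact h1.comp (by fun_prop)
  -- The closed box times a time interval is compact, which supplies a constant bound for the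
  -- derivative.
  have hK : IsCompact (Icc (0 : ι → ℝ) 1 ×ˢ Icc (t₀ - 1) (t₀ + 1)) :=
    isCompact_Icc.prod isCompact_Icc
  obtain ⟨C, hC⟩ := hK.exists_bound_of_continuousOn hg'.continuousOn
  have hfin : volume {x : ι → ℝ | ∀ i, x i ∈ Ioc (0 : ℝ) (0 + 1)} < ⊤ :=
    (measure_mono box_subset_Icc).trans_lt isCompact_Icc.measure_lt_top
  have : IsFiniteMeasure (volume.restrict {x : ι → ℝ | ∀ i, x i ∈ Ioc (0 : ℝ) (0 + 1)}) :=
    ⟨by rwa [Measure.restrict_apply_univ]⟩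
  have hgA : ∀ t : ℝ, Continuous fun x => g (A x + t • a) := fun t =>
    hg.continuous.comp (by fun_prop)
  refine (hasDerivAt_integral_of_dominated_loc_of_deriv_le (bound := fun _ => C)
    (F := fun (t : ℝ) x => g (A x + t • a)) (F' := fun (t : ℝ) x => fderiv ℝ g (A x + t • a) a)
    (Icc_mem_nhds (by linarith : t₀ - 1 < t₀) (by linarith : t₀ < t₀ + 1)) ?_ ?_ ?_ ?_ ?_ ?_).2
  · exact Eventually.of_forall fun t => (hgA t).aestronglyMeasurable
  · exact ((hgA t₀).continuousOn.integrableOn_compact isCompact_Icc).mono_set box_subset_Icc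
  · exact (hg'.comp (by fun_prop : Continuous fun x : ι → ℝ => (x, t₀))).aestronglyMeasurable
  · refine (ae_restrict_mem measurableSet_box).mono fun x hx t ht => ?_
    exact hC (x, t) ⟨box_subset_Icc hx, ht⟩
  · exact integrable_const C
  · refine Eventually.of_forall fun x t _ => ?_
    have h1 : HasDerivAt (fun t : ℝ => A x + t • a) a t := by
      simpa using ((hasDerivAt_id t).smul_const a).const_add (A x)
    exact ((hg.differentiable one_ne_zero _).hasFDerivAt).comp_hasDerivAt t h1

theorem hasDerivAt_boxMean {g : V × V → ℂ} (hg : ContDiff ℝ 1 g) (q : V) (a : V × V) (t₀ : ℝ) :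
    HasDerivAt (fun t : ℝ => boxMean b fun p => g ((p, q) + t • a))
      (boxMean b fun p => fderiv ℝ g ((p, q) + t₀ • a) a) t₀ := by
  have hA : Continuous fun x : ι → ℝ => (b.equivFun.symm x, q) :=
    (LinearMap.continuous_of_finiteDimensional b.equivFun.symm.toLinearMap).prodMk
      continuous_const
  exact hasDerivAt_integral_box hA hg a t₀

variable {Λ : AddSubgroup V} (hΛ : ∀ v, v ∈ Λ ↔ ∀ i, ∃ m : ℤ, b.repr v i = m)
include hΛ

/-- The mean over `p` of a function of `(p, q)` that is periodic in `p` and holomorphic in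
`p + τ q` does not depend on `q`. -/
theorem boxMean_eq_of_holomorphic {g : V × V → ℂ} (hg : ContDiff ℝ 1 g)
    (hp : ∀ γ ∈ Λ, ∀ p q, g (γ + p, q) = g (p, q)) {c : ℂ}
    (hol : ∀ x u, fderiv ℝ g x (0, u) = c * fderiv ℝ g x (u, 0)) (q : V) :
    (boxMean b fun p => g (p, q)) = boxMean b fun p => g (p, 0) := by
  -- The mean is unchanged by translation in `p`, so the mean of any derivative in `p` is zero.
  have h1 : ∀ q u, (boxMean b fun p => fderiv ℝ g (p, q) (u, 0)) = 0 := by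
    intro q u
    have h2 := hasDerivAt_boxMean (b := b) hg q (u, 0) 0
    simp only [zero_smul, add_zero] at h2
    refine h2.unique ?_
    have h3 : (fun t : ℝ => boxMean b fun p => g ((p, q) + t • (u, 0))) =
        fun _ => boxMean b fun p => g (p, q) := by
      funext t
      have h4 := boxMean_translate hΛ (f := fun p => g (p, q))
        (hg.continuous.comp (by fun_prop)) (fun γ hγ v => hp γ hγ v q) (t • u)
      rw [← h4]
      simp
    rw [h3]
    exact hasDerivAt_const _ _
  have h2 : ∀ t : ℝ, HasDerivAt (fun t : ℝ => boxMean b fun p => g ((p, 0) + t • (0, q))) 0 t := by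
    intro t
    have h3 := hasDerivAt_boxMean (b := b) hg 0 (0, q) t
    have h4 : (boxMean b fun p => fderiv ℝ g ((p, 0) + t • (0, q)) (0, q)) = 0 := by
      -- Holomorphy replaces the derivative in `q` by a multiple of the derivative in `p`, whose
      -- mean is zero.
      simp only [hol]
      have h5 := h1 (t • q) q
      rw [boxMean] at h5 ⊢
      rw [integral_const_mul]
      refine mul_eq_zero_of_right c (Eq.trans ?_ h5)
      simp
    rwa [h4] at h3
  have h3 := is_const_of_deriv_eq_zero (fun t => (h2 t).differentiableAt) (fun t => (h2 t).deriv)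
    1 0
  simpa using h3

end BoxMean

/-! ### Cauchy-Riemann equations in the coordinates $(p,q)$. -/

section Coefficients

variable {V : Type*} [NormedAddCommGroup V] [InnerProductSpace ℝ V] {B : LinearMap.BilinForm ℝ V}

theorem IsC1.contDiff [FiniteDimensional ℝ V] {F : V × V → ℂ} (hF : IsC1 F) : ContDiff ℝ 1 F := by
  let e := (finBasis ℝ (V × V)).equivFun
  have h1 := (hF _ e.symm.toLinearMap).comp e.toContinuousLinearEquiv.contDiff
  have h2 : F = (fun c => F (e.symm c)) ∘ e := by
    funext x
    simp
  rw [h2]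
  exact h1

/-- The vectors of type `(0, 1)`. -/
theorem zeta_jvec (τ : UpperHalfPlane) (u : V) :
    zeta τ (-(τ.re / τ.im) • u, (1 / τ.im) • u) = Complex.I • zeta τ ((u, 0) : V × V) := by
  have h1 := τ.im_pos.ne'
  -- The pair of real coefficients is the solution of $a+\tau b=i$.
  have h2 : (((-(τ.re / τ.im) : ℝ) : ℂ)) + (τ : ℂ) * ((1 / τ.im : ℝ) : ℂ) = Complex.I := by
    have h3 : (τ : ℂ) = τ.re + τ.im * Complex.I := (Complex.re_add_im (τ : ℂ)).symm
    have h4 : ((τ.im : ℝ) : ℂ) ≠ 0 := by exact_mod_cast h1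
    rw [h3]
    push_cast
    field_simp
    ring
  rw [zeta, zeta, TensorProduct.tmul_zero, add_zero, ← TensorProduct.smul_tmul,
    ← TensorProduct.smul_tmul, ← TensorProduct.add_tmul, TensorProduct.smul_tmul', ← h2]
  congr 1
  simp [mul_comm]

/-- The Cauchy-Riemann equations in the trivialisation by `s^k`. -/
theorem fderiv_eq_of_isHolomorphicSection (hs : ∀ x y, B x y = B y x) {τ : UpperHalfPlane} {k : ℕ}
    {H : V × V → ℂ} (hH : ContDiff ℝ 1 H)
    (hol : IsHolomorphicSection B τ k fun x => H x * refSection B τ x ^ k) (x : V × V) (u : V) :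
    fderiv ℝ H x (0, u) = (τ : ℂ) * fderiv ℝ H x (u, 0) := by
  have h1 := (hH.differentiable one_ne_zero x).hasFDerivAt
  have h2 := (covDeriv_mul_refSection_eq_zero_iff hs τ k (h1.hasLineDerivAt (u, 0))
    (h1.hasLineDerivAt (-(τ.re / τ.im) • u, (1 / τ.im) • u)) (zeta_jvec τ u)).mp
    (hol.2 x _ _ (zeta_jvec τ u))
  have h3 : ((-(τ.re / τ.im) • u, (1 / τ.im) • u) : V × V) =
      (-(τ.re / τ.im)) • ((u, 0) : V × V) + (1 / τ.im) • ((0, u) : V × V) := by simp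
  rw [h3, map_add, map_smul, map_smul, Complex.real_smul, Complex.real_smul] at h2
  have h5 : (τ : ℂ) = τ.re + τ.im * Complex.I := (Complex.re_add_im (τ : ℂ)).symm
  have h4 : ((τ.im : ℝ) : ℂ) ≠ 0 := by exact_mod_cast τ.im_pos.ne'
  rw [h5]
  push_cast at h2
  field_simp at h2
  linear_combination (-Complex.I) * h2 + (fderiv ℝ H x (0, u) - (τ.re : ℂ) * fderiv ℝ H x (u, 0)) *
    Complex.I_sq

end Coefficients
end ThetaAlt

namespace ThetaAlt

open Module

/-! ### Lattice bases and dual lattices. -/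

section Lattices

variable {V : Type*} [NormedAddCommGroup V] [InnerProductSpace ℝ V] [FiniteDimensional ℝ V]
variable {B : LinearMap.BilinForm ℝ V}

theorem exists_basis_of_isZLattice (Λ : AddSubgroup V)
    [DiscreteTopology (AddSubgroup.toIntSubmodule Λ)]
    [IsZLattice ℝ (AddSubgroup.toIntSubmodule Λ)] :
    ∃ b : Basis (Fin (finrank ℝ V)) ℝ V, ∀ v, v ∈ Λ ↔ ∀ i, ∃ m : ℤ, b.repr v i = m := by
  have h1 := ZLattice.module_finite ℝ (AddSubgroup.toIntSubmodule Λ)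
  have h2 := ZLattice.module_free ℝ (AddSubgroup.toIntSubmodule Λ)
  let c := Free.chooseBasis ℤ (AddSubgroup.toIntSubmodule Λ)
  let b := c.ofZLatticeBasis ℝ (AddSubgroup.toIntSubmodule Λ)
  have h3 : ∀ v, v ∈ Λ ↔ ∀ i, ∃ m : ℤ, b.repr v i = m := by
    intro v
    have h4 : v ∈ Λ ↔ v ∈ Submodule.span ℤ (Set.range b) := by
      rw [c.ofZLatticeBasis_span ℝ]
      rfl
    rw [h4, b.mem_span_iff_repr_mem ℤ]
    exact forall_congr' fun i => exists_congr fun m => eq_comm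
  refine ⟨b.reindex (Fintype.equivFinOfCardEq (finrank_eq_card_basis b).symm), fun v => ?_⟩
  rw [h3]
  simp only [Basis.repr_reindex_apply]
  exact (Equiv.forall_congr_right
    (Fintype.equivFinOfCardEq (finrank_eq_card_basis b).symm).symm).symm

variable {ι : Type*} [Fintype ι] {b : Basis ι ℝ V} {Λ : AddSubgroup V}

-- Subtracting the integer parts of the coordinates leaves a point of the fundamental box.
omit [InnerProductSpace ℝ V] [FiniteDimensional ℝ V] in
theorem exists_norm_add_le [NormedSpace ℝ V] {b : Basis ι ℝ V}
    (hΛ : ∀ v, v ∈ Λ ↔ ∀ i, ∃ m : ℤ, b.repr v i = m) (v : V) :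
    ∃ γ ∈ Λ, ‖v + γ‖ ≤ ∑ i, ‖b i‖ := by
  refine ⟨∑ i, (-⌊b.repr v i⌋ : ℝ) • b i, ?_, ?_⟩
  · rw [hΛ]
    intro i
    refine ⟨-⌊b.repr v i⌋, ?_⟩
    rw [Basis.repr_sum_self]
    push_cast
    rfl
  · have h1 : v + ∑ i, (-⌊b.repr v i⌋ : ℝ) • b i = ∑ i, Int.fract (b.repr v i) • b i := by
      conv_lhs => rw [← b.sum_repr v]
      rw [← Finset.sum_add_distrib]
      refine Finset.sum_congr rfl fun i _ => ?_
      rw [b.sum_repr, ← add_smul]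
      rfl
    rw [h1]
    refine (norm_sum_le _ _).trans (Finset.sum_le_sum fun i _ => ?_)
    rw [norm_smul, Real.norm_of_nonneg (Int.fract_nonneg _)]
    exact mul_le_of_le_one_left (norm_nonneg _) (Int.fract_lt_one _).le

omit [FiniteDimensional ℝ V] in
theorem mem_dualLattice_iff (hΛ : ∀ v, v ∈ Λ ↔ ∀ i, ∃ m : ℤ, b.repr v i = m) (k : ℕ) (μ : V) :
    μ ∈ dualLattice B Λ k ↔ ∀ i, ∃ m : ℤ, B ((k : ℝ) • μ) (b i) = m := by
  constructor
  · intro h i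
    refine h (b i) ((hΛ _).mpr fun j => ?_)
    rw [b.repr_self]
    by_cases hij : i = j
    · exact ⟨1, by simp [hij]⟩
    · exact ⟨0, by simp [hij]⟩
  · intro h γ hγ
    choose m hm using h
    choose n hn using (hΛ γ).mp hγ
    refine ⟨∑ i, n i * m i, ?_⟩
    rw [← b.sum_repr γ, map_sum]
    push_cast
    refine Finset.sum_congr rfl fun i _ => ?_
    rw [map_smul, hm, hn, smul_eq_mul]

omit [FiniteDimensional ℝ V] in
/-- The coordinates on `k⁻¹ Λ*` given by a basis of `Λ`. -/
theorem exists_dual_coordinates (hB : ∀ x y, B x y = inner ℝ x y) {k : ℕ} (hk : 0 < k)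
    (b : Basis ι ℝ V) : ∃ L : V ≃ₗ[ℝ] (ι → ℝ), ∀ μ i, L μ i = -(k * B (b i) μ) := by
  let f : V →ₗ[ℝ] (ι → ℝ) := LinearMap.pi fun i => -((k : ℝ) • B (b i))
  have hf : Function.Injective f := by
    rw [injective_iff_map_eq_zero]
    intro μ hμ
    have h1 : ∀ v, B v μ = 0 := by
      intro v
      have h2 : B.flip μ = 0 := by
        refine b.ext fun i => ?_
        have h3 := congrFun hμ i
        have hk' : (k : ℝ) ≠ 0 := by exact_mod_cast hk.ne'
        simpa [f, hk'] using h3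
      exact LinearMap.congr_fun h2 v
    have h4 := h1 μ
    rwa [hB, inner_self_eq_zero] at h4
  refine ⟨LinearEquiv.ofInjectiveOfFinrankEq f hf (by
    rw [finrank_fintype_fun_eq_card, finrank_eq_card_basis b]), fun μ i => ?_⟩
  rfl

-- The lattice $k^{-1}\Lambda^*$ is the integral span of the basis whose coordinates are
-- $-kB(b_i,\cdot)$.
omit [FiniteDimensional ℝ V] in
theorem discreteTopology_dualLattice (hB : ∀ x y, B x y = inner ℝ x y)
    (hΛ : ∀ v, v ∈ Λ ↔ ∀ i, ∃ m : ℤ, b.repr v i = m) {k : ℕ} (hk : 0 < k) :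
    DiscreteTopology (dualLattice B Λ k) := by
  obtain ⟨L, hL⟩ := exists_dual_coordinates hB hk b
  let b' := Basis.ofEquivFun L
  have h1 : dualLattice B Λ k = (Submodule.span ℤ (Set.range b')).toAddSubgroup := by
    ext μ
    rw [mem_dualLattice_iff hΛ, Submodule.mem_toAddSubgroup, b'.mem_span_iff_repr_mem ℤ]
    refine forall_congr' fun i => ?_
    have h2 : b'.repr μ i = -(B ((k : ℝ) • μ) (b i)) := by
      rw [Basis.ofEquivFun_repr_apply, hL, form_symm hB, map_smul, LinearMap.smul_apply,
        smul_eq_mul]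
    rw [h2]
    constructor
    · rintro ⟨m, hm⟩
      exact ⟨-m, by rw [hm]; simp⟩
    · rintro ⟨m, hm⟩
      exact ⟨-m, by rw [eq_comm, neg_eq_iff_eq_neg] at hm; rw [hm]; simp⟩
  rw [h1]
  exact inferInstanceAs (DiscreteTopology (Submodule.span ℤ (Set.range b')))

omit [FiniteDimensional ℝ V] in
theorem exists_dualLattice_equiv (hB : ∀ x y, B x y = inner ℝ x y)
    (hΛ : ∀ v, v ∈ Λ ↔ ∀ i, ∃ m : ℤ, b.repr v i = m) {k : ℕ} (hk : 0 < k) :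
    ∃ σ : dualLattice B Λ k ≃ (ι → ℤ),
      ∀ μ i, ((σ μ i : ℤ) : ℝ) = -(k * B (b i) (μ : V)) := by
  obtain ⟨L, hL⟩ := exists_dual_coordinates hB hk b
  have h0 : ∀ μ : dualLattice B Λ k, ∃ n : ι → ℤ, ∀ i, (n i : ℝ) = L μ i := by
    intro μ
    choose m hm using (mem_dualLattice_iff hΛ k (μ : V)).mp μ.2
    refine ⟨fun i => -m i, fun i => ?_⟩
    rw [hL, Int.cast_neg, ← hm, form_symm hB, map_smul, smul_eq_mul]
  choose n hn using h0
  refine ⟨Equiv.ofBijective n ⟨fun μ ν h => ?_, fun m => ?_⟩, fun μ i => (hn μ i).trans (hL _ i)⟩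
  · refine Subtype.ext (L.injective (funext fun i => ?_))
    rw [← hn, ← hn, h]
  · have h1 : L.symm (fun i => (m i : ℝ)) ∈ dualLattice B Λ k := by
      rw [mem_dualLattice_iff hΛ]
      intro i
      refine ⟨-m i, ?_⟩
      have h2 := hL (L.symm fun i => (m i : ℝ)) i
      rw [L.apply_symm_apply] at h2
      rw [form_symm hB, map_smul, smul_eq_mul]
      push_cast
      linarith
    refine ⟨⟨_, h1⟩, funext fun i => ?_⟩
    have h3 := hn ⟨_, h1⟩ i
    rw [L.apply_symm_apply] at h3
    exact_mod_cast h3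

end Lattices

/-! ### Every holomorphic section is a theta series. -/

section Expansion

variable {V : Type*} [NormedAddCommGroup V] [InnerProductSpace ℝ V] [FiniteDimensional ℝ V]
variable {B : LinearMap.BilinForm ℝ V}
variable {ι : Type*} [Fintype ι] {b : Basis ι ℝ V} {Λ : AddSubgroup V}

/-- Translation by $\Lambda$ brings every point of `P` into a fixed ball, which meets the discrete
group `P` in finitely many points. -/
theorem exists_bound_of_periodic (hΛ : ∀ v, v ∈ Λ ↔ ∀ i, ∃ m : ℤ, b.repr v i = m)
    {P : AddSubgroup V} [DiscreteTopology P] (hΛP : Λ ≤ P) {d : V → ℂ}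
    (hd : ∀ μ ∈ P, ∀ γ ∈ Λ, d (μ + γ) = d μ) : ∃ C : ℝ, ∀ μ ∈ P, ‖d μ‖ ≤ C := by
  obtain ⟨C, hC⟩ := ((finite_inter_ball P (∑ i, ‖b i‖)).image fun μ => ‖d μ‖).bddAbove
  refine ⟨C, fun μ hμ => ?_⟩
  obtain ⟨γ, hγ, h1⟩ := exists_norm_add_le hΛ μ
  rw [← hd μ hμ γ hγ]
  exact hC ⟨μ + γ, ⟨P.add_mem hμ (hΛP hγ), h1⟩, rfl⟩

omit [FiniteDimensional ℝ V] in
theorem exp_dualLattice_periodic (hs : ∀ x y, B x y = B y x) {k : ℕ} {μ : V}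
    (hμ : μ ∈ dualLattice B Λ k) {γ : V} (hγ : γ ∈ Λ) (v : V) :
    Complex.exp (2 * Complex.I * Real.pi * k * B (γ + v) μ) =
      Complex.exp (2 * Complex.I * Real.pi * k * B v μ) := by
  obtain ⟨m, hm⟩ := hμ γ hγ
  rw [map_smul, LinearMap.smul_apply, smul_eq_mul, hs] at hm
  refine Complex.exp_eq_exp_iff_exists_int.mpr ⟨m, ?_⟩
  have h1 := congrArg (fun r : ℝ => (r : ℂ)) hm
  push_cast at h1
  rw [map_add, LinearMap.add_apply]
  push_cast
  linear_combination (2 * Complex.I * (Real.pi : ℂ)) * h1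

/-- The Fourier coefficients in `p`, at fixed `q`. -/
noncomputable def fiberCoeff (b : Basis ι ℝ V) (B : LinearMap.BilinForm ℝ V) (k : ℕ)
    (H : V × V → ℂ) (μ q : V) : ℂ :=
  boxMean b fun p => H (p, q) * Complex.exp (2 * Complex.I * Real.pi * k * B p μ)

omit [FiniteDimensional ℝ V] in
theorem boxMean_mul_const (f : V → ℂ) (c : ℂ) :
    (boxMean b fun p => f p * c) = boxMean b f * c := by
  rw [boxMean, boxMean, MeasureTheory.integral_mul_const]

/-- The product of $H$ with $\exp(2\pi ikB(\zeta,\mu))$ is still holomorphic in $\zeta$ and periodic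
in $p$, so its mean over $p$ does not depend on $q$. -/
theorem fiberCoeff_eq (hs : ∀ x y, B x y = B y x)
    (hΛ : ∀ v, v ∈ Λ ↔ ∀ i, ∃ m : ℤ, b.repr v i = m) {k : ℕ} {τ : UpperHalfPlane} {H : V × V → ℂ}
    (hH : ContDiff ℝ 1 H) (hp : ∀ γ ∈ Λ, ∀ p q, H (γ + p, q) = H (p, q))
    (hol : ∀ x u, fderiv ℝ H x (0, u) = (τ : ℂ) * fderiv ℝ H x (u, 0)) {μ : V}
    (hμ : μ ∈ dualLattice B Λ k) (q : V) :
    fiberCoeff b B k H μ q =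
      fiberCoeff b B k H μ 0 * Complex.exp (-(2 * Complex.I * Real.pi * k * τ * B q μ)) := by
  let ℓ : V × V →L[ℝ] ℂ := thetaExponentL B τ k LinearMap.id μ
  have hℓ : ∀ x, -ℓ x = 2 * Complex.I * Real.pi * k * B x.1 μ +
      2 * Complex.I * Real.pi * k * τ * B x.2 μ := by
    intro x
    rw [thetaExponentL_apply, zetaForm, LinearMap.id_apply]
    ring
  have hexp : ContDiff ℝ 1 fun x => Complex.exp (-ℓ x) := ℓ.contDiff.neg.cexp
  have hg : ContDiff ℝ 1 fun x => H x * Complex.exp (-ℓ x) := hH.mul hexp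
  have h1 := boxMean_eq_of_holomorphic hΛ hg (c := τ) ?_ ?_ q
  · have h2 : ∀ q, (boxMean b fun p => H (p, q) * Complex.exp (-ℓ (p, q))) =
        fiberCoeff b B k H μ q * Complex.exp (2 * Complex.I * Real.pi * k * τ * B q μ) := by
      intro q
      rw [fiberCoeff, ← boxMean_mul_const]
      congr 1
      funext p
      rw [hℓ, Complex.exp_add, ← mul_assoc]
    rw [h2, h2] at h1
    rw [Complex.exp_neg, ← div_eq_mul_inv, eq_div_iff (Complex.exp_ne_zero _), h1]
    simp
  · intro γ hγ p q
    simp only [hp γ hγ, hℓ, Complex.exp_add, exp_dualLattice_periodic hs hμ hγ]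
  · intro x u
    have h3 : HasFDerivAt (fun x => H x * Complex.exp (-ℓ x)) _ x :=
      ((hH.differentiable one_ne_zero x).hasFDerivAt).mul (ℓ.hasFDerivAt.neg.cexp)
    rw [h3.fderiv]
    have h4 : ℓ (0, u) = τ * ℓ (u, 0) := by
      rw [← neg_inj, hℓ, ← mul_neg, hℓ]
      simp
      ring
    simp only [add_apply, smul_apply, smul_eq_mul,
      neg_apply, h4, hol]
    ring

/-- The coefficient of index $\mu+\gamma$ at $q=\gamma$ is computed twice: from its value at $q=0$
by `fiberCoeff_eq`, and by translating by $(0,\gamma)$, whose factor of automorphy lowers the index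
to $\mu$. -/
theorem fiberCoeff_add (hs : ∀ x y, B x y = B y x)
    (hΛ : ∀ v, v ∈ Λ ↔ ∀ i, ∃ m : ℤ, b.repr v i = m) {k : ℕ} {τ : UpperHalfPlane} {H : V × V → ℂ}
    (hH : ContDiff ℝ 1 H) (hq : ∀ γ : V × V, γ.1 ∈ Λ → γ.2 ∈ Λ → ∀ x, H (γ + x) = H x *
        Complex.exp (-2 * Complex.I * (Real.pi : ℂ) * (k : ℂ) *
          (zetaForm B τ x γ.2 + (τ : ℂ) / 2 * ((B γ.2 γ.2 : ℝ) : ℂ))))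
    (hp : ∀ γ ∈ Λ, ∀ p q, H (γ + p, q) = H (p, q))
    (hol : ∀ x u, fderiv ℝ H x (0, u) = (τ : ℂ) * fderiv ℝ H x (u, 0))
    (hΛP : Λ ≤ dualLattice B Λ k) {μ : V}
    (hμ : μ ∈ dualLattice B Λ k) {γ : V} (hγ : γ ∈ Λ) :
    fiberCoeff b B k H (μ + γ) 0 = fiberCoeff b B k H μ 0 *
      Complex.exp (Complex.I * Real.pi * k * τ * (2 * B γ μ + B γ γ)) := by
  have h1 := fiberCoeff_eq hs hΛ hH hp hol (AddSubgroup.add_mem _ hμ (hΛP hγ)) γ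
  have h2 : fiberCoeff b B k H (μ + γ) γ = fiberCoeff b B k H μ 0 *
      Complex.exp (-(Complex.I * Real.pi * k * τ * B γ γ)) := by
    rw [fiberCoeff, fiberCoeff, ← boxMean_mul_const]
    congr 1
    funext p
    have h3 := hq (0, γ) Λ.zero_mem hγ (p, 0)
    rw [Prod.mk_add_mk, zero_add, add_zero] at h3
    rw [h3, mul_assoc (H (p, 0)), mul_assoc (H (p, 0)), ← Complex.exp_add, ← Complex.exp_add]
    congr 2
    simp only [zetaForm, map_zero, LinearMap.zero_apply, map_add]
    push_cast
    ring
  rw [h2] at h1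
  rw [Complex.exp_neg (2 * Complex.I * Real.pi * k * τ * B γ (μ + γ)), ← div_eq_mul_inv,
    eq_div_iff (Complex.exp_ne_zero _)] at h1
  rw [← h1, mul_assoc, ← Complex.exp_add]
  congr 2
  rw [map_add]
  push_cast
  ring

/-- Every holomorphic section is a theta series with periodic coefficients. -/
theorem exists_thetaSum_eq (hB : ∀ x y, B x y = inner ℝ x y)
    (hΛ : ∀ v, v ∈ Λ ↔ ∀ i, ∃ m : ℤ, b.repr v i = m) {k : ℕ} (hk : 0 < k)
    (hΛP : Λ ≤ dualLattice B Λ k) {τ : UpperHalfPlane} {F : V × V → ℂ}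
    (hF : F ∈ holSections B Λ τ k) :
    ∃ d : V → ℂ, (∀ μ ∈ dualLattice B Λ k, ∀ γ ∈ Λ, d (μ + γ) = d μ) ∧
      F = fun x => thetaSum B (dualLattice B Λ k) τ k d x * refSection B τ x ^ k := by
  have hs := form_symm hB
  have := discreteTopology_dualLattice hB hΛ hk
  obtain ⟨σ, hσ⟩ := exists_dualLattice_equiv hB hΛ hk
  let H : V × V → ℂ := fun x => F x * (refSection B τ x ^ k)⁻¹
  have hFH : F = fun x => H x * refSection B τ x ^ k := by
    funext x
    rw [inv_mul_cancel_right₀ (refSection_pow_ne_zero τ k x)]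
  have hH : ContDiff ℝ 1 H := by
    refine (IsC1.contDiff hF.2.1).mul ((isC1_refSection_pow hB τ k).contDiff.inv fun x => ?_)
    exact refSection_pow_ne_zero τ k x
  clear_value H
  rw [hFH] at hF
  have hol := fderiv_eq_of_isHolomorphicSection hs hH hF.2
  have hq := (isLatticeInvariant_mul_refSection_iff hs Λ τ k H).mp hF.1
  have hp : ∀ γ ∈ Λ, ∀ p q, H (γ + p, q) = H (p, q) := by
    intro γ hγ p q
    have h1 := hq (γ, 0) hγ Λ.zero_mem (p, q)
    rw [Prod.mk_add_mk, zero_add] at h1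
    rw [h1]
    simp [zetaForm]
  -- The Gaussian factor $\exp(i\pi k\tau B(\mu,\mu))$ of the theta term is divided out; by
  -- `fiberCoeff_add` this makes the coefficients periodic.
  let d : V → ℂ := fun μ => fiberCoeff b B k H μ 0 *
    Complex.exp (-(Complex.I * Real.pi * k * τ * B μ μ))
  have hd : ∀ μ ∈ dualLattice B Λ k, ∀ γ ∈ Λ, d (μ + γ) = d μ := by
    intro μ hμ γ hγ
    simp only [d]
    rw [fiberCoeff_add hs hΛ hH hq hp hol hΛP hμ hγ, mul_assoc, ← Complex.exp_add]
    congr 2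
    simp only [map_add, LinearMap.add_apply]
    rw [hs μ γ]
    push_cast
    ring
  obtain ⟨C, hC⟩ := exists_bound_of_periodic hΛ hΛP hd
  have hterm : ∀ (p q : V) (μ : dualLattice B Λ k), d μ * thetaTerm B τ k μ (p, q) =
      fiberCoeff b B k H μ q * Complex.exp (-(2 * Complex.I * Real.pi * k * B p μ)) := by
    intro p q μ
    rw [fiberCoeff_eq hs hΛ hH hp hol μ.2]
    simp only [d, thetaTerm, zetaForm]
    rw [mul_assoc (fiberCoeff b B k H μ 0), mul_assoc (fiberCoeff b B k H μ 0),
      ← Complex.exp_add, ← Complex.exp_add]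
    congr 2
    ring
  refine ⟨d, hd, ?_⟩
  rw [hFH]
  funext x
  congr 1
  obtain ⟨p, q⟩ := x
  have hsum : ∀ p, Summable fun μ : dualLattice B Λ k => d μ * thetaTerm B τ k μ (p, q) := by
    intro p
    simpa only [zero_add] using summable_mul_thetaTerm hB (dualLattice B Λ k) τ hk 0 (d := d)
      (C := C) (fun γ => by rw [zero_add]; exact hC γ γ.2) (p, q)
  -- At $p=0$ the characters equal $1$, so the convergent theta series yields summability of the
  -- Fourier coefficients.
  have h1 := hsum 0
  simp only [hterm, map_zero, LinearMap.zero_apply, Complex.ofReal_zero, mul_zero, neg_zero,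
    Complex.exp_zero, mul_one] at h1
  have h2 := hasSum_fourier hΛ hσ (f := fun p => H (p, q)) (hH.continuous.comp (by fun_prop))
    (fun γ hγ v => hp γ hγ v q) h1 p
  rw [thetaSum, ← h2.tsum_eq]
  exact tsum_congr fun μ => (hterm p q μ).symm

/-- At $q=0$ the theta series is an absolutely convergent Fourier series whose coefficients are
$d(\mu)$ times nonzero Gaussians. -/
theorem eq_zero_of_thetaSum_eq_zero (hB : ∀ x y, B x y = inner ℝ x y)
    (hΛ : ∀ v, v ∈ Λ ↔ ∀ i, ∃ m : ℤ, b.repr v i = m) {k : ℕ} (hk : 0 < k)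
    (hΛP : Λ ≤ dualLattice B Λ k) {τ : UpperHalfPlane} {d : V → ℂ}
    (hd : ∀ μ ∈ dualLattice B Λ k, ∀ γ ∈ Λ, d (μ + γ) = d μ)
    (h0 : ∀ x, thetaSum B (dualLattice B Λ k) τ k d x = 0) :
    ∀ μ ∈ dualLattice B Λ k, d μ = 0 := by
  have := discreteTopology_dualLattice hB hΛ hk
  obtain ⟨σ, hσ⟩ := exists_dualLattice_equiv hB hΛ hk
  obtain ⟨C, hC⟩ := exists_bound_of_periodic hΛ hΛP hd
  have hsum : ∀ x, Summable fun μ : dualLattice B Λ k => d μ * thetaTerm B τ k μ x := by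
    intro x
    simpa only [zero_add] using summable_mul_thetaTerm hB (dualLattice B Λ k) τ hk 0 (d := d)
      (C := C) (fun γ => by rw [zero_add]; exact hC γ γ.2) x
  have h1 := eq_zero_of_hasSum_fourier hσ (hsum 0) fun v => by
    have h2 := (hsum (v, 0)).hasSum
    change HasSum _ (thetaSum B (dualLattice B Λ k) τ k d (v, 0)) at h2
    rw [h0] at h2
    refine h2.congr_fun fun μ => ?_
    rw [mul_assoc, thetaTerm_eq _ _ _ (v, 0)]
    congr 3
    change _ = -2 * Complex.I * (Real.pi : ℂ) * (k : ℂ) * zetaForm B τ (v, 0) (μ : V)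
    rw [zetaForm, map_zero, LinearMap.zero_apply, Complex.ofReal_zero]
    ring
  intro μ hμ
  exact (mul_eq_zero.mp (h1 ⟨μ, hμ⟩)).resolve_right (Complex.exp_ne_zero _)

end Expansion
end ThetaAlt

namespace ThetaAlt

open Module

/-! ### Alternating theta series and the basis. -/

namespace IsRootData

variable {V : Type*} [NormedAddCommGroup V] [InnerProductSpace ℝ V] [FiniteDimensional ℝ V]
variable {B : LinearMap.BilinForm ℝ V} {Φ Φp : Set (Dual ℝ V)} {α₀ : Dual ℝ V}
variable (h : IsRootData B Φ) {k : ℕ} {τ : UpperHalfPlane}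
include h

theorem altSign_symm {w : V ≃ₗ[ℝ] V} (hw : w ∈ weylGroup B Φ) :
    altSign w.symm = altSign w := by
  have h1 : altSign w.symm * altSign w = 1 := by
    rw [← altSign_mul, ← altSign_one (V := V)]
    exact congrArg altSign (inv_mul_cancel w)
  have h2 := h.altSign_mul_self hw
  have h3 : altSign w ≠ 0 := by
    intro h0
    rw [h0, mul_zero] at h2
    exact zero_ne_one h2
  exact mul_right_cancel₀ h3 (h1.trans h2.symm)

theorem form_symm_weyl {w : V ≃ₗ[ℝ] V} (hw : w ∈ weylGroup B Φ) (x y : V) :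
    B (w.symm x) y = B x (w y) := by
  rw [← h.form_weyl hw, w.apply_symm_apply]

theorem lattice_le_dualLattice (k : ℕ) : corootLattice B Φ ≤ dualLattice B (corootLattice B Φ) k := by
  intro γ hγ γ' hγ'
  obtain ⟨m, hm⟩ := h.form_lattice hγ hγ'
  refine ⟨k * m, ?_⟩
  rw [map_smul, LinearMap.smul_apply, hm, smul_eq_mul]
  push_cast
  rfl

theorem weyl_mem_dualLattice {w : V ≃ₗ[ℝ] V} (hw : w ∈ weylGroup B Φ) {μ : V}
    (hμ : μ ∈ dualLattice B (corootLattice B Φ) k) :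
    w μ ∈ dualLattice B (corootLattice B Φ) k := by
  intro γ hγ
  obtain ⟨m, hm⟩ := hμ _ (h.weyl_mem_lattice (inv_mem hw) hγ)
  refine ⟨m, ?_⟩
  rw [← hm, ← map_smul, form_symm h.form_eq, form_symm h.form_eq _ (w⁻¹ γ)]
  exact (h.form_symm_weyl hw _ _).symm

theorem exists_lattice_basis : ∃ b : Basis (Fin (finrank ℝ V)) ℝ V,
    ∀ v, v ∈ corootLattice B Φ ↔ ∀ i, ∃ m : ℤ, b.repr v i = m := by
  have := h.discreteTopology_lattice
  have := h.isZLattice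
  exact exists_basis_of_isZLattice _

theorem discreteTopology_dual (hk : 0 < k) :
    DiscreteTopology (dualLattice B (corootLattice B Φ) k) := by
  obtain ⟨b, hb⟩ := h.exists_lattice_basis
  exact discreteTopology_dualLattice h.form_eq hb hk

theorem summable_thetaSum (hk : 0 < k) {d : V → ℂ}
    (hd : ∀ μ ∈ dualLattice B (corootLattice B Φ) k, ∀ γ ∈ corootLattice B Φ, d (μ + γ) = d μ)
    (x : V × V) :
    Summable fun μ : dualLattice B (corootLattice B Φ) k => d μ * thetaTerm B τ k μ x := by
  have := h.discreteTopology_dual hk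
  obtain ⟨b, hb⟩ := h.exists_lattice_basis
  obtain ⟨C, hC⟩ := exists_bound_of_periodic hb (h.lattice_le_dualLattice k) hd
  simpa only [zero_add] using summable_mul_thetaTerm h.form_eq
    (dualLattice B (corootLattice B Φ) k) τ hk 0 (d := d)
    (C := C) (fun γ => by rw [zero_add]; exact hC γ γ.2) x

theorem thetaSum_mem_holSections (hk : 0 < k) {d : V → ℂ}
    (hd : ∀ μ ∈ dualLattice B (corootLattice B Φ) k, ∀ γ ∈ corootLattice B Φ, d (μ + γ) = d μ) :
    (fun x => thetaSum B (dualLattice B (corootLattice B Φ) k) τ k d x * refSection B τ x ^ k) ∈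
      holSections B (corootLattice B Φ) τ k := by
  have := h.discreteTopology_dual hk
  obtain ⟨b, hb⟩ := h.exists_lattice_basis
  obtain ⟨C, hC⟩ := exists_bound_of_periodic hb (h.lattice_le_dualLattice k) hd
  exact thetaSum_mul_mem_holSections h.form_eq _ τ hk (h.lattice_le_dualLattice k) hd hC

theorem eq_of_thetaSum_eq (hk : 0 < k) {d d' : V → ℂ}
    (hd : ∀ μ ∈ dualLattice B (corootLattice B Φ) k, ∀ γ ∈ corootLattice B Φ, d (μ + γ) = d μ)
    (hd' : ∀ μ ∈ dualLattice B (corootLattice B Φ) k, ∀ γ ∈ corootLattice B Φ, d' (μ + γ) = d' μ)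
    (hdd' : ∀ x, thetaSum B (dualLattice B (corootLattice B Φ) k) τ k d x =
      thetaSum B (dualLattice B (corootLattice B Φ) k) τ k d' x) :
    ∀ μ ∈ dualLattice B (corootLattice B Φ) k, d μ = d' μ := by
  obtain ⟨b, hb⟩ := h.exists_lattice_basis
  intro μ hμ
  refine sub_eq_zero.mp (eq_zero_of_thetaSum_eq_zero (τ := τ) (d := fun μ => d μ - d' μ) h.form_eq hb
    hk (h.lattice_le_dualLattice k) (fun μ hμ γ hγ => by rw [hd μ hμ γ hγ, hd' μ hμ γ hγ])
    (fun x => ?_) μ hμ)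
  have h1 := hdd' x
  rw [← sub_eq_zero, thetaSum, thetaSum,
    ← (h.summable_thetaSum hk hd x).tsum_sub (h.summable_thetaSum hk hd' x)] at h1
  rw [thetaSum, ← h1]
  exact tsum_congr fun μ => sub_mul _ _ _

/-! #### The action of the Weyl group -/

/-- Since `w` is an isometry preserving $k^{-1}\Lambda^*$, it fixes $s$ and merely reindexes the
series. -/
theorem weylAct_thetaSum {w : V ≃ₗ[ℝ] V} (hw : w ∈ weylGroup B Φ) (d : V → ℂ) :
    weylAct w (fun x => thetaSum B (dualLattice B (corootLattice B Φ) k) τ k d x *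
        refSection B τ x ^ k) =
      fun x => thetaSum B (dualLattice B (corootLattice B Φ) k) τ k (fun μ => d (w.symm μ)) x *
        refSection B τ x ^ k := by
  have hz : ∀ (x : V × V) v, zetaForm B τ (w.symm x.1, w.symm x.2) v = zetaForm B τ x (w v) := by
    intro x v
    rw [zetaForm, zetaForm, h.form_symm_weyl hw, h.form_symm_weyl hw]
  funext x
  simp only [weylAct]
  congr 1
  · let e : dualLattice B (corootLattice B Φ) k ≃ dualLattice B (corootLattice B Φ) k :=
      { toFun := fun μ => ⟨w μ, h.weyl_mem_dualLattice hw μ.2⟩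
        invFun := fun μ => ⟨w.symm μ, h.weyl_mem_dualLattice (inv_mem hw) μ.2⟩
        left_inv := fun μ => Subtype.ext (w.symm_apply_apply _)
        right_inv := fun μ => Subtype.ext (w.apply_symm_apply _) }
    rw [thetaSum, thetaSum, ← e.tsum_eq fun μ => d (w.symm μ) * thetaTerm B τ k μ x]
    refine tsum_congr fun μ => ?_
    change _ = d (w.symm (w μ)) * thetaTerm B τ k (w μ) x
    rw [w.symm_apply_apply, thetaTerm, thetaTerm, hz, h.form_weyl hw]
  · rw [refSection, refSection, hz, w.apply_symm_apply]

/-- A theta series is alternating if and only if its coefficients are. -/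
theorem thetaSum_mem_alternating_iff (hk : 0 < k) {d : V → ℂ}
    (hd : ∀ μ ∈ dualLattice B (corootLattice B Φ) k, ∀ γ ∈ corootLattice B Φ, d (μ + γ) = d μ) :
    (fun x => thetaSum B (dualLattice B (corootLattice B Φ) k) τ k d x * refSection B τ x ^ k) ∈
      alternating (weylGroup B Φ) ↔
    ∀ w ∈ weylGroup B Φ, ∀ μ ∈ dualLattice B (corootLattice B Φ) k,
      d (w μ) = altSign w * d μ := by
  have hsm : ∀ c : ℂ, c • (fun x => thetaSum B (dualLattice B (corootLattice B Φ) k) τ k d x *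
      refSection B τ x ^ k) =
      fun x => thetaSum B (dualLattice B (corootLattice B Φ) k) τ k (fun μ => c * d μ) x *
        refSection B τ x ^ k := by
    intro c
    funext x
    simp only [Pi.smul_apply, smul_eq_mul, thetaSum, ← mul_assoc, ← tsum_mul_left]
  constructor
  · intro hF w hw
    have h1 := hF w⁻¹ (inv_mem hw)
    rw [h.weylAct_thetaSum (inv_mem hw), hsm] at h1
    refine h.eq_of_thetaSum_eq hk (τ := τ) ?_ ?_ fun x => ?_
    · intro μ hμ γ hγ
      rw [map_add, hd _ (h.weyl_mem_dualLattice hw hμ) _ (h.weyl_mem_lattice hw hγ)]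
    · intro μ hμ γ hγ
      rw [hd μ hμ γ hγ]
    · have h2 := mul_right_cancel₀ (refSection_pow_ne_zero τ k x) (congrFun h1 x)
      have h3 : altSign w⁻¹ = altSign w := h.altSign_symm hw
      rw [h3] at h2
      exact h2
  · intro hF w hw
    rw [h.weylAct_thetaSum hw, hsm]
    funext x
    congr 1
    refine tsum_congr fun μ => ?_
    have h1 : d (w.symm μ) = altSign w.symm * d μ := hF w⁻¹ (inv_mem hw) μ μ.2
    simp only [h1, h.altSign_symm hw]

/-- Alternating coefficients vanish on the walls. -/
theorem alternating_eq_zero {d : V → ℂ}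
    (hd : ∀ μ ∈ dualLattice B (corootLattice B Φ) k, ∀ γ ∈ corootLattice B Φ, d (μ + γ) = d μ)
    (halt : ∀ w ∈ weylGroup B Φ, ∀ μ ∈ dualLattice B (corootLattice B Φ) k,
      d (w μ) = altSign w * d μ) {μ : V} (hμ : μ ∈ dualLattice B (corootLattice B Φ) k)
    {α : Dual ℝ V} (hα : α ∈ Φ) {m : ℤ} (hm : α μ = m) : d μ = 0 := by
  -- Here $s_\alpha\mu=\mu-m\alpha^\vee$ lies in $\mu+\Lambda$, so periodicity and alternation give
  -- $d(\mu)=-d(\mu)$.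
  have h1 := halt _ (h.sreflection_mem ⟨α, hα⟩) μ hμ
  rw [h.sreflection_apply, h.altSign_sreflection, sub_eq_add_neg, hd μ hμ, neg_one_mul] at h1
  · exact self_eq_neg.mp h1
  · rw [hm, Int.cast_smul_eq_zsmul]
    exact AddSubgroup.neg_mem _ (AddSubgroup.zsmul_mem _ (h.corootVec_mem hα) m)

/-! #### The basis -/

omit [FiniteDimensional ℝ V] h in
open Classical in
/-- The coefficients of `χ_{μ,k}`. -/
noncomputable def chiCoeff (B : LinearMap.BilinForm ℝ V) (Φ : Set (Dual ℝ V)) (μ ν : V) : ℂ :=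
  ∑ᶠ w : weylGroup B Φ, altSign (w : V ≃ₗ[ℝ] V) *
    if ν - (w : V ≃ₗ[ℝ] V) μ ∈ corootLattice B Φ then 1 else 0

omit [FiniteDimensional ℝ V] h in
theorem chiCoeff_add (μ ν : V) {γ : V} (hγ : γ ∈ corootLattice B Φ) :
    chiCoeff B Φ μ (ν + γ) = chiCoeff B Φ μ ν := by
  refine finsum_congr fun w => ?_
  rw [add_sub_right_comm, AddSubgroup.add_mem_cancel_right _ hγ]

/-- Reindex the sum over $W$ by left multiplication by `w`, which preserves $\Lambda$. -/
theorem chiCoeff_weyl {w : V ≃ₗ[ℝ] V} (hw : w ∈ weylGroup B Φ) (μ ν : V) :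
    chiCoeff B Φ μ (w ν) = altSign w * chiCoeff B Φ μ ν := by
  classical
  have := h.finite_weylGroup
  rw [chiCoeff, chiCoeff, ← finsum_comp_equiv (Equiv.mulLeft (⟨w, hw⟩ : weylGroup B Φ)),
    mul_finsum]
  refine finsum_congr fun u => ?_
  change altSign (w * (u : V ≃ₗ[ℝ] V)) * (if w ν - w ((u : V ≃ₗ[ℝ] V) μ) ∈ corootLattice B Φ then 1 else 0) = _
  rw [altSign_mul, mul_assoc, ← map_sub]
  have h1 : w (ν - (u : V ≃ₗ[ℝ] V) μ) ∈ corootLattice B Φ ↔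
      ν - (u : V ≃ₗ[ℝ] V) μ ∈ corootLattice B Φ := by
    refine ⟨fun h2 => ?_, h.weyl_mem_lattice hw⟩
    have h3 := h.weyl_mem_lattice (inv_mem hw) h2
    have h4 : w⁻¹ (w (ν - (u : V ≃ₗ[ℝ] V) μ)) = ν - (u : V ≃ₗ[ℝ] V) μ := w.symm_apply_apply _
    rwa [h4] at h3
  simp only [h1]

/-- If $\nu\in w\mu+\Lambda$ with both points in the alcove, then $w=1$ and $\nu=\mu$; hence at most
one term survives. -/
theorem chiCoeff_alcove (hp : IsPositiveSystem Φ Φp) (h0 : IsHighestRoot Φ Φp α₀) {μ ν : V}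
    (hμ : μ ∈ alcove Φp α₀) (hν : ν ∈ alcove Φp α₀) [Decidable (ν = μ)] :
    chiCoeff B Φ μ ν = if ν = μ then 1 else 0 := by
  classical
  rw [chiCoeff, finsum_eq_single _ 1]
  · rw [OneMemClass.coe_one, altSign_one, one_mul, LinearEquiv.coe_one, id]
    refine if_congr ⟨fun h1 => ?_, fun h1 => ?_⟩ rfl rfl
    · have h2 := h.eq_one_of_mem_alcove hp h0 hμ (one_mem _) h1 (by
        rw [LinearEquiv.coe_one, id, add_sub_cancel]; exact hν)
      exact sub_eq_zero.mp h2.2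
    · rw [h1, sub_self]
      exact zero_mem _
  · intro w hw
    rw [if_neg, mul_zero]
    intro h1
    refine hw (Subtype.ext (h.eq_one_of_mem_alcove hp h0 hμ w.2 h1 ?_).1)
    rwa [add_sub_cancel]

theorem theta_eq_thetaSum {μ : V} (hμ : μ ∈ dualLattice B (corootLattice B Φ) k) (x : V × V)
    [∀ ν : V, Decidable (ν - μ ∈ corootLattice B Φ)] :
    theta B (corootLattice B Φ) τ k μ x = thetaSum B (dualLattice B (corootLattice B Φ) k) τ k
      (fun ν => if ν - μ ∈ corootLattice B Φ then 1 else 0) x := by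
  let i : corootLattice B Φ → dualLattice B (corootLattice B Φ) k := fun γ =>
    ⟨μ + γ, AddSubgroup.add_mem _ hμ (h.lattice_le_dualLattice k γ.2)⟩
  have hi : Function.Injective i := by
    intro γ γ' hγ
    exact Subtype.ext (add_left_cancel (congrArg Subtype.val hγ))
  rw [theta, thetaSum, ← hi.tsum_eq]
  · refine tsum_congr fun γ => ?_
    simp [i]
  · intro ν hν
    have h1 : (ν : V) - μ ∈ corootLattice B Φ := by
      by_contra h2
      simp [h2] at hν
    exact ⟨⟨_, h1⟩, Subtype.ext (add_sub_cancel _ _)⟩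

theorem chi_eq (hk : 0 < k) {μ : V} (hμ : μ ∈ dualLattice B (corootLattice B Φ) k) :
    chi B Φ τ k μ = fun x => thetaSum B (dualLattice B (corootLattice B Φ) k) τ k
      (chiCoeff B Φ μ) x * refSection B τ x ^ k := by
  classical
  have := h.finite_weylGroup
  have := Fintype.ofFinite (weylGroup B Φ)
  funext x
  rw [chi, finsum_eq_sum_of_fintype]
  simp only [← mul_assoc, ← Finset.sum_mul]
  congr 1
  simp only [thetaSum, chiCoeff, finsum_eq_sum_of_fintype, Finset.sum_mul]
  rw [Summable.tsum_finsetSum]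
  · refine Finset.sum_congr rfl fun w _ => ?_
    rw [h.theta_eq_thetaSum (h.weyl_mem_dualLattice w.2 hμ), thetaSum, ← tsum_mul_left]
    refine tsum_congr fun ν => ?_
    rw [mul_assoc]
  · intro w _
    refine h.summable_thetaSum hk (d := fun ν => altSign (w : V ≃ₗ[ℝ] V) *
      if ν - (w : V ≃ₗ[ℝ] V) μ ∈ corootLattice B Φ then 1 else 0) ?_ x
    intro ν _ γ hγ
    rw [add_sub_right_comm, AddSubgroup.add_mem_cancel_right _ hγ]

theorem chi_mem (hk : 0 < k) {μ : V} (hμ : μ ∈ dualLattice B (corootLattice B Φ) k) :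
    chi B Φ τ k μ ∈ altHolSections B Φ τ k := by
  rw [h.chi_eq hk hμ]
  exact ⟨h.thetaSum_mem_holSections hk fun ν _ γ hγ => chiCoeff_add μ ν hγ,
    (h.thetaSum_mem_alternating_iff hk fun ν _ γ hγ => chiCoeff_add μ ν hγ).mpr
      fun w hw ν _ => h.chiCoeff_weyl hw μ ν⟩

/-- Translate each point by $\Lambda$ into a fixed ball, which contains finitely many points of
$k^{-1}\Lambda^*$. This is injective because distinct alcove points are inequivalent modulo
$\Lambda$. -/
theorem finite_alcove_inter (hp : IsPositiveSystem Φ Φp) (h0 : IsHighestRoot Φ Φp α₀)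
    (hk : 0 < k) : Finite ↥(alcove Φp α₀ ∩ scaledDualLattice B Φ k) := by
  obtain ⟨b, hb⟩ := h.exists_lattice_basis
  have := h.discreteTopology_dual hk
  have := (finite_inter_ball (dualLattice B (corootLattice B Φ) k) (∑ i, ‖b i‖)).to_subtype
  choose g hg hgn using exists_norm_add_le hb
  refine Finite.of_injective (fun μ : ↥(alcove Φp α₀ ∩ scaledDualLattice B Φ k) =>
    (⟨μ + g μ, AddSubgroup.add_mem _ μ.2.2 (h.lattice_le_dualLattice k (hg _)), hgn _⟩ :
      {γ : V | γ ∈ dualLattice B (corootLattice B Φ) k ∧ ‖γ‖ ≤ ∑ i, ‖b i‖})) fun μ ν hμν => ?_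
  have h1 : (μ : V) + g μ = ν + g ν := congrArg Subtype.val hμν
  have h2 : (μ : V) + (g μ - g ν) = ν := by rw [← add_sub_assoc, h1, add_sub_cancel_right]
  have h3 := h.eq_one_of_mem_alcove hp h0 μ.2.1 (one_mem _) (sub_mem (hg μ) (hg ν)) (by
    rw [LinearEquiv.coe_one, id, h2]; exact ν.2.1)
  rw [h3.2, add_zero] at h2
  exact Subtype.ext h2

/-- A point with some integral root value carries coefficient zero; any other point is moved into
the alcove by $W\ltimes\Lambda$, along which both functions transform in the same way. -/
theorem eq_of_eq_on_alcove (hp : IsPositiveSystem Φ Φp) (h0 : IsHighestRoot Φ Φp α₀)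
    {d d' : V → ℂ}
    (hd : ∀ μ ∈ dualLattice B (corootLattice B Φ) k, ∀ γ ∈ corootLattice B Φ, d (μ + γ) = d μ)
    (halt : ∀ w ∈ weylGroup B Φ, ∀ μ ∈ dualLattice B (corootLattice B Φ) k,
      d (w μ) = altSign w * d μ)
    (hd' : ∀ μ ∈ dualLattice B (corootLattice B Φ) k, ∀ γ ∈ corootLattice B Φ, d' (μ + γ) = d' μ)
    (halt' : ∀ w ∈ weylGroup B Φ, ∀ μ ∈ dualLattice B (corootLattice B Φ) k,
      d' (w μ) = altSign w * d' μ)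
    (hdd' : ∀ μ ∈ alcove Φp α₀ ∩ scaledDualLattice B Φ k, d μ = d' μ) :
    ∀ μ ∈ dualLattice B (corootLattice B Φ) k, d μ = d' μ := by
  intro μ hμ
  by_cases hw : ∀ α ∈ Φ, ∀ m : ℤ, α μ ≠ m
  · obtain ⟨w, hw, γ, hγ, h1⟩ := h.exists_mem_alcove hp h0 hw
    have h2 := h.weyl_mem_dualLattice hw hμ
    have h3 := hdd' _ ⟨h1, AddSubgroup.add_mem _ h2 (h.lattice_le_dualLattice k hγ)⟩
    rw [hd _ h2 _ hγ, hd' _ h2 _ hγ, halt w hw μ hμ, halt' w hw μ hμ] at h3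
    refine mul_left_cancel₀ (fun h4 => ?_) h3
    have h5 := h.altSign_mul_self hw
    rw [h4, mul_zero] at h5
    exact zero_ne_one h5
  · push Not at hw
    obtain ⟨α, hα, m, hm⟩ := hw
    rw [h.alternating_eq_zero hd halt hμ hα hm, h.alternating_eq_zero hd' halt' hμ hα hm]

/-- The functions `χ_{μ,k}` form a basis of the space of alternating holomorphic sections. -/
theorem exists_basis_chi (hp : IsPositiveSystem Φ Φp) (h0 : IsHighestRoot Φ Φp α₀) (hk : 0 < k) :
    ∃ b : Basis ↥(alcove Φp α₀ ∩ scaledDualLattice B Φ k) ℂ (altHolSections B Φ τ k),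
      ∀ μ, (b μ : V × V → ℂ) = chi B Φ τ k (μ : V) := by
  classical
  have := h.finite_alcove_inter hp h0 hk
  have := Fintype.ofFinite ↥(alcove Φp α₀ ∩ scaledDualLattice B Φ k)
  let v : ↥(alcove Φp α₀ ∩ scaledDualLattice B Φ k) → altHolSections B Φ τ k :=
    fun μ => ⟨chi B Φ τ k μ, h.chi_mem hk μ.2.2⟩
  -- `D g` is the coefficient function of $\sum g_\mu\chi_{\mu,k}$. Its restriction to the alcove is
  -- `g`, which yields independence and, later, spanning.
  let D : (↥(alcove Φp α₀ ∩ scaledDualLattice B Φ k) → ℂ) → V → ℂ :=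
    fun g ν => ∑ μ, g μ * chiCoeff B Φ μ ν
  have hD : ∀ g, ∀ μ ∈ dualLattice B (corootLattice B Φ) k, ∀ γ ∈ corootLattice B Φ,
      D g (μ + γ) = D g μ := by
    intro g μ _ γ hγ
    exact Finset.sum_congr rfl fun ν _ => by rw [chiCoeff_add _ _ hγ]
  have hDw : ∀ g, ∀ w ∈ weylGroup B Φ, ∀ μ ∈ dualLattice B (corootLattice B Φ) k,
      D g (w μ) = altSign w * D g μ := by
    intro g w hw μ _
    simp only [D, Finset.mul_sum]
    exact Finset.sum_congr rfl fun ν _ => by rw [h.chiCoeff_weyl hw]; ring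
  have hDa : ∀ g, ∀ μ, D g μ.1 = g μ := by
    intro g μ
    simp only [D]
    rw [Finset.sum_eq_single μ]
    · rw [h.chiCoeff_alcove hp h0 μ.2.1 μ.2.1, if_pos rfl, mul_one]
    · intro ν _ hν
      rw [h.chiCoeff_alcove hp h0 ν.2.1 μ.2.1, if_neg fun h1 => hν (Subtype.ext h1.symm), mul_zero]
    · intro h1
      exact absurd (Finset.mem_univ _) h1
  have hv : ∀ g, ((∑ μ, g μ • v μ : altHolSections B Φ τ k) : V × V → ℂ) =
      fun x => thetaSum B (dualLattice B (corootLattice B Φ) k) τ k (D g) x *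
        refSection B τ x ^ k := by
    intro g
    funext x
    rw [AddSubmonoidClass.coe_finsetSum, Finset.sum_apply]
    simp only [v, Submodule.coe_smul, Pi.smul_apply, smul_eq_mul]
    have h1 : ∀ μ : ↥(alcove Φp α₀ ∩ scaledDualLattice B Φ k), g μ * chi B Φ τ k μ x =
        (∑' ν : dualLattice B (corootLattice B Φ) k,
          g μ * chiCoeff B Φ μ ν * thetaTerm B τ k ν x) * refSection B τ x ^ k := by
      intro μ
      rw [h.chi_eq hk μ.2.2]
      unfold thetaSum
      rw [← mul_assoc, ← tsum_mul_left]
      simp only [mul_assoc]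
    simp only [h1, ← Finset.sum_mul]
    rw [← Summable.tsum_finsetSum]
    · unfold thetaSum
      simp only [D, Finset.sum_mul]
    · intro μ _
      exact h.summable_thetaSum hk (d := fun ν => g μ * chiCoeff B Φ μ ν)
        (fun ν _ γ hγ => by rw [chiCoeff_add _ _ hγ]) x
  have hli : LinearIndependent ℂ v := by
    rw [Fintype.linearIndependent_iff]
    intro g hg μ
    have h1 := hv g
    rw [hg] at h1
    have h2 := h.eq_of_thetaSum_eq hk (τ := τ) (d' := fun _ => 0) (hD g) (fun _ _ _ _ => rfl)
      fun x => ?_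
    · rw [← hDa g μ]
      exact h2 _ μ.2.2
    · have h3 := congrFun h1 x
      rw [eq_comm] at h3
      rw [(mul_eq_zero.mp h3).resolve_right (refSection_pow_ne_zero τ k x)]
      simp [thetaSum]
  have hsp : ⊤ ≤ Submodule.span ℂ (Set.range v) := by
    rintro ⟨F, hF⟩ -
    obtain ⟨b, hb⟩ := h.exists_lattice_basis
    obtain ⟨d, hd, rfl⟩ := exists_thetaSum_eq h.form_eq hb hk (h.lattice_le_dualLattice k) hF.1
    have halt := (h.thetaSum_mem_alternating_iff hk hd).mp hF.2
    -- The coordinates of a section are the values of its coefficient function on the alcove.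
    have h1 : (∑ μ, d μ.1 • v μ) = ⟨_, hF⟩ := by
      refine Subtype.ext ?_
      rw [hv fun μ => d μ.1]
      funext x
      simp only
      congr 1
      refine tsum_congr fun μ => ?_
      rw [h.eq_of_eq_on_alcove hp h0 (hD _) (hDw _) hd halt (fun μ hμ => hDa _ ⟨μ, hμ⟩) μ μ.2]
    rw [← h1]
    exact Submodule.sum_mem _ fun μ _ => Submodule.smul_mem _ _ (Submodule.subset_span ⟨μ, rfl⟩)
  refine ⟨Basis.mk hli hsp, fun μ => ?_⟩
  rw [Basis.mk_apply]

end IsRootData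
end ThetaAlt

namespace ThetaAlt

open Module

/-! ### Complexification of a compact Lie algebra and of its torus. -/

section Complexification

variable {𝔤 : Type*} [LieRing 𝔤] [LieAlgebra ℝ 𝔤]

/-- The complexification of a real Lie algebra. -/
def Cx (𝔤 : Type*) [LieRing 𝔤] [LieAlgebra ℝ 𝔤] : Type _ := ℂ ⊗[ℝ] 𝔤

noncomputable instance : LieRing (Cx 𝔤) := inferInstanceAs (LieRing (ℂ ⊗[ℝ] 𝔤))

noncomputable instance : LieAlgebra ℂ (Cx 𝔤) := LieAlgebra.ExtendScalars.instLieAlgebra ℝ ℂ 𝔤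

noncomputable instance : LieAlgebra ℝ (Cx 𝔤) := LieAlgebra.ExtendScalars.instBaseLieAlgebra ℝ ℂ 𝔤

instance [FiniteDimensional ℝ 𝔤] : FiniteDimensional ℂ (Cx 𝔤) :=
  inferInstanceAs (FiniteDimensional ℂ (ℂ ⊗[ℝ] 𝔤))

instance : IsScalarTower ℝ ℂ (Cx 𝔤) := inferInstanceAs (IsScalarTower ℝ ℂ (ℂ ⊗[ℝ] 𝔤))

/-- The inclusion of a real Lie algebra into its complexification. -/
noncomputable def toCx : 𝔤 →ₗ[ℝ] Cx 𝔤 := TensorProduct.mk ℝ ℂ 𝔤 1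

/-- The real part on the complexification. -/
noncomputable def rePart : Cx 𝔤 →ₗ[ℝ] 𝔤 :=
  ((TensorProduct.lid ℝ 𝔤).toLinearMap ∘ₗ LinearMap.rTensor 𝔤 Complex.reLm :)

/-- The imaginary part on the complexification. -/
noncomputable def imPart : Cx 𝔤 →ₗ[ℝ] 𝔤 :=
  ((TensorProduct.lid ℝ 𝔤).toLinearMap ∘ₗ LinearMap.rTensor 𝔤 Complex.imLm :)

@[simp]
theorem rePart_toCx (x : 𝔤) : rePart (toCx x) = x := one_smul ℝ x

@[simp]
theorem imPart_toCx (x : 𝔤) : imPart (toCx x) = 0 := zero_smul ℝ x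

theorem Cx.induction {p : Cx 𝔤 → Prop} (zero : p 0)
    (tmul : ∀ (c : ℂ) (x : 𝔤), p (c ⊗ₜ[ℝ] x : ℂ ⊗[ℝ] 𝔤))
    (add : ∀ z w : Cx 𝔤, p z → p w → p (z + w)) (z : Cx 𝔤) : p z :=
  TensorProduct.induction_on (motive := p) z zero tmul add

theorem toCx_add_smul (z : Cx 𝔤) : toCx (rePart z) + Complex.I • toCx (imPart z) = z := by
  refine Cx.induction (p := fun z => toCx (rePart z) + Complex.I • toCx (imPart z) = z)
    (by simp) (fun c x => ?_) (fun z w hz hw => ?_) z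
  · change (1 : ℂ) ⊗ₜ[ℝ] (c.re • x) + (Complex.I * 1) ⊗ₜ[ℝ] (c.im • x) = c ⊗ₜ[ℝ] x
    rw [← TensorProduct.smul_tmul, ← TensorProduct.smul_tmul, ← TensorProduct.add_tmul]
    congr 1
    apply Complex.ext <;> simp
  · conv_rhs => rw [← hz, ← hw]
    simp only [map_add, smul_add]
    abel

theorem real_smul_cx (r : ℝ) (z : Cx 𝔤) : (r : ℂ) • z = r • z := Complex.coe_smul r z

theorem I_smul_parts (z : Cx 𝔤) :
    rePart (Complex.I • z) = -imPart z ∧ imPart (Complex.I • z) = rePart z := by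
  refine Cx.induction (p := fun z => rePart (Complex.I • z) = -imPart z ∧
    imPart (Complex.I • z) = rePart z) (by simp) (fun c x => ?_) (fun z w hz hw => ?_) z
  · change (Complex.I * c).re • x = -(c.im • x) ∧ (Complex.I * c).im • x = c.re • x
    simp
  · simp only [map_add, smul_add, hz.1, hw.1, hz.2, hw.2, neg_add, and_self]

theorem rePart_smul (c : ℂ) (z : Cx 𝔤) :
    rePart (c • z) = c.re • rePart z - c.im • imPart z := by
  conv_lhs => rw [← Complex.re_add_im c, add_smul, mul_smul, real_smul_cx, real_smul_cx]
  rw [map_add, map_smul, map_smul, (I_smul_parts z).1, smul_neg, sub_eq_add_neg]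

theorem imPart_smul (c : ℂ) (z : Cx 𝔤) :
    imPart (c • z) = c.re • imPart z + c.im • rePart z := by
  conv_lhs => rw [← Complex.re_add_im c, add_smul, mul_smul, real_smul_cx, real_smul_cx]
  rw [map_add, map_smul, map_smul, (I_smul_parts z).2]

theorem cx_ext {z w : Cx 𝔤} (h1 : rePart z = rePart w) (h2 : imPart z = imPart w) :
    z = w := by
  rw [← toCx_add_smul z, h1, h2, toCx_add_smul]

theorem toCx_lie (x y : 𝔤) : ⁅toCx x, toCx y⁆ = toCx ⁅x, y⁆ := by
  change (1 * 1 : ℂ) ⊗ₜ[ℝ] ⁅x, y⁆ = (1 : ℂ) ⊗ₜ[ℝ] ⁅x, y⁆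
  rw [one_mul]

theorem killingForm_toCx [FiniteDimensional ℝ 𝔤] (x y : 𝔤) :
    killingForm ℂ (Cx 𝔤) (toCx x) (toCx y) = (killingForm ℝ 𝔤 x y : ℂ) := by
  change LieModule.traceForm ℂ (ℂ ⊗[ℝ] 𝔤) (ℂ ⊗[ℝ] 𝔤) ((1 : ℂ) ⊗ₜ[ℝ] x) ((1 : ℂ) ⊗ₜ[ℝ] y) = _
  rw [LieModule.traceForm_baseChange, LinearMap.BilinForm.baseChange_tmul]
  simp

theorem lie_eq_parts (z w : Cx 𝔤) :
    ⁅z, w⁆ = toCx (⁅rePart z, rePart w⁆ - ⁅imPart z, imPart w⁆) +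
      Complex.I • toCx (⁅rePart z, imPart w⁆ + ⁅imPart z, rePart w⁆) := by
  conv_lhs => rw [← toCx_add_smul z, ← toCx_add_smul w]
  have h1 : ∀ x y : Cx 𝔤, ⁅Complex.I • x, y⁆ = Complex.I • ⁅x, y⁆ := smul_lie Complex.I
  have h2 : ∀ x y : Cx 𝔤, ⁅x, Complex.I • y⁆ = Complex.I • ⁅x, y⁆ := lie_smul Complex.I
  rw [add_lie, lie_add, lie_add, h1, h1, h2, h2, smul_smul, Complex.I_mul_I]
  simp only [toCx_lie, map_add, map_sub, smul_add]
  module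

theorem rePart_toCx_add_smul (x y : 𝔤) : rePart (toCx x + Complex.I • toCx y) = x := by
  rw [map_add, rePart_smul]
  simp

theorem imPart_toCx_add_smul (x y : 𝔤) : imPart (toCx x + Complex.I • toCx y) = y := by
  rw [map_add, imPart_smul]
  simp

theorem rePart_lie (z w : Cx 𝔤) :
    rePart ⁅z, w⁆ = ⁅rePart z, rePart w⁆ - ⁅imPart z, imPart w⁆ := by
  rw [lie_eq_parts, rePart_toCx_add_smul]

theorem imPart_lie (z w : Cx 𝔤) :
    imPart ⁅z, w⁆ = ⁅rePart z, imPart w⁆ + ⁅imPart z, rePart w⁆ := by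
  rw [lie_eq_parts, imPart_toCx_add_smul]

/-- The real and imaginary parts of an element of the radical are each orthogonal to the real Lie
algebra, where the Killing form is definite. -/
theorem isKilling_complexification [FiniteDimensional ℝ 𝔤]
    (hcompact : ∀ x : 𝔤, x ≠ 0 → killingForm ℝ 𝔤 x x < 0) :
    LieAlgebra.IsKilling ℂ (Cx 𝔤) := by
  refine ⟨?_⟩
  rw [LieSubmodule.eq_bot_iff]
  intro z hz
  rw [LieIdeal.mem_killingCompl] at hz
  have h1 : ∀ v : 𝔤, killingForm ℝ 𝔤 v (rePart z) = 0 ∧ killingForm ℝ 𝔤 v (imPart z) = 0 := by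
    intro v
    have h2 := hz (toCx v) (LieSubmodule.mem_top _)
    rw [← toCx_add_smul z, map_add, map_smul, killingForm_toCx, killingForm_toCx] at h2
    have h3 := congrArg Complex.re h2
    have h4 := congrArg Complex.im h2
    simp at h3 h4
    exact ⟨h3, h4⟩
  have h2 : ∀ x : 𝔤, killingForm ℝ 𝔤 x x = 0 → x = 0 := by
    intro x hx
    by_contra h3
    exact (hcompact x h3).ne hx
  refine cx_ext ?_ ?_
  · rw [map_zero]
    exact h2 _ (h1 _).1
  · rw [map_zero]
    exact h2 _ (h1 _).2

/-- The complexification of a subalgebra. -/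
noncomputable def cxSubalgebra (𝔱 : LieSubalgebra ℝ 𝔤) : LieSubalgebra ℂ (Cx 𝔤) where
  carrier := {z | rePart z ∈ 𝔱 ∧ imPart z ∈ 𝔱}
  zero_mem' := by simp
  add_mem' := by
    rintro z w ⟨h1, h2⟩ ⟨h3, h4⟩
    simp only [Set.mem_ofPred_eq, map_add]
    exact ⟨add_mem h1 h3, add_mem h2 h4⟩
  smul_mem' := by
    rintro c z ⟨h1, h2⟩
    simp only [Set.mem_ofPred_eq, rePart_smul, imPart_smul]
    exact ⟨sub_mem (𝔱.smul_mem _ h1) (𝔱.smul_mem _ h2),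
      add_mem (𝔱.smul_mem _ h2) (𝔱.smul_mem _ h1)⟩
  lie_mem' := by
    rintro z w ⟨h1, h2⟩ ⟨h3, h4⟩
    change rePart ⁅z, w⁆ ∈ 𝔱 ∧ imPart ⁅z, w⁆ ∈ 𝔱
    rw [rePart_lie, imPart_lie]
    exact ⟨sub_mem (𝔱.lie_mem h1 h3) (𝔱.lie_mem h2 h4),
      add_mem (𝔱.lie_mem h1 h4) (𝔱.lie_mem h2 h3)⟩

theorem mem_cxSubalgebra {𝔱 : LieSubalgebra ℝ 𝔤} {z : Cx 𝔤} :
    z ∈ cxSubalgebra 𝔱 ↔ rePart z ∈ 𝔱 ∧ imPart z ∈ 𝔱 :=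
  Iff.rfl

/-- The inclusion of a subalgebra into its complexification. -/
noncomputable def toCxSub (𝔱 : LieSubalgebra ℝ 𝔤) : 𝔱 →ₗ[ℝ] cxSubalgebra 𝔱 where
  toFun h := ⟨toCx (h : 𝔤), by rw [mem_cxSubalgebra]; simp⟩
  map_add' x y := Subtype.ext (by simp)
  map_smul' c x := Subtype.ext (by simp)

theorem exists_eq_toCxSub {𝔱 : LieSubalgebra ℝ 𝔤} (z : cxSubalgebra 𝔱) :
    ∃ x y : 𝔱, z = toCxSub 𝔱 x + Complex.I • toCxSub 𝔱 y := by
  obtain ⟨h1, h2⟩ := mem_cxSubalgebra.mp z.2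
  exact ⟨⟨_, h1⟩, ⟨_, h2⟩, Subtype.ext (toCx_add_smul (z : Cx 𝔤)).symm⟩

variable {𝔱 : LieSubalgebra ℝ 𝔤} (h𝔱 : Maximal (fun 𝔥 : LieSubalgebra ℝ 𝔤 => IsLieAbelian 𝔥) 𝔱)
include h𝔱

theorem torus_lie {x y : 𝔤} (hx : x ∈ 𝔱) (hy : y ∈ 𝔱) : ⁅x, y⁆ = 0 := by
  have := h𝔱.prop
  exact congrArg Subtype.val (trivial_lie_zero 𝔱 𝔱 ⟨x, hx⟩ ⟨y, hy⟩)

/-- Otherwise $\mathfrak t+\mathbb Rx$ would be a strictly larger abelian subalgebra. -/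
theorem mem_torus_of_commute {x : 𝔤} (hx : ∀ t ∈ 𝔱, ⁅x, t⁆ = 0) : x ∈ 𝔱 := by
  have h1 : ∀ y ∈ 𝔱.toSubmodule ⊔ Submodule.span ℝ {x},
      ∀ z ∈ 𝔱.toSubmodule ⊔ Submodule.span ℝ {x}, ⁅y, z⁆ = 0 := by
    intro y hy z hz
    obtain ⟨t, ht, u, hu, rfl⟩ := Submodule.mem_sup.mp hy
    obtain ⟨t', ht', u', hu', rfl⟩ := Submodule.mem_sup.mp hz
    obtain ⟨a, rfl⟩ := Submodule.mem_span_singleton.mp hu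
    obtain ⟨b, rfl⟩ := Submodule.mem_span_singleton.mp hu'
    have h2 : ⁅t, x⁆ = 0 := by rw [← lie_skew, hx t ht, neg_zero]
    simp [torus_lie h𝔱 ht ht', hx t' ht', h2]
  let 𝔰 : LieSubalgebra ℝ 𝔤 :=
    { 𝔱.toSubmodule ⊔ Submodule.span ℝ {x} with
      lie_mem' := by
        intro y z hy hz
        have h2 := h1 y hy z hz
        change ⁅y, z⁆ ∈ 𝔱.toSubmodule ⊔ Submodule.span ℝ {x}
        rw [h2]
        exact zero_mem _ }
  have h3 : IsLieAbelian 𝔰 := ⟨fun y z => Subtype.ext (h1 y y.2 z z.2)⟩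
  have h4 : 𝔱 ≤ 𝔰 := fun t ht => Submodule.mem_sup_left ht
  exact h𝔱.le_of_ge h3 h4 (Submodule.mem_sup_right (Submodule.mem_span_singleton_self x))

theorem isLieAbelian_cxSubalgebra : IsLieAbelian (cxSubalgebra 𝔱) := by
  refine ⟨fun z w => Subtype.ext ?_⟩
  obtain ⟨h1, h2⟩ := mem_cxSubalgebra.mp z.2
  obtain ⟨h3, h4⟩ := mem_cxSubalgebra.mp w.2
  rw [LieSubalgebra.coe_bracket, lie_eq_parts, torus_lie h𝔱 h1 h3, torus_lie h𝔱 h1 h4,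
    torus_lie h𝔱 h2 h3, torus_lie h𝔱 h2 h4]
  simp

variable {B : LinearMap.BilinForm ℝ 𝔤} (hB : IsBasicInnerProduct 𝔱 B)
include hB

omit h𝔱 in
theorem IsBasicInnerProduct.eq_zero {x : 𝔤} (hx : B x x = 0) : x = 0 := by
  by_contra h1
  exact (hB.pos x h1).ne' hx

/-- By invariance $B([x,t],[x,t])=B(x,[t,[x,t]])=0$, since $t$ and $[x,t]$ both lie in the abelian
$\mathfrak t$; so $x$ centralises $\mathfrak t$. -/
theorem mem_torus_of_normalize {x : 𝔤} (hx : ∀ t ∈ 𝔱, ⁅x, t⁆ ∈ 𝔱) : x ∈ 𝔱 := by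
  refine mem_torus_of_commute h𝔱 fun t ht => hB.eq_zero ?_
  rw [hB.invariant, torus_lie h𝔱 ht (hx t ht), map_zero]

theorem isCartanSubalgebra_cxSubalgebra : (cxSubalgebra 𝔱).IsCartanSubalgebra := by
  have := isLieAbelian_cxSubalgebra h𝔱
  refine ⟨inferInstance, le_antisymm (fun z hz => ?_) (LieSubalgebra.le_normalizer _)⟩
  rw [LieSubalgebra.mem_normalizer_iff] at hz
  have h1 : ∀ t ∈ 𝔱, ⁅rePart z, t⁆ ∈ 𝔱 ∧ ⁅imPart z, t⁆ ∈ 𝔱 := by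
    intro t ht
    have h2 := hz (toCx t) (mem_cxSubalgebra.mpr (by simpa using ht))
    rw [mem_cxSubalgebra, rePart_lie, imPart_lie] at h2
    simpa using h2
  exact mem_cxSubalgebra.mpr ⟨mem_torus_of_normalize h𝔱 hB fun t ht => (h1 t ht).1,
    mem_torus_of_normalize h𝔱 hB fun t ht => (h1 t ht).2⟩

end Complexification
end ThetaAlt

namespace ThetaAlt

open Module

/-! ### Real roots as restrictions of complex weights. -/

section Weights

open LieAlgebra LieAlgebra.IsKilling LieModule

variable {𝔤 : Type*} [LieRing 𝔤] [LieAlgebra ℝ 𝔤] [FiniteDimensional ℝ 𝔤]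
variable {𝔱 : LieSubalgebra ℝ 𝔤}
variable {B : LinearMap.BilinForm ℝ 𝔤} (hB : IsBasicInnerProduct 𝔱 B)
variable [IsKilling ℂ (Cx 𝔤)] [(cxSubalgebra 𝔱).IsCartanSubalgebra]

/-- The weight `χ` of the complexified torus restricts to `2πiα` on the torus. -/
def Restricts (χ : Weight ℂ (cxSubalgebra 𝔱) (Cx 𝔤)) (α : Dual ℝ 𝔱) : Prop :=
  ∀ h : 𝔱, χ (toCxSub 𝔱 h) = 2 * Real.pi * Complex.I * α h

omit [FiniteDimensional ℝ 𝔤] [IsKilling ℂ (Cx 𝔤)] in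
theorem Restricts.unique {χ : Weight ℂ (cxSubalgebra 𝔱) (Cx 𝔤)} {α β : Dual ℝ 𝔱}
    (h1 : Restricts χ α) (h2 : Restricts χ β) : α = β := by
  ext x
  have h3 := (h1 x).symm.trans (h2 x)
  have h4 : (2 * Real.pi * Complex.I : ℂ) ≠ 0 := Complex.two_pi_I_ne_zero
  exact_mod_cast mul_left_cancel₀ h4 h3

omit [IsKilling ℂ (Cx 𝔤)] in
theorem Restricts.isNonZero_iff {χ : Weight ℂ (cxSubalgebra 𝔱) (Cx 𝔤)} {α : Dual ℝ 𝔱}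
    (h1 : Restricts χ α) : χ.IsNonZero ↔ α ≠ 0 := by
  refine not_congr ⟨fun h2 => ?_, fun h2 => ?_⟩
  · ext x
    have h3 := h1 x
    have h4 : (2 * Real.pi * Complex.I : ℂ) ≠ 0 := Complex.two_pi_I_ne_zero
    rw [h2.eq, Pi.zero_apply, eq_comm, mul_eq_zero] at h3
    exact_mod_cast h3.resolve_left h4
  · have h3 : ∀ x : 𝔱, χ (toCxSub 𝔱 x) = 0 := by
      intro x
      rw [h1, h2]
      simp
    change (χ : cxSubalgebra 𝔱 → ℂ) = 0
    funext z
    obtain ⟨x, y, rfl⟩ := exists_eq_toCxSub z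
    rw [← Weight.toLinear_apply, map_add, map_smul, Weight.toLinear_apply, Weight.toLinear_apply,
      h3, h3]
    simp

theorem lie_toCx_rootVector {χ : Weight ℂ (cxSubalgebra 𝔱) (Cx 𝔤)} {z : Cx 𝔤}
    (hz : z ∈ rootSpace (cxSubalgebra 𝔱) χ) (h : 𝔱) :
    ⁅toCx (h : 𝔤), z⁆ = χ (toCxSub 𝔱 h) • z :=
  lie_eq_smul_of_mem_rootSpace hz (toCxSub 𝔱 h)

include hB in
/-- The weights take imaginary values on the torus, since the inner product is invariant. -/
theorem re_weight_eq_zero (χ : Weight ℂ (cxSubalgebra 𝔱) (Cx 𝔤)) (h : 𝔱) :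
    (χ (toCxSub 𝔱 h)).re = 0 := by
  obtain ⟨z, hz, hz0⟩ := χ.exists_ne_zero
  have h1 := lie_toCx_rootVector hz h
  have h2 := congrArg rePart h1
  have h3 := congrArg imPart h1
  rw [rePart_lie, rePart_smul] at h2
  rw [imPart_lie, imPart_smul] at h3
  simp only [rePart_toCx, imPart_toCx, zero_lie, sub_zero, add_zero] at h2 h3
  have h4 : ∀ x, B ⁅(h : 𝔤), x⁆ x = 0 := by
    intro x
    have h5 := hB.invariant x (h : 𝔤) x
    rw [← lie_skew, map_neg, LinearMap.neg_apply, hB.symm x] at h5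
    linarith
  have h5 := h4 (rePart z)
  have h6 := h4 (imPart z)
  rw [h2] at h5
  rw [h3] at h6
  simp only [map_sub, map_add, map_smul, LinearMap.sub_apply, LinearMap.add_apply,
    LinearMap.smul_apply, smul_eq_mul] at h5 h6
  rw [hB.symm (imPart z) (rePart z)] at h5
  -- Skewness of $\operatorname{ad}h$ gives one equation for each part of the weight vector; in
  -- their sum the imaginary part of the eigenvalue cancels.
  have h7 : (χ (toCxSub 𝔱 h)).re * (B (rePart z) (rePart z) + B (imPart z) (imPart z)) = 0 := by
    linear_combination h5 + h6
  refine (mul_eq_zero.mp h7).resolve_right fun h8 => hz0 ?_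
  have hnn : ∀ x, 0 ≤ B x x := by
    intro x
    rcases eq_or_ne x 0 with rfl | hx
    · simp
    · exact (hB.pos x hx).le
  refine cx_ext ?_ ?_
  · rw [map_zero]
    exact hB.eq_zero (le_antisymm (by linarith [hnn (imPart z)]) (hnn _))
  · rw [map_zero]
    exact hB.eq_zero (le_antisymm (by linarith [hnn (rePart z)]) (hnn _))

include hB in
theorem exists_restricts (χ : Weight ℂ (cxSubalgebra 𝔱) (Cx 𝔤)) :
    ∃ α : Dual ℝ 𝔱, Restricts χ α := by
  let α : Dual ℝ 𝔱 := (2 * Real.pi)⁻¹ •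
    (Complex.imLm ∘ₗ (Weight.toLinear ℂ (cxSubalgebra 𝔱) (Cx 𝔤) χ).restrictScalars ℝ ∘ₗ toCxSub 𝔱)
  refine ⟨α, fun h => ?_⟩
  have h1 : α h = (2 * Real.pi)⁻¹ * (χ (toCxSub 𝔱 h)).im := rfl
  have h2 : (Real.pi : ℂ) ≠ 0 := by exact_mod_cast Real.pi_ne_zero
  rw [h1, ← Complex.re_add_im (χ (toCxSub 𝔱 h)), re_weight_eq_zero hB]
  push_cast
  simp
  field_simp

theorem Restricts.mem_realRoots {χ : Weight ℂ (cxSubalgebra 𝔱) (Cx 𝔤)} {α : Dual ℝ 𝔱}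
    (h1 : Restricts χ α) (h0 : χ.IsNonZero) : α ∈ realRoots 𝔱 := by
  refine ⟨h1.isNonZero_iff.mp h0, ?_⟩
  obtain ⟨z, hz, hz0⟩ := χ.exists_ne_zero
  refine ⟨rePart z, imPart z, ?_, fun h => ?_⟩
  · by_contra! h2
    exact hz0 (cx_ext (by rw [h2.1, map_zero]) (by rw [h2.2, map_zero]))
  · have h3 := lie_toCx_rootVector hz h
    rw [h1] at h3
    have h4 := congrArg rePart h3
    have h5 := congrArg imPart h3
    rw [rePart_lie, rePart_smul] at h4
    rw [imPart_lie, imPart_smul] at h5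
    simp at h4 h5
    rw [h4, h5, neg_smul]
    exact ⟨rfl, rfl⟩

-- The vector $X+iY$ is a common eigenvector of $\mathfrak t$, hence of its complexification, and
-- its eigenvalue function is the weight.
omit [IsKilling ℂ (Cx 𝔤)] in
theorem exists_weight_of_mem_realRoots {α : Dual ℝ 𝔱} (hα : α ∈ realRoots 𝔱) :
    ∃ χ : Weight ℂ (cxSubalgebra 𝔱) (Cx 𝔤), Restricts χ α ∧ χ.IsNonZero := by
  obtain ⟨h0, X, Y, hXY, hα⟩ := hα
  let z : Cx 𝔤 := toCx X + Complex.I • toCx Y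
  have hz0 : z ≠ 0 := by
    intro h1
    have h2 := congrArg rePart h1
    have h3 := congrArg imPart h1
    rw [rePart_toCx_add_smul, map_zero] at h2
    rw [imPart_toCx_add_smul, map_zero] at h3
    exact hXY.elim (fun h => h h2) fun h => h h3
  have hz : ∀ h : 𝔱, ⁅toCx (h : 𝔤), z⁆ = (2 * Real.pi * Complex.I * α h : ℂ) • z := by
    intro h
    refine cx_ext ?_ ?_
    · rw [rePart_lie, rePart_smul, rePart_toCx_add_smul, imPart_toCx_add_smul]
      simp [(hα h).1]
    · rw [imPart_lie, imPart_smul, rePart_toCx_add_smul, imPart_toCx_add_smul]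
      simp [(hα h).2]
  have hex : ∀ u : cxSubalgebra 𝔱, ∃ c : ℂ, ⁅u, z⁆ = c • z := by
    intro u
    obtain ⟨x, y, rfl⟩ := exists_eq_toCxSub u
    refine ⟨2 * Real.pi * Complex.I * α x + Complex.I * (2 * Real.pi * Complex.I * α y), ?_⟩
    rw [add_lie, smul_lie, add_smul, mul_smul Complex.I]
    exact congrArg₂ (· + ·) (hz x) (congrArg (Complex.I • ·) (hz y))
  choose χ hχ using hex
  have hχ0 : genWeightSpace (Cx 𝔤) χ ≠ ⊥ := by
    intro h1
    have h2 : z ∈ weightSpace (Cx 𝔤) χ := by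
      rw [mem_weightSpace]
      exact hχ
    have h3 := weightSpace_le_genWeightSpace (Cx 𝔤) χ h2
    rw [h1] at h3
    exact hz0 h3
  have hr : Restricts ⟨χ, hχ0⟩ α := by
    intro h
    have h1 : χ (toCxSub 𝔱 h) • z = (2 * Real.pi * Complex.I * α h : ℂ) • z :=
      (hχ (toCxSub 𝔱 h)).symm.trans (hz h)
    exact smul_left_injective ℂ hz0 h1
  exact ⟨⟨χ, hχ0⟩, hr, hr.isNonZero_iff.mpr h0⟩

end Weights
end ThetaAlt

namespace ThetaAlt

open Module

/-! ### Coroots with respect to a positive definite form. -/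

section Coroots

variable {V : Type*} [AddCommGroup V] [Module ℝ V] [FiniteDimensional ℝ V]
variable {C : LinearMap.BilinForm ℝ V} (hpos : ∀ x, x ≠ 0 → 0 < C x x)
include hpos

theorem exists_isDualVector (α : Dual ℝ V) : ∃ a, IsDualVector C α a := by
  have h1 : Function.Injective C := by
    rw [injective_iff_map_eq_zero]
    intro x hx
    by_contra h2
    have h3 := hpos x h2
    rw [hx] at h3
    exact lt_irrefl _ h3
  have h2 : Function.Surjective C := by
    refine (LinearMap.injective_iff_surjective_of_finrank_eq_finrank ?_).mp h1
    exact (Subspace.dual_finrank_eq (K := ℝ) (V := V)).symm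
  obtain ⟨a, ha⟩ := h2 α
  exact ⟨a, fun v => by rw [ha]⟩

omit [FiniteDimensional ℝ V] in
theorem isDualVector_unique {α : Dual ℝ V} {a b : V} (ha : IsDualVector C α a)
    (hb : IsDualVector C α b) : a = b := by
  by_contra h1
  have h2 := hpos (a - b) (sub_ne_zero.mpr h1)
  have h3 : C (a - b) (a - b) = 0 := by
    rw [LinearMap.map_sub₂, ha, hb, sub_self]
  rw [h3] at h2
  exact lt_irrefl _ h2

theorem exists_isCoroot (α : Dual ℝ V) : ∃ x, IsCoroot C α x := by
  obtain ⟨a, ha⟩ := exists_isDualVector hpos α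
  exact ⟨_, a, ha, rfl⟩

omit [FiniteDimensional ℝ V] in
theorem IsDualVector.self_pos {α : Dual ℝ V} (hα : α ≠ 0) {a : V} (ha : IsDualVector C α a) :
    0 < C a a := by
  refine hpos a ?_
  rintro rfl
  refine hα (LinearMap.ext fun v => ?_)
  rw [← ha v]
  simp

omit [FiniteDimensional ℝ V] in
theorem IsCoroot.apply_self {α : Dual ℝ V} (hα : α ≠ 0) {x : V} (hx : IsCoroot C α x) :
    α x = 2 := by
  obtain ⟨a, ha, rfl⟩ := hx
  have h1 := ha.self_pos hpos hα
  rw [map_smul, ← ha, smul_eq_mul, div_mul_cancel₀ _ h1.ne']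

omit [FiniteDimensional ℝ V] in
theorem IsCoroot.self_pos {α : Dual ℝ V} (hα : α ≠ 0) {x : V} (hx : IsCoroot C α x) :
    0 < C x x := by
  refine hpos x ?_
  rintro rfl
  have h1 := hx.apply_self hpos hα
  rw [map_zero] at h1
  exact two_ne_zero h1.symm

omit [FiniteDimensional ℝ V] in
theorem IsCoroot.form_eq {α : Dual ℝ V} (hα : α ≠ 0) {x : V} (hx : IsCoroot C α x) (v : V) :
    C x v = C x x / 2 * α v := by
  have h2 := hx.apply_self hpos hα
  obtain ⟨a, ha, rfl⟩ := hx
  have h1 : C ((2 / C a a) • a) ((2 / C a a) • a) = 4 / C a a := by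
    have h3 := (ha.self_pos hpos hα).ne'
    simp only [map_smul, LinearMap.smul_apply, smul_eq_mul]
    field_simp
    norm_num
  rw [h1, map_smul, LinearMap.smul_apply, smul_eq_mul, ha v]
  ring

omit [FiniteDimensional ℝ V] in
theorem IsCoroot.form_self_mul {α : Dual ℝ V} (hα : α ≠ 0) {x a : V} (hx : IsCoroot C α x)
    (ha : IsDualVector C α a) : C x x * C a a = 4 := by
  obtain ⟨b, hb, rfl⟩ := hx
  obtain rfl := isDualVector_unique hpos ha hb
  have h3 := (ha.self_pos hpos hα).ne'
  simp only [map_smul, LinearMap.smul_apply, smul_eq_mul]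
  field_simp
  norm_num

end Coroots

/-! ### Root system axioms for the real roots. -/

section Weights

open LieAlgebra LieAlgebra.IsKilling LieModule

variable {𝔤 : Type*} [LieRing 𝔤] [LieAlgebra ℝ 𝔤] [FiniteDimensional ℝ 𝔤]
variable {𝔱 : LieSubalgebra ℝ 𝔤}
variable {B : LinearMap.BilinForm ℝ 𝔤} (hB : IsBasicInnerProduct 𝔱 B)
include hB

omit [FiniteDimensional ℝ 𝔤] in
theorem torusForm_pos (x : 𝔱) (hx : x ≠ 0) : 0 < torusForm B 𝔱 x x :=
  hB.pos x fun h => hx (Subtype.ext h)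

omit [FiniteDimensional ℝ 𝔤] in
theorem torusForm_symm (x y : 𝔱) : torusForm B 𝔱 x y = torusForm B 𝔱 y x :=
  hB.symm x y

variable [IsKilling ℂ (Cx 𝔤)] [(cxSubalgebra 𝔱).IsCartanSubalgebra]

/-- The coroot of a weight of the complexified torus is, up to the factor `2πi`, the coroot of the
real root with respect to the inner product. -/
theorem Restricts.coroot_eq {χ : Weight ℂ (cxSubalgebra 𝔱) (Cx 𝔤)} {α : Dual ℝ 𝔱}
    (hr : Restricts χ α) (h0 : χ.IsNonZero) {x : 𝔱} (hx : IsCoroot (torusForm B 𝔱) α x) :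
    coroot χ = (1 / (2 * Real.pi * Complex.I) : ℂ) • toCxSub 𝔱 x := by
  have hpos := torusForm_pos hB
  obtain ⟨h, e, f, ht, he, hf⟩ := exists_isSl2Triple_of_weight_isNonZero h0
  have hco := ht.h_eq_coroot h0 he hf
  obtain ⟨a, ha, rfl⟩ := hx
  have hapos := ha.self_pos hpos (hr.isNonZero_iff.mp h0)
  have hf' : ∀ t : 𝔱, ⁅f, toCx (t : 𝔤)⁆ = (2 * Real.pi * Complex.I * α t : ℂ) • f := by
    intro t
    have h1 : ⁅toCx (t : 𝔤), f⁆ = (-χ (toCxSub 𝔱 t)) • f :=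
      lie_eq_smul_of_mem_rootSpace hf (toCxSub 𝔱 t)
    rw [← lie_skew, h1, hr, neg_smul, neg_neg]
  -- With $B$ extended bilinearly, $p+iq=B(e,f)$. Invariance then shows that $h=[e,f]$ is $2\pi
  -- i(p+iq)$ times the vector `a` dual to `α`.
  let p : ℝ := B (rePart e) (rePart f) - B (imPart e) (imPart f)
  let q : ℝ := B (rePart e) (imPart f) + B (imPart e) (rePart f)
  have hfr : ∀ t : 𝔱, ⁅rePart f, (t : 𝔤)⁆ = -(2 * Real.pi * α t) • imPart f ∧
      ⁅imPart f, (t : 𝔤)⁆ = (2 * Real.pi * α t) • rePart f := by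
    intro t
    have h2 := congrArg rePart (hf' t)
    have h3 := congrArg imPart (hf' t)
    rw [rePart_lie, rePart_smul] at h2
    rw [imPart_lie, imPart_smul] at h3
    simp at h2 h3
    rw [h2, h3, neg_smul]
    exact ⟨rfl, rfl⟩
  have hc : ∀ t : 𝔱, B (rePart h) t = -(2 * Real.pi) * q * α t ∧
      B (imPart h) t = 2 * Real.pi * p * α t := by
    intro t
    rw [← ht.lie_e_f, rePart_lie, imPart_lie]
    simp only [map_sub, map_add, LinearMap.sub_apply, LinearMap.add_apply, hB.invariant,
      (hfr t).1, (hfr t).2, map_smul, smul_eq_mul, p, q]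
    constructor <;> ring
  obtain ⟨u, v, huv⟩ := exists_eq_toCxSub (coroot χ)
  have hh : h = toCx (u : 𝔤) + Complex.I • toCx (v : 𝔤) := by
    rw [hco, huv]
    rfl
  have hu : u = (-(2 * Real.pi) * q) • a := by
    have h1 : IsDualVector (torusForm B 𝔱) ((-(2 * Real.pi) * q) • α) u := by
      intro t
      have h2 := (hc t).1
      rw [hh, rePart_toCx_add_smul] at h2
      exact h2
    refine isDualVector_unique hpos h1 fun t => ?_
    rw [map_smul, LinearMap.smul_apply, ha]
    rfl
  have hv : v = (2 * Real.pi * p) • a := by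
    have h1 : IsDualVector (torusForm B 𝔱) ((2 * Real.pi * p) • α) v := by
      intro t
      have h2 := (hc t).2
      rw [hh, imPart_toCx_add_smul] at h2
      exact h2
    refine isDualVector_unique hpos h1 fun t => ?_
    rw [map_smul, LinearMap.smul_apply, ha]
    rfl
  have hsm : ∀ (r : ℝ) (t : 𝔱), toCxSub 𝔱 (r • t) = (r : ℂ) • toCxSub 𝔱 t := by
    intro r t
    rw [map_smul]
    exact Subtype.ext (real_smul_cx r _).symm
  rw [hu, hv, hsm, hsm, smul_smul, ← add_smul] at huv
  -- The remaining scalar is fixed by the value $2$ of the weight on its coroot.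
  have h2 := root_apply_coroot h0
  rw [huv, ← Weight.toLinear_apply, map_smul, Weight.toLinear_apply, hr, ← ha, smul_eq_mul] at h2
  rw [huv, hsm, smul_smul]
  congr 1
  have h3 : ((torusForm B 𝔱 a a : ℝ) : ℂ) ≠ 0 := by exact_mod_cast hapos.ne'
  have h4 : (2 * Real.pi * Complex.I : ℂ) ≠ 0 := Complex.two_pi_I_ne_zero
  push_cast
  rw [div_mul_div_comm, one_mul, eq_div_iff (mul_ne_zero h4 h3)]
  push_cast at h2
  exact h2

theorem Restricts.apply_coroot {χ ψ : Weight ℂ (cxSubalgebra 𝔱) (Cx 𝔤)} {α β : Dual ℝ 𝔱}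
    (hχ : Restricts χ α) (h0 : χ.IsNonZero) (hψ : Restricts ψ β) {x : 𝔱}
    (hx : IsCoroot (torusForm B 𝔱) α x) : ψ (coroot χ) = β x := by
  have h4 : (2 * Real.pi * Complex.I : ℂ) ≠ 0 := Complex.two_pi_I_ne_zero
  rw [hχ.coroot_eq hB h0 hx, ← Weight.toLinear_apply, map_smul, Weight.toLinear_apply, hψ,
    smul_eq_mul, one_div, inv_mul_cancel_left₀ h4]

theorem finite_realRoots : (realRoots 𝔱).Finite := by
  choose r hr using exists_restricts hB (𝔱 := 𝔱)
  refine (Set.finite_range r).subset fun α hα => ?_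
  obtain ⟨χ, h1, -⟩ := exists_weight_of_mem_realRoots hα
  exact ⟨χ, (hr χ).unique h1⟩

theorem realRoots_integral {α β : Dual ℝ 𝔱} (hα : α ∈ realRoots 𝔱) (hβ : β ∈ realRoots 𝔱)
    {x : 𝔱} (hx : IsCoroot (torusForm B 𝔱) α x) : ∃ m : ℤ, β x = m := by
  obtain ⟨χ, h1, h2⟩ := exists_weight_of_mem_realRoots hα
  obtain ⟨ψ, h3, h4⟩ := exists_weight_of_mem_realRoots hβ
  have h5 := h1.apply_coroot hB h2 h3 hx
  rw [apply_coroot_eq_cast] at h5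
  exact ⟨_, by exact_mod_cast h5.symm⟩

theorem realRoots_refl {α β : Dual ℝ 𝔱} (hα : α ∈ realRoots 𝔱) (hβ : β ∈ realRoots 𝔱)
    {x : 𝔱} (hx : IsCoroot (torusForm B 𝔱) α x) : β - β x • α ∈ realRoots 𝔱 := by
  obtain ⟨χ, h1, h2⟩ := exists_weight_of_mem_realRoots hα
  obtain ⟨ψ, h3, h4⟩ := exists_weight_of_mem_realRoots hβ
  have h5 : Restricts (reflectRoot χ ψ) (β - β x • α) := by
    intro t
    change ψ (toCxSub 𝔱 t) - ψ (coroot χ) * χ (toCxSub 𝔱 t) = _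
    rw [h1.apply_coroot hB h2 h3 hx, h1, h3]
    simp only [LinearMap.sub_apply, LinearMap.smul_apply, smul_eq_mul]
    push_cast
    ring
  exact h5.mem_realRoots (reflectRoot_isNonZero χ ψ h4)

omit hB in
theorem realRoots_reduced {α : Dual ℝ 𝔱} (hα : α ∈ realRoots 𝔱) {c : ℝ}
    (hc : c • α ∈ realRoots 𝔱) : c = 1 ∨ c = -1 := by
  obtain ⟨χ, h1, h2⟩ := exists_weight_of_mem_realRoots hα
  obtain ⟨ψ, h3, h4⟩ := exists_weight_of_mem_realRoots hc
  have h5 : (ψ : cxSubalgebra 𝔱 → ℂ) = (c : ℂ) • (χ : cxSubalgebra 𝔱 → ℂ) := by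
    have h6 : ∀ t, ψ (toCxSub 𝔱 t) = c * χ (toCxSub 𝔱 t) := by
      intro t
      rw [h1, h3]
      simp only [LinearMap.smul_apply, smul_eq_mul]
      push_cast
      ring
    funext z
    obtain ⟨x, y, rfl⟩ := exists_eq_toCxSub z
    rw [Pi.smul_apply, ← Weight.toLinear_apply, ← Weight.toLinear_apply, map_add, map_add, map_smul,
      map_smul]
    simp only [Weight.toLinear_apply, h6, smul_eq_mul]
    ring
  rcases eq_neg_one_or_eq_zero_or_eq_one_of_eq_smul χ ψ h2 (c : ℂ) h5 with h6 | h6 | h6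
  · exact Or.inr (by exact_mod_cast h6)
  · have h7 : c = 0 := by exact_mod_cast h6
    rw [h7, zero_smul] at hc
    exact absurd rfl hc.1
  · exact Or.inl (by exact_mod_cast h6)

/-- The nonzero weights span the dual of the Cartan subalgebra, and each restricts to $2\pi i$ times
a real root. -/
theorem eq_zero_of_forall_realRoots {v : 𝔱} (hv : ∀ α ∈ realRoots 𝔱, α v = 0) : v = 0 := by
  have h1 : ∀ φ : Dual ℂ (cxSubalgebra 𝔱), φ (toCxSub 𝔱 v) = 0 := by
    intro φ
    have h2 : φ ∈ Submodule.span ℂ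
        ({χ : Weight ℂ (cxSubalgebra 𝔱) (Cx 𝔤) | χ.IsNonZero}.image
          (Weight.toLinear ℂ (cxSubalgebra 𝔱) (Cx 𝔤))) := by
      rw [span_weight_isNonZero_eq_top]
      exact Submodule.mem_top
    induction h2 using Submodule.span_induction with
    | mem φ hφ =>
      obtain ⟨χ, h3, rfl⟩ := hφ
      obtain ⟨α, h4⟩ := exists_restricts hB χ
      rw [Weight.toLinear_apply, h4, hv α (h4.mem_realRoots h3)]
      simp
    | zero => simp
    | add φ ψ _ _ h3 h4 => rw [LinearMap.add_apply, h3, h4, add_zero]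
    | smul c φ _ h3 => rw [LinearMap.smul_apply, h3, smul_zero]
  have h2 := (Module.forall_dual_apply_eq_zero_iff ℂ (toCxSub 𝔱 v)).mp h1
  have h3 := congrArg (fun z : cxSubalgebra 𝔱 => rePart (z : Cx 𝔤)) h2
  refine Subtype.ext ?_
  change rePart (toCx (v : 𝔤)) = rePart 0 at h3
  simpa using h3

theorem span_realRoots : Submodule.span ℝ (realRoots 𝔱) = ⊤ := by
  rw [← Subspace.dualCoannihilator_dualAnnihilator_eq (W := Submodule.span ℝ (realRoots 𝔱))]
  have h1 : (Submodule.span ℝ (realRoots 𝔱)).dualCoannihilator = ⊥ := by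
    rw [Submodule.eq_bot_iff]
    intro v hv
    rw [Submodule.mem_dualCoannihilator] at hv
    exact eq_zero_of_forall_realRoots hB fun α hα => hv α (Submodule.subset_span hα)
  rw [h1, Submodule.dualAnnihilator_bot]

end Weights
end ThetaAlt

namespace ThetaAlt

open Module

/-! ### Simplicity and irreducibility of the roots. -/

section Irreducible

open LieAlgebra LieAlgebra.IsKilling LieModule

variable {𝔤 : Type*} [LieRing 𝔤] [LieAlgebra ℝ 𝔤] [FiniteDimensional ℝ 𝔤] [LieAlgebra.IsSimple ℝ 𝔤]
variable {𝔱 : LieSubalgebra ℝ 𝔤}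
variable {B : LinearMap.BilinForm ℝ 𝔤} (hB : IsBasicInnerProduct 𝔱 B)
variable [IsKilling ℂ (Cx 𝔤)] [(cxSubalgebra 𝔱).IsCartanSubalgebra]

omit [FiniteDimensional ℝ 𝔤] [IsKilling ℂ (Cx 𝔤)] [(cxSubalgebra 𝔱).IsCartanSubalgebra] in
/-- An ideal of the complexification of a simple Lie algebra is everything as soon as it contains
a nonzero real element. -/
theorem mem_ideal_of_toCx_mem (I : LieIdeal ℂ (Cx 𝔤)) {x : 𝔤} (hx : toCx x ∈ I) (hx0 : x ≠ 0)
    (z : Cx 𝔤) : z ∈ I := by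
  let J : LieIdeal ℝ 𝔤 :=
    { carrier := {y | toCx y ∈ I}
      zero_mem' := by simp
      add_mem' := by
        intro a b ha hb
        simp only [Set.mem_ofPred_eq, map_add] at ha hb ⊢
        exact add_mem ha hb
      smul_mem' := by
        intro c a ha
        simp only [Set.mem_ofPred_eq, map_smul, ← real_smul_cx] at ha ⊢
        exact I.smul_mem _ ha
      lie_mem := by
        intro a b hb
        change toCx ⁅a, b⁆ ∈ I
        rw [← toCx_lie]
        exact I.lie_mem hb }
  have hJ : J = ⊤ := by
    refine (LieAlgebra.IsSimple.eq_bot_or_eq_top (R := ℝ) J).resolve_left fun h => hx0 ?_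
    have h1 : x ∈ J := hx
    rwa [h, LieSubmodule.mem_bot] at h1
  have h1 : ∀ y : 𝔤, toCx y ∈ I := by
    intro y
    have h2 : y ∈ J := by
      rw [hJ]
      exact LieSubmodule.mem_top y
    exact h2
  rw [← toCx_add_smul z]
  exact add_mem (h1 _) (I.smul_mem _ (h1 _))

include hB in
/-- The root system of a simple Lie algebra is irreducible. -/
theorem realRoots_irreducible {Φ₁ : Set (Dual ℝ 𝔱)} (h1 : Φ₁ ⊆ realRoots 𝔱) (hne : Φ₁.Nonempty)
    (horth : ∀ α ∈ Φ₁, ∀ γ ∈ realRoots 𝔱, γ ∉ Φ₁ → ∀ x : 𝔱, IsCoroot (torusForm B 𝔱) γ x →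
      α x = 0) : realRoots 𝔱 ⊆ Φ₁ := by
  -- The span of the weights over `Φ₁` is stable under all root reflections: those in `Φ₁` add
  -- elements of the span, the others act trivially on it. It therefore corresponds to an ideal.
  let q : Submodule ℂ (Dual ℂ (cxSubalgebra 𝔱)) := Submodule.span ℂ
    (Weight.toLinear ℂ (cxSubalgebra 𝔱) (Cx 𝔤) '' {χ | χ.IsNonZero ∧ ∃ α ∈ Φ₁, Restricts χ α})
  have hq0 : ∀ (χ : Weight ℂ (cxSubalgebra 𝔱) (Cx 𝔤)) (γ : Dual ℝ 𝔱), χ.IsNonZero →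
      Restricts χ γ → γ ∉ Φ₁ → ∀ φ ∈ q, φ (coroot χ) = 0 := by
    intro χ γ hχ hr hγ φ hφ
    obtain ⟨x, hx⟩ := exists_isCoroot (torusForm_pos hB) γ
    induction hφ using Submodule.span_induction with
    | mem φ h2 =>
      obtain ⟨ψ, ⟨-, α, hα, h3⟩, rfl⟩ := h2
      rw [Weight.toLinear_apply, hr.apply_coroot hB hχ h3 hx,
        horth α hα γ (hr.mem_realRoots hχ) hγ x hx, Complex.ofReal_zero]
    | zero => simp
    | add φ ψ _ _ h3 h4 => rw [LinearMap.add_apply, h3, h4, add_zero]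
    | smul c φ _ h3 => rw [LinearMap.smul_apply, h3, smul_zero]
  have hq : ∀ i, q ∈ End.invtSubmodule ((rootSystem (cxSubalgebra 𝔱)).reflection i).toLinearMap := by
    intro i φ hφ
    have hi : (i : Weight ℂ (cxSubalgebra 𝔱) (Cx 𝔤)).IsNonZero := LieSubalgebra.isNonZero_coe_root i
    obtain ⟨γ, hγ⟩ := exists_restricts hB (i : Weight ℂ (cxSubalgebra 𝔱) (Cx 𝔤))
    rw [Submodule.mem_comap, LinearEquiv.coe_coe, RootPairing.reflection_apply,
      rootSystem_root_apply]
    change φ - φ (coroot i.1) • _ ∈ q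
    by_cases h2 : γ ∈ Φ₁
    · exact sub_mem hφ (q.smul_mem _ (Submodule.subset_span ⟨_, ⟨hi, γ, h2, hγ⟩, rfl⟩))
    · have h3 := hq0 _ γ hi hγ h2 φ hφ
      rwa [h3, zero_smul, sub_zero]
  let I := invtSubmoduleToLieIdeal q hq
  -- The ideal contains the coroot of a root in `Φ₁`, and a complex multiple of it is a nonzero real
  -- element.
  have hI : ∀ z, z ∈ I := by
    obtain ⟨α, hα⟩ := hne
    obtain ⟨χ, h2, h3⟩ := exists_weight_of_mem_realRoots (h1 hα)
    obtain ⟨x, hx⟩ := exists_isCoroot (torusForm_pos hB) α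
    have h4 : (⟨χ, by simpa using h3⟩ : (cxSubalgebra 𝔱).root) ∈ I.rootSet := by
      rw [mem_rootSet_invtSubmoduleToLieIdeal]
      exact Submodule.subset_span ⟨χ, ⟨h3, α, hα, h2⟩, rfl⟩
    rw [LieIdeal.mem_rootSet] at h4
    obtain ⟨h, e, f, ht, he, hf⟩ := exists_isSl2Triple_of_weight_isNonZero h3
    have h5 : e ∈ I := h4 he
    have h6 : h ∈ I := by
      rw [← ht.lie_e_f, ← lie_skew]
      exact neg_mem (I.lie_mem h5)
    rw [ht.h_eq_coroot h3 he hf, h2.coroot_eq hB h3 hx] at h6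
    have h7 : (2 * Real.pi * Complex.I : ℂ) ≠ 0 := Complex.two_pi_I_ne_zero
    have h8 : toCx (x : 𝔤) ∈ I := by
      have h9 := I.smul_mem (2 * Real.pi * Complex.I : ℂ) h6
      change (2 * Real.pi * Complex.I : ℂ) • (1 / (2 * Real.pi * Complex.I) : ℂ) • toCx (x : 𝔤) ∈ I
        at h9
      rwa [smul_smul, mul_one_div_cancel h7, one_smul] at h9
    refine mem_ideal_of_toCx_mem I h8 ?_
    intro h9
    have h10 := hx.apply_self (torusForm_pos hB) (h1 hα).1
    have h11 : x = 0 := Subtype.ext h9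
    rw [h11, map_zero] at h10
    exact two_ne_zero h10.symm
  intro γ hγ
  by_contra h2
  obtain ⟨χ, h3, h4⟩ := exists_weight_of_mem_realRoots hγ
  have h5 : (⟨χ, by simpa using h4⟩ : (cxSubalgebra 𝔱).root) ∈ I.rootSet := by
    rw [LieIdeal.mem_rootSet]
    exact fun z _ => hI z
  rw [mem_rootSet_invtSubmoduleToLieIdeal] at h5
  -- A root outside `Φ₁` would now lie in `q`, which annihilates its coroot, although its value
  -- there is $2$.
  have h6 := hq0 χ γ h4 h3 h2 _ h5
  have h7 := root_apply_coroot h4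
  rw [← Weight.toLinear_apply] at h7
  exact two_ne_zero (h7.symm.trans h6)

end Irreducible

/-! ### Coroot lengths compared with a long root. -/

section Norms

variable {V : Type*} [AddCommGroup V] [Module ℝ V] [FiniteDimensional ℝ V]
variable {C : LinearMap.BilinForm ℝ V} (hpos : ∀ x, x ≠ 0 → 0 < C x x)
  (hsymm : ∀ x y, C x y = C y x)
include hpos hsymm

omit [FiniteDimensional ℝ V] in
/-- If a root `α` is not orthogonal to a longer root `β` whose coroot has square length `2`, the
square length of the coroot of `α` is an even integer. -/
theorem exists_form_coroot_eq {α β : Dual ℝ V} (hα : α ≠ 0) (hβ : β ≠ 0) {x y : V}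
    (hx : IsCoroot C α x) (hy : IsCoroot C β y) (hy2 : C y y = 2) (hle : 2 ≤ C x x) {m n : ℤ}
    (hm : β x = m) (hn : α y = n) (hn0 : α y ≠ 0) : ∃ l : ℤ, C x x = 2 * l := by
  have h1 := hx.form_eq hpos hα y
  have h2 := hy.form_eq hpos hβ x
  rw [hsymm y x, h1, hy2] at h2
  have h3 : C x x * n = 2 * m := by
    rw [← hm, ← hn]
    linarith
  have hcs : (C x y) ^ 2 ≤ C x x * C y y := by
    have h4 : 0 ≤ C (C x x • y - C x y • x) (C x x • y - C x y • x) := by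
      rcases eq_or_ne (C x x • y - C x y • x) 0 with h0 | h0
      · rw [h0]; simp
      · exact (hpos _ h0).le
    simp only [map_sub, map_smul, LinearMap.sub_apply, LinearMap.smul_apply, smul_eq_mul,
      hsymm y x] at h4
    have h5 := hx.self_pos hpos hα
    have h6 : 0 ≤ C x x * (C x x * C y y - (C x y) ^ 2) := by linarith
    have h7 := nonneg_of_mul_nonneg_right h6 h5
    linarith
  have hn' : (n : ℝ) ≠ 0 := by rwa [← hn]
  have hx0 := hx.self_pos hpos hα
  -- Cauchy-Schwarz with $C(y,y)=2$ and $C(x,x)\ge2$ leaves only $n=\pm1,\pm2$. For $n=\pm1$ the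
  -- relation `h3` gives $C(x,x)=\pm2m$; for $n=\pm2$ equality holds and $C(x,x)=2$.
  have hcs' : C x x * (n : ℝ) ^ 2 ≤ 8 := by
    rw [h1, hy2, hn] at hcs
    have h4 : C x x * (C x x * (n : ℝ) ^ 2) ≤ C x x * 8 := by linarith
    exact le_of_mul_le_mul_left h4 hx0
  have hn2 : n ^ 2 ≤ 4 := by
    have h4 : (n : ℝ) ^ 2 ≤ 4 := by nlinarith [sq_nonneg (n : ℝ)]
    exact_mod_cast h4
  have hn0' : n ≠ 0 := by exact_mod_cast hn'
  have h5 : n ≤ 2 := by nlinarith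
  have h6 : -2 ≤ n := by nlinarith
  have h7 : n = -2 ∨ n = -1 ∨ n = 1 ∨ n = 2 := by omega
  have hxle : n = -2 ∨ n = 2 → C x x = 2 := by
    intro h8
    have h9 : (n : ℝ) ^ 2 = 4 := by
      rcases h8 with rfl | rfl <;> norm_num
    rw [h9] at hcs'
    linarith
  rcases h7 with h7 | h7 | h7 | h7
  · exact ⟨1, by rw [hxle (Or.inl h7)]; norm_num⟩
  · refine ⟨-m, ?_⟩
    rw [h7] at h3
    push_cast at h3 ⊢
    linarith
  · refine ⟨m, ?_⟩
    rw [h7] at h3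
    push_cast at h3
    linarith
  · exact ⟨1, by rw [hxle (Or.inr h7)]; norm_num⟩

omit hsymm in
theorem exists_isLongRoot {Φ : Set (Dual ℝ V)} (hfin : Φ.Finite) (hne : Φ.Nonempty) :
    ∃ β, IsLongRoot C Φ β := by
  choose a ha using exists_isDualVector hpos
  obtain ⟨β, hβ, hmax⟩ := hfin.exists_maximalFor (fun α => C (a α) (a α)) Φ hne
  refine ⟨β, hβ, fun γ hγ b c hb hc => ?_⟩
  rw [isDualVector_unique hpos hb (ha β), isDualVector_unique hpos hc (ha γ)]
  exact le_of_not_gt fun h => h.not_ge (hmax hγ h.le)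

end Norms
end ThetaAlt

namespace ThetaAlt

open Module

/-! ### Evenness of the basic inner product on coroots. -/

section Even

open LieAlgebra LieAlgebra.IsKilling LieModule

theorem IsLongRoot.reflect {V : Type*} [AddCommGroup V] [Module ℝ V] [FiniteDimensional ℝ V]
    {C : LinearMap.BilinForm ℝ V} (hpos : ∀ x, x ≠ 0 → 0 < C x x)
    (hsymm : ∀ x y, C x y = C y x) {Φ : Set (Dual ℝ V)} {α β : Dual ℝ V} (hα : α ≠ 0)
    (hβ : IsLongRoot C Φ β) {x : V} (hx : IsCoroot C α x) (hmem : β - β x • α ∈ Φ) :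
    IsLongRoot C Φ (β - β x • α) := by
  refine ⟨hmem, fun γ hγ b' c hb' hc => ?_⟩
  obtain ⟨b, hb⟩ := exists_isDualVector hpos β
  obtain ⟨a, ha, rfl⟩ := hx
  have hapos := ha.self_pos hpos hα
  have h1 : b' = b - β ((2 / C a a) • a) • a := by
    refine isDualVector_unique hpos hb' fun v => ?_
    rw [LinearMap.map_sub₂, map_smul, LinearMap.smul_apply, ha v, hb v]
    rfl
  refine (hβ.2 γ hγ b c hb hc).trans (le_of_eq ?_)
  rw [h1, map_smul, ← hb a]
  simp only [map_sub, map_smul, LinearMap.sub_apply, LinearMap.smul_apply, smul_eq_mul, hsymm a b]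
  field_simp
  ring

variable {𝔤 : Type*} [LieRing 𝔤] [LieAlgebra ℝ 𝔤] [FiniteDimensional ℝ 𝔤] [LieAlgebra.IsSimple ℝ 𝔤]
variable {𝔱 : LieSubalgebra ℝ 𝔤}
variable {B : LinearMap.BilinForm ℝ 𝔤} (hB : IsBasicInnerProduct 𝔱 B)
variable [IsKilling ℂ (Cx 𝔤)] [(cxSubalgebra 𝔱).IsCartanSubalgebra]
include hB

/-- Every root is linked to a long root. -/
theorem exists_long_not_orthogonal {α : Dual ℝ 𝔱} (hα : α ∈ realRoots 𝔱) :
    ∃ β, IsLongRoot (torusForm B 𝔱) (realRoots 𝔱) β ∧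
      ∃ y, IsCoroot (torusForm B 𝔱) β y ∧ α y ≠ 0 := by
  have hpos := torusForm_pos hB
  have hsymm := torusForm_symm hB
  let Φ₁ : Set (Dual ℝ 𝔱) := {α | α ∈ realRoots 𝔱 ∧
    ∃ β, IsLongRoot (torusForm B 𝔱) (realRoots 𝔱) β ∧
      ∃ y, IsCoroot (torusForm B 𝔱) β y ∧ α y ≠ 0}
  have hswap : ∀ {α β : Dual ℝ 𝔱} {x y : 𝔱}, α ≠ 0 → β ≠ 0 → IsCoroot (torusForm B 𝔱) α x →
      IsCoroot (torusForm B 𝔱) β y → α y = 0 → β x = 0 := by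
    intro α β x y hα hβ hx hy h
    have h1 := hx.form_eq hpos hα y
    rw [h, mul_zero, hsymm, hy.form_eq hpos hβ] at h1
    exact (mul_eq_zero.mp h1).resolve_left (half_pos (hy.self_pos hpos hβ)).ne'
  refine (realRoots_irreducible hB (Φ₁ := Φ₁) (fun α h => h.1) ?_ ?_ hα).2
  · obtain ⟨β, hβ⟩ := exists_isLongRoot hpos (finite_realRoots hB) ⟨α, hα⟩
    obtain ⟨y, hy⟩ := exists_isCoroot hpos β
    refine ⟨β, hβ.1, β, hβ, y, hy, ?_⟩
    rw [hy.apply_self hpos hβ.1.1]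
    exact two_ne_zero
  · rintro α ⟨hα, β, hβ, y, hy, hαy⟩ γ hγ hγ1 x hx
    -- Suppose `γ` is orthogonal to every long root but not to `α`. It is orthogonal to `β` and to
    -- its reflection $\beta-\beta(\alpha^\vee)\alpha$, which forces $\beta(\alpha^\vee)=0$, against
    -- the choice of `β`.
    by_contra h0
    obtain ⟨z, hz⟩ := exists_isCoroot hpos α
    have hmem := realRoots_refl hB hα hβ.1 hz
    have hlong := hβ.reflect hpos hsymm hα.1 hz hmem
    obtain ⟨y', hy'⟩ := exists_isCoroot hpos (β - β z • α)
    have hort : ∀ {β : Dual ℝ 𝔱} {y : 𝔱}, IsLongRoot (torusForm B 𝔱) (realRoots 𝔱) β →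
        IsCoroot (torusForm B 𝔱) β y → β x = 0 := by
      intro β y hβ hy
      refine hswap hγ.1 hβ.1.1 hx hy ?_
      by_contra h1
      exact hγ1 ⟨hγ, β, hβ, y, hy, h1⟩
    have h1 := hort hβ hy
    have h2 := hort hlong hy'
    rw [LinearMap.sub_apply, LinearMap.smul_apply, h1, zero_sub, neg_eq_zero, smul_eq_mul,
      mul_eq_zero, or_iff_left h0] at h2
    exact hαy (hswap hβ.1.1 hα.1 hy hz h2)

/-- The square lengths of the coroots with respect to the basic inner product are even. -/
theorem exists_form_coroot_even {α : Dual ℝ 𝔱} (hα : α ∈ realRoots 𝔱) {x : 𝔱}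
    (hx : IsCoroot (torusForm B 𝔱) α x) : ∃ m : ℤ, torusForm B 𝔱 x x = 2 * m := by
  have hpos := torusForm_pos hB
  obtain ⟨β, hβ, y, hy, hαy⟩ := exists_long_not_orthogonal hB hα
  have hy2 : torusForm B 𝔱 y y = 2 := hB.normalized β hβ y hy
  obtain ⟨m, hm⟩ := realRoots_integral hB hα hβ.1 hx
  obtain ⟨n, hn⟩ := realRoots_integral hB hβ.1 hα hy
  obtain ⟨a, ha⟩ := exists_isDualVector hpos α
  obtain ⟨b, hb⟩ := exists_isDualVector hpos β
  refine exists_form_coroot_eq hpos (torusForm_symm hB) hα.1 hβ.1.1 hx hy hy2 ?_ hm hn hαy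
  have h1 := hβ.2 α hα b a hb ha
  have h2 := hx.form_self_mul hpos hα.1 ha
  have h3 := hy.form_self_mul hpos hβ.1.1 hb
  have h4 := ha.self_pos hpos hα.1
  rw [hy2] at h3
  nlinarith

end Even

/-! ### From an abstract positive definite form to a Euclidean space. -/

section Transfer

variable {V : Type*} [AddCommGroup V] [Module ℝ V] [FiniteDimensional ℝ V]

/-- The theorem for a reduced crystallographic root system whose coroots have even square length. -/
theorem exists_basis_chi_of_root_system {C : LinearMap.BilinForm ℝ V}
    (hpos : ∀ x, x ≠ 0 → 0 < C x x) (hsymm : ∀ x y, C x y = C y x) {Φ Φp : Set (Dual ℝ V)}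
    (hfin : Φ.Finite) (h0 : 0 ∉ Φ) (hspan : Submodule.span ℝ Φ = ⊤)
    (hrefl : ∀ α ∈ Φ, ∀ β ∈ Φ, ∀ x, IsCoroot C α x → β - β x • α ∈ Φ)
    (hint : ∀ α ∈ Φ, ∀ β ∈ Φ, ∀ x, IsCoroot C α x → ∃ m : ℤ, β x = m)
    (hred : ∀ α ∈ Φ, ∀ c : ℝ, c • α ∈ Φ → c = 1 ∨ c = -1)
    (hnorm : ∀ α ∈ Φ, ∀ x, IsCoroot C α x → ∃ m : ℤ, C x x = 2 * m)
    {α₀ : Dual ℝ V} (hp : IsPositiveSystem Φ Φp) (hα₀ : IsHighestRoot Φ Φp α₀)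
    (τ : UpperHalfPlane) {k : ℕ} (hk : 0 < k) :
    Finite (weylGroup C Φ) ∧
    (∀ (μ : V) (x : V × V),
      Summable (fun γ : corootLattice C Φ => thetaTerm C τ k (μ + (γ : V)) x)) ∧
    ∃ b : Basis ↥(alcove Φp α₀ ∩ scaledDualLattice C Φ k) ℂ (altHolSections C Φ τ k),
      ∀ μ, (b μ : V × V → ℂ) = chi C Φ τ k (μ : V) := by
  -- Taking `C` itself as the inner product makes the compatibility `form_eq` definitional.
  let core : InnerProductSpace.Core ℝ V :=
    { inner := fun x y => C x y
      conj_inner_symm := fun x y => hsymm y x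
      re_inner_nonneg := fun x => by
        rcases eq_or_ne x 0 with rfl | hx
        · simp
        · exact (hpos x hx).le
      add_left := fun x y z => by simp
      smul_left := fun x y r => by simp
      definite := fun x hx => by
        by_contra h1
        exact (hpos x h1).ne' hx }
  let : NormedAddCommGroup V := core.toNormedAddCommGroup
  let : InnerProductSpace ℝ V := InnerProductSpace.ofCore core.toCore
  have hform : ∀ x y, C x y = inner ℝ x y := fun _ _ => rfl
  have hcoroot : ∀ α : Dual ℝ V, IsCoroot C α (corootVec α) := by
    intro α
    refine ⟨dualVec α, fun v => ?_, ?_⟩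
    · rw [hform, inner_dualVec]
    · rw [corootVec, hform]
  have h : IsRootData C Φ :=
    { form_eq := hform
      finite := hfin
      zero_notMem := h0
      span_eq := hspan
      refl := fun α hα β hβ => hrefl α hα β hβ _ (hcoroot α)
      integral := fun α hα β hβ => hint α hα β hβ _ (hcoroot α)
      reduced := hred
      norm := fun α hα => hnorm α hα _ (hcoroot α) }
  have : DiscreteTopology (corootLattice C Φ) := h.discreteTopology_lattice
  exact ⟨h.finite_weylGroup, fun μ x => summable_thetaTerm hform _ τ hk μ x,
    h.exists_basis_chi hp hα₀ hk⟩

end Transfer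
end ThetaAlt

theorem mainTheorem8 {𝔤 : Type*} [LieRing 𝔤] [LieAlgebra ℝ 𝔤] [FiniteDimensional ℝ 𝔤]
    [LieAlgebra.IsSimple ℝ 𝔤]
    (hcompact : ∀ x : 𝔤, x ≠ 0 → killingForm ℝ 𝔤 x x < 0)
    (𝔱 : LieSubalgebra ℝ 𝔤)
    (h𝔱 : Maximal (fun 𝔥 : LieSubalgebra ℝ 𝔤 => IsLieAbelian 𝔥) 𝔱)
    (B : LinearMap.BilinForm ℝ 𝔤) (hB : ThetaAlt.IsBasicInnerProduct 𝔱 B)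
    (Δp : Set (Module.Dual ℝ 𝔱))
    (hΔp : ThetaAlt.IsPositiveSystem (ThetaAlt.realRoots 𝔱) Δp)
    (α₀ : Module.Dual ℝ 𝔱)
    (hα₀ : ThetaAlt.IsHighestRoot (ThetaAlt.realRoots 𝔱) Δp α₀)
    (τ : UpperHalfPlane) (k : ℕ) (hk : 0 < k) :
    Finite (ThetaAlt.weylGroup (ThetaAlt.torusForm B 𝔱) (ThetaAlt.realRoots 𝔱)) ∧
    (∀ (μ : 𝔱) (x : 𝔱 × 𝔱),
      Summable (fun γ : ThetaAlt.corootLattice (ThetaAlt.torusForm B 𝔱) (ThetaAlt.realRoots 𝔱) =>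
        ThetaAlt.thetaTerm (ThetaAlt.torusForm B 𝔱) τ k (μ + (γ : 𝔱)) x)) ∧
    ∃ b : Module.Basis
        ↥(ThetaAlt.alcove Δp α₀ ∩
          ThetaAlt.scaledDualLattice (ThetaAlt.torusForm B 𝔱) (ThetaAlt.realRoots 𝔱) k)
        ℂ (ThetaAlt.altHolSections (ThetaAlt.torusForm B 𝔱) (ThetaAlt.realRoots 𝔱) τ k),
      ∀ μ, (b μ : 𝔱 × 𝔱 → ℂ) =
        ThetaAlt.chi (ThetaAlt.torusForm B 𝔱) (ThetaAlt.realRoots 𝔱) τ k (μ : 𝔱) := by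
  have := ThetaAlt.isKilling_complexification hcompact
  have := ThetaAlt.isCartanSubalgebra_cxSubalgebra h𝔱 hB
  exact ThetaAlt.exists_basis_chi_of_root_system (ThetaAlt.torusForm_pos hB)
    (ThetaAlt.torusForm_symm hB) (ThetaAlt.finite_realRoots hB) (fun h => h.1 rfl)
    (ThetaAlt.span_realRoots hB) (fun _ hα _ hβ _ hx => ThetaAlt.realRoots_refl hB hα hβ hx)
    (fun _ hα _ hβ _ hx => ThetaAlt.realRoots_integral hB hα hβ hx)
    (fun _ hα _ hc => ThetaAlt.realRoots_reduced hα hc)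
    (fun _ hα _ hx => ThetaAlt.exists_form_coroot_even hB hα hx) hΔp hα₀ τ hk
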